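/- **Theorem (first binary Darboux transformation).** Let $n,N\ge 0$ be integers, $T\subseteq\mathbb R$ open, and $\alpha,\eta,\xi_1,\lambda_1,\dots,\lambda_N\in\mathbb R$. All functions below are functions of $x\in\mathbb R$, $t\in T$, and are $C^\infty$ jointly in $(x,t)$. Write $\partial=\partial/\partial x$ and $(\partial^{-1}h)(x,t)=\int_{-\infty}^x h(y,t)\,dy$. Notation. Let $b_0=0$, $b_1=1$, $b_{k+1}=Lb_k$ for $k\ge1$, where $L=-\tfrac14\partial^2-u+\tfrac12\partial^{-1}u_x$ acts on differential polynomials in $u$ (here $\partial^{-1}$ is the primitive without constant term), let $a_k=-\tfrac12\partial b_k$, and $A^{(n)}(u,\lambda)=\sum_{i=0}^{n+1}(a_i+b_i\partial)\lambda^{n+1-i}$. Say that a product $pq$ *decays* if every $t_0\in T$ has a neighbourhood $I$ and an integrable function $g$ on $(-\infty,0]$ with $|p(x,t)q(x,t)|\le g(x)$ for $x\le0$, $t\in I$. A *solution of the $n$-th KdV equation with self-consistent sources* is a tuple of real functions $u,\phi_1,\dots,\phi_N$ such that every $\partial^k u$ ($k\ge0$) is bounded on $x\le 0$ locally uniformly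 in $t$, and $$u_t=\partial\Big[-2b_{n+2}(u)-2\alpha\sum_{j=1}^N\phi_j^2\Big],\qquad \phi_{j,xx}+(\lambda_j+u)\phi_j=0\quad(1\le j\le N).\tag{1}$$ A *solution of its Lax pair at $\lambda$* (real or complex) is a real or complex function $\psi$ such that all products $\phi_j\psi$ decay and $$\psi_{xx}+(\lambda+u)\psi=0,\qquad \psi_t=A^{(n)}(u,\lambda)\psi+\eta\psi+\alpha\sum_{j=1}^N\phi_j\,\partial^{-1}(\phi_j\psi).\tag{2}$$ Let $u,\phi_1,\dots,\phi_N$ be such a solution of (1), and let $f_1$ be a real solution of its Lax pair at $\lambda=\xi_1$ such that $f_1^2$ decays and $f_1(\cdot,t)\not\equiv0$ for every $t\in T$. Put $$\bar u=u+2\partial^2\ln(\partial^{-1}f_1^2),\qquad \bar\phi_j=\phi_j-\frac{f_1}{\partial^{-1}f_1^2}\,\partial^{-1}(f_1\phi_j)\quad(1\le j\le N).$$ Then: 1. (Covariance of the Lax pair.) For every $\lambda$ and every solution $\psi$ of the Lax pair at $\lambda$ such that $f_1\psi$ decays, the function $\bar\psi=\psi-\dfrac{f_1}{\partial^{-1}f_1^2}\,\partial^{-1}(f_1\psi)$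 is a solution of the Lax pair at $\lambda$, with the same $n,N,\alpha,\eta$, belonging to $\bar u,\bar\phi_1,\dots,\bar\phi_N$: it is smooth, all products $\bar\phi_j\bar\psi$ decay, and $$\bar\psi_{xx}+(\lambda+\bar u)\bar\psi=0,\qquad \bar\psi_t=A^{(n)}(\bar u,\lambda)\bar\psi+\eta\bar\psi+\alpha\sum_{j=1}^N\bar\phi_j\,\partial^{-1}(\bar\phi_j\bar\psi).$$ 2. (Auto-Bäcklund transformation.) $\bar u,\bar\phi_1,\dots,\bar\phi_N$ is a solution, in the same sense, of the same $n$-th KdV equation with self-consistent sources (1), with the same $N$, $\alpha$ and $\lambda_1,\dots,\lambda_N$. -/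

import Mathlib

open Set Filter Topology MeasureTheory
open scoped ContDiff

namespace KdVSources

noncomputable section

/-! Fields are functions `h x t` of position `x` and time `t`, in this order. -/

/-- Differential polynomials with real coefficients in one unknown function `u`:
the variable `X k` stands for the `k`-th derivative of `u` with respect to `x`. -/
abbrev DiffPoly : Type := MvPolynomial ℕ ℝ

/-- The total derivative `∂` on differential polynomials: `∂ u⁽ᵏ⁾ = u⁽ᵏ⁺¹⁾`. -/
def totalD : Derivation ℝ DiffPoly DiffPoly :=
  MvPolynomial.mkDerivation ℝ (fun k => MvPolynomial.X (k + 1))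

open Classical in
/-- The inverse `∂⁻¹` on differential polynomials: the primitive without constant term
(and `0` where there is no primitive; see `exists_primitive_bPoly`). -/
def totalDInv (p : DiffPoly) : DiffPoly :=
  if h : ∃ q : DiffPoly, totalD q = p ∧ MvPolynomial.constantCoeff q = 0
  then h.choose else 0

/-- The recursion operator `L = -1/4 ∂² - u + 1/2 ∂⁻¹ u_x`. -/
def lenardL (p : DiffPoly) : DiffPoly :=
  (-(1 / 4) : ℝ) • totalD (totalD p) - MvPolynomial.X 0 * p
    + (1 / 2 : ℝ) • totalDInv (MvPolynomial.X 1 * p)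

/-- The coefficients `b_k`: `b_0 = 0`, `b_1 = 1`, `b_{k+1} = L b_k` for `k ≥ 1`. -/
def bPoly : ℕ → DiffPoly
  | 0 => 0
  | 1 => 1
  | k + 2 => lenardL (bPoly (k + 1))

/-- The coefficients `a_k = -1/2 ∂ b_k`. -/
def aPoly (k : ℕ) : DiffPoly := (-(1 / 2) : ℝ) • totalD (bPoly k)

/-- The value at `(x, t)` of a differential polynomial in the function `u`. -/
def DiffPoly.at (P : DiffPoly) (u : ℝ → ℝ → ℝ) (x t : ℝ) : ℝ :=
  MvPolynomial.eval (fun k => iteratedDeriv k (fun y => u y t) x) P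

/-- `(∂⁻¹ h)(x, t) = ∫_{-∞}^x h(y, t) dy`. -/
def integralFromNegInf {E : Type*} [NormedAddCommGroup E] [NormedSpace ℝ E]
    (h : ℝ → ℝ → E) (x t : ℝ) : E :=
  ∫ y in Iic x, h y t

/-- `A⁽ⁿ⁾(u, μ) ψ = ∑_{i=0}^{n+1} μ^{n+1-i} (a_i ψ + b_i ψ_x)`, for a real potential `u` and a
real or complex function `ψ` and spectral parameter `μ`. -/
def opA {𝕜 : Type*} [RCLike 𝕜] (n : ℕ) (u : ℝ → ℝ → ℝ) (μ : 𝕜) (ψ : ℝ → ℝ → 𝕜) (x t : ℝ) : 𝕜 :=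
  ∑ i ∈ Finset.range (n + 2), μ ^ (n + 1 - i) *
    ((aPoly i).at u x t • ψ x t + (bPoly i).at u x t • deriv (fun y => ψ y t) x)

/-- `B_N ψ = α ∑_j φ_j ∂⁻¹(φ_j ψ)`. -/
def opB {𝕜 : Type*} [RCLike 𝕜] {N : ℕ} (α : ℝ) (φ : Fin N → ℝ → ℝ → ℝ) (ψ : ℝ → ℝ → 𝕜)
    (x t : ℝ) : 𝕜 :=
  α • ∑ j, φ j x t • integralFromNegInf (fun y s => φ j y s • ψ y s) x t

/-- `h` is smooth jointly in `x ∈ ℝ` and `t ∈ T`. -/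
def SmoothField {E : Type*} [NormedAddCommGroup E] [NormedSpace ℝ E] (T : Set ℝ)
    (h : ℝ → ℝ → E) : Prop :=
  ContDiffOn ℝ ∞ (fun z : ℝ × ℝ => h z.1 z.2) (univ ×ˢ T)

/-- All `x`-derivatives of `u` (including `u`) are bounded on `x ≤ 0`, locally uniformly in
`t ∈ T`. -/
def BoundedDerivsAtNegInf (T : Set ℝ) (u : ℝ → ℝ → ℝ) : Prop :=
  ∀ k : ℕ, ∀ t₀ ∈ T, ∃ C : ℝ, ∀ᶠ t in 𝓝 t₀, ∀ x ≤ 0, |iteratedDeriv k (fun y => u y t) x| ≤ C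

/-- The product `p q` decays as `x → -∞`, so that `∂⁻¹(p q)` makes sense: it is dominated on
`x ≤ 0` by an integrable function of `x`, locally uniformly in `t ∈ T`. -/
def DecayingProduct {E : Type*} [NormedAddCommGroup E] [NormedSpace ℝ E] (T : Set ℝ)
    (p : ℝ → ℝ → ℝ) (q : ℝ → ℝ → E) : Prop :=
  ∀ t₀ ∈ T, ∃ g : ℝ → ℝ, IntegrableOn g (Iic 0) volume ∧
    ∀ᶠ t in 𝓝 t₀, ∀ x ≤ 0, ‖p x t • q x t‖ ≤ g x

/-- `u, φ_1, …, φ_N` solve on `ℝ × T` the `n`-th KdV equation with self-consistent sources with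
coupling constant `α` and eigenvalues `lam_1, …, lam_N`. -/
structure IsKdVSourceSolution (T : Set ℝ) (n : ℕ) {N : ℕ} (α : ℝ) (lam : Fin N → ℝ)
    (u : ℝ → ℝ → ℝ) (φ : Fin N → ℝ → ℝ → ℝ) : Prop where
  smooth_u : SmoothField T u
  smooth_φ : ∀ j, SmoothField T (φ j)
  bounded_u : BoundedDerivsAtNegInf T u
  evolution : ∀ x, ∀ t ∈ T, deriv (fun s => u x s) t =
    deriv (fun y => -2 * (bPoly (n + 2)).at u y t - 2 * α * ∑ j, φ j y t ^ 2) x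
  source : ∀ j, ∀ x, ∀ t ∈ T,
    iteratedDeriv 2 (fun y => φ j y t) x + (lam j + u x t) * φ j x t = 0

/-- `ψ` solves on `ℝ × T`, with spectral parameter `μ`, the Lax pair
`ψ_xx + (μ + u) ψ = 0`, `ψ_t = A⁽ⁿ⁾(u, μ) ψ + η ψ + B_N ψ`, all the products `φ_j ψ` decaying
as `x → -∞`. -/
structure IsLaxSolution {𝕜 : Type*} [RCLike 𝕜] (T : Set ℝ) (n : ℕ) {N : ℕ} (α η : ℝ)
    (u : ℝ → ℝ → ℝ) (φ : Fin N → ℝ → ℝ → ℝ) (μ : 𝕜) (ψ : ℝ → ℝ → 𝕜) : Prop where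
  smooth : SmoothField T ψ
  decay : ∀ j, DecayingProduct T (φ j) ψ
  spectral : ∀ x, ∀ t ∈ T,
    iteratedDeriv 2 (fun y => ψ y t) x + (μ + ((u x t : ℝ) : 𝕜)) * ψ x t = 0
  evolution : ∀ x, ∀ t ∈ T,
    deriv (fun s => ψ x s) t = opA n u μ ψ x t + η • ψ x t + opB α φ ψ x t

/-- `q ↦ q - (f / ∂⁻¹f²) ∂⁻¹(f q)`: the first binary Darboux transformation generated by `f`,
on wave functions and sources. -/
def binaryDarboux {E : Type*} [NormedAddCommGroup E] [NormedSpace ℝ E]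
    (f : ℝ → ℝ → ℝ) (q : ℝ → ℝ → E) (x t : ℝ) : E :=
  q x t - (f x t / integralFromNegInf (fun y s => f y s ^ 2) x t) •
    integralFromNegInf (fun y s => f y s • q y s) x t

/-- `u ↦ u + 2 ∂² ln (∂⁻¹f²)`: the first binary Darboux transformation generated by `f`,
on potentials. -/
def binaryDarbouxPotential (f u : ℝ → ℝ → ℝ) (x t : ℝ) : ℝ :=
  u x t + 2 * iteratedDeriv 2
    (fun y => Real.log (integralFromNegInf (fun y' s => f y' s ^ 2) y t)) x

/-! The coefficients `b_k` are well defined: every `∂⁻¹` in their recursion is a genuine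
primitive. -/

theorem totalDInv_spec {p : DiffPoly} (h : ∃ q, totalD q = p) :
    totalD (totalDInv p) = p ∧ MvPolynomial.constantCoeff (totalDInv p) = 0 := by
  have h' : ∃ q : DiffPoly, totalD q = p ∧ MvPolynomial.constantCoeff q = 0 := by
    obtain ⟨q, hq⟩ := h
    refine ⟨q - MvPolynomial.C (MvPolynomial.constantCoeff q), ?_, by simp⟩
    simp [totalD] at hq ⊢
    exact hq
  unfold totalDInv
  rw [dif_pos h']
  exact h'.choose_spec

theorem totalD_X (k : ℕ) : totalD (MvPolynomial.X k) = MvPolynomial.X (k + 1) := by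
  simp [totalD, MvPolynomial.mkDerivation_X]

theorem totalD_C (a : ℝ) : totalD (MvPolynomial.C a) = 0 := by
  simp [totalD]

/-- Differentiated form of `L`. -/
def lenardK (p : DiffPoly) : DiffPoly :=
  (-(1 / 4) : ℝ) • totalD (totalD (totalD p)) - MvPolynomial.X 0 * totalD p
    - (1 / 2 : ℝ) • (MvPolynomial.X 1 * p)

theorem totalD_lenardL {p : DiffPoly} (h : ∃ q, totalD q = MvPolynomial.X 1 * p) :
    totalD (lenardL p) = lenardK p := by
  have h1 := (totalDInv_spec h).1
  simp only [lenardL, lenardK, map_add, map_sub, h1, Derivation.leibniz, totalD_X, totalD_C,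
    smul_eq_mul, MvPolynomial.smul_eq_C_mul]
  have : (MvPolynomial.C (1 / 2 : ℝ) : DiffPoly) + MvPolynomial.C (1 / 2 : ℝ) = 1 := by
    rw [← MvPolynomial.C_add]; norm_num
  linear_combination (MvPolynomial.X 1 * p) * this

theorem lenardK_skew (p q : DiffPoly) : ∃ r, totalD r = p * lenardK q + q * lenardK p := by
  refine ⟨(-(1 / 4) : ℝ) • (p * totalD (totalD q) + q * totalD (totalD p) - totalD p * totalD q)
    - MvPolynomial.X 0 * p * q, ?_⟩
  simp only [lenardK, map_add, map_sub, Derivation.leibniz, totalD_X, totalD_C,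
    smul_eq_mul, MvPolynomial.smul_eq_C_mul]
  have : (MvPolynomial.C (1 / 2 : ℝ) : DiffPoly) + MvPolynomial.C (1 / 2 : ℝ) = 1 := by
    rw [← MvPolynomial.C_add]; norm_num
  linear_combination (MvPolynomial.X 1 * p * q) * this

theorem bPoly_two : totalD (bPoly 2) = (-(1 / 2) : ℝ) • MvPolynomial.X 1 := by
  rw [bPoly, bPoly, totalD_lenardL ⟨MvPolynomial.X 0, by simp [totalD_X]⟩]
  simp [lenardK, neg_smul]

theorem exists_primitive_bPoly (k : ℕ) :
    ∃ q, totalD q = MvPolynomial.X 1 * bPoly k := by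
  induction k using Nat.strong_induction_on with
  | _ k ih =>
    have hL : ∀ i < k, totalD (bPoly (i + 1)) = lenardK (bPoly i) := by
      intro i hi
      match i with
      | 0 => simp [bPoly, lenardK]
      | i + 1 => exact totalD_lenardL (ih _ hi)
    match k with
    | 0 => exact ⟨0, by simp [bPoly]⟩
    | 1 => exact ⟨MvPolynomial.X 0, by simp [bPoly, totalD_X]⟩
    | m + 2 =>
      have shift : ∀ i < m + 2, ∀ j < m + 2, ∃ r,
          totalD r = bPoly i * totalD (bPoly (j + 1)) - bPoly (i + 1) * totalD (bPoly j) := by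
        intro i hi j hj
        obtain ⟨r, hr⟩ := lenardK_skew (bPoly i) (bPoly j)
        refine ⟨r - bPoly (i + 1) * bPoly j, ?_⟩
        rw [map_sub, hr, Derivation.leibniz, hL i hi, hL j hj]
        simp only [smul_eq_mul]
        ring
      have chain : ∀ d ≤ m, ∃ r, totalD r =
          bPoly (m + 2 - d) * totalD (bPoly (2 + d)) - bPoly (m + 2) * totalD (bPoly 2) := by
        intro d
        induction d with
        | zero => exact fun _ => ⟨0, by simp⟩
        | succ d ihd =>
          intro hd
          obtain ⟨r, hr⟩ := ihd (by omega)
          obtain ⟨s, hs⟩ := shift (m + 2 - (d + 1)) (by omega) (2 + d) (by omega)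
          refine ⟨r + s, ?_⟩
          rw [map_add, hr, hs, show m + 2 - (d + 1) + 1 = m + 2 - d by omega,
            show 2 + d + 1 = 2 + (d + 1) by omega]
          ring
      obtain ⟨r, hr⟩ := chain m le_rfl
      rw [show m + 2 - m = 2 by omega, show 2 + m = m + 2 by omega] at hr
      refine ⟨r - bPoly 2 * bPoly (m + 2), ?_⟩
      rw [map_sub, hr, Derivation.leibniz, bPoly_two]
      simp only [smul_eq_mul, MvPolynomial.smul_eq_C_mul]
      have : (MvPolynomial.C (-(1 / 2) : ℝ) : DiffPoly) + MvPolynomial.C (-(1 / 2) : ℝ) = -1 := by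
        rw [← MvPolynomial.C_add]; norm_num
      linear_combination (-(MvPolynomial.X 1 * bPoly (m + 2))) * this

end

end KdVSources

open KdVSources

/-! Write f for the seed, τ = ∂⁻¹f², s = 1/τ, W for the Wronskian, and bars for transforms. The
proof turns the nonlocal quantities into local ones and then verifies polynomial identities.

Locality. If p, q solve the spectral equation at λ, μ, then W(p, q) has x-derivative (λ - μ)pq. It
vanishes at -∞ when pq decays, so (λ - μ) ∂⁻¹(pq) = W(p, q) (`wronskian_eq`). For μ ≠ ξ this makes
∂⁻¹(fψ) a local expression; for μ = ξ it makes ψ a multiple of f at each time, so that the transform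
of ψ is 0.

Algebra. Let A_k be the truncations of the evolution operator, the full one being A_{n+2}. There is
a quadratic form θ_k in (f, f_x), with differential polynomials as coefficients, such that ∂θ_k = 2
f A_k f, and b_k(ū) = b_k(u) - ∂(θ_k s) (`ExtPoly.darbouxHom_bPoly`). The recursion fixes ∂b_{k+1},
and only constants are killed by ∂ in the polynomial ring generated by the u⁽ᵏ⁾, f, f_x, s, so an
induction on k works.

Time. The Lax pair gives τ_t = θ_{n+2} + 2ητ + α ∑ (∂⁻¹(fφ_j))². Dividing by τ and differentiating,
∂(ln τ)_t = b_{n+2}(u) - b_{n+2}(ū) + α ∑ (φ_j² - φ̄_j²). One more derivative is the evolution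
equation for ū; no compatibility condition of the Lax pair is needed. For the wave functions,
`IsSeed.opM_darboux` is the covariance of the local flow, and the source terms transform by ∂⁻¹(p̄
q̄) = ∂⁻¹(pq) - s ∂⁻¹(fp) ∂⁻¹(fq).

Analysis. Decay is assumed for products of functions only, not of their derivatives. Solutions of
y'' = -(λ + u) y with u bounded are nearly affine on short intervals, so a few sampled values
control the first jet. This gives decay of products of first jets (`jet_mul_jet_dominated`) and |f|²
+ |f_x|² ≤ C τ (`IsSeed.jet_sq_le_tau`). These two bounds supply the vanishing boundary terms, the
differentiation under the integral and the boundedness of ū. -/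

namespace KdVSources

noncomputable section

/-! ### Differential algebra of the recursion -/

/-- Induction step for the transformed b_k, in an abstract differential algebra. Here θ and θn stand
for θ_k s and θ_{k+1} s, G for G_k and b for b_k. If β = b - ∂θ, the recursion with the new
potential U sends β to the image of b under the old recursion, minus 4 ∂²θn. The certificate is the
second derivative of `hn` together with f²s times the derivative of `hb`. -/
theorem darboux_identity {A : Type*} [CommRing A] [Algebra ℝ A] (D : Derivation ℝ A A)
    {ξ u f g s θ b G θn U β : A} (hξ : D ξ = 0)
    (hf : D f = g) (hg : D g = - (ξ + u) * f) (hs : D s = - (f * f * s * s))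
    (hθ : D θ = 2 * G * f * g * s - D G * f * f * s - f * f * s * θ)
    (hb : 4 * D b = - D (D (D G)) - 4 * (u + ξ) * D G - 2 * D u * G)
    (hn : 2 * θn = 2 * (ξ * θ + b * f * f * s + G * g * g * s - D G * f * g * s
      + (ξ + u) * G * f * f * s) + D (D G) * f * f * s)
    (hU : U = u + 2 * D (f * f * s)) (hβ : β = b - D θ) :
    - D (D (D β)) - 4 * U * D β - 2 * D U * β + 4 * D (D θn)
      = - D (D (D b)) - 4 * u * D b - 2 * D u * b := by
  have h2 : D (2 : A) = 0 := D.map_natCast 2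
  have h4 : D (4 : A) = 0 := D.map_natCast 4
  have hDb := congrArg D hb
  have hn1 := congrArg D hn
  simp only [map_add, map_sub, map_neg, Derivation.leibniz, smul_eq_mul, hξ, h2, h4, hf, hg, hs,
    hθ] at hDb hn1
  have hn2 := congrArg D hn1
  simp only [map_add, map_sub, map_neg, Derivation.leibniz, smul_eq_mul, hξ, h2, hf, hg, hs,
    hθ, map_zero] at hn2
  simp only [hU, hβ, map_add, map_sub, map_neg, Derivation.leibniz, smul_eq_mul, hξ, h2,
    hf, hg, hs, hθ, map_zero]
  linear_combination 2 * hn2 + f * f * s * hDb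

/-- Induction step for ∂θ_k = 2 f A_k f, where A_k f = G_k f_x - ½ (∂G_k) f and G_{k+1} = ξ G_k +
b_k. -/
theorem quadratic_primitive_identity {A : Type*} [CommRing A] [Algebra ℝ A]
    (D : Derivation ℝ A A) {ξ u f g θ b G θn : A} (hξ : D ξ = 0)
    (hf : D f = g) (hg : D g = - (ξ + u) * f)
    (hθ : D θ = 2 * G * f * g - D G * f * f)
    (hb : 4 * D b = - D (D (D G)) - 4 * (u + ξ) * D G - 2 * D u * G)
    (hn : 2 * θn = 2 * (ξ * θ + b * f * f + G * g * g - D G * f * g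
      + (ξ + u) * G * f * f) + D (D G) * f * f) :
    2 * D θn = 2 * (2 * (ξ * G + b) * f * g - D (ξ * G + b) * f * f) := by
  have h2 : D (2 : A) = 0 := D.map_natCast 2
  have hn1 := congrArg D hn
  simp only [map_add, map_sub, Derivation.leibniz, smul_eq_mul, hξ, h2, hf, hg, hθ] at hn1
  simp only [map_add, Derivation.leibniz, smul_eq_mul, hξ]
  linear_combination hn1 + f * f * hb

theorem totalD_bPoly_succ (k : ℕ) : totalD (bPoly (k + 1)) = lenardK (bPoly k) := by
  cases k with
  | zero => simp [bPoly, lenardK]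
  | succ k => exact totalD_lenardL (exists_primitive_bPoly _)

theorem four_mul_totalD_bPoly_succ (k : ℕ) : 4 * totalD (bPoly (k + 1)) =
    - totalD (totalD (totalD (bPoly k))) - 4 * MvPolynomial.X 0 * totalD (bPoly k)
      - 2 * MvPolynomial.X 1 * bPoly k := by
  rw [totalD_bPoly_succ, lenardK]
  simp only [MvPolynomial.smul_eq_C_mul]
  have h1 : (4 : DiffPoly) * MvPolynomial.C (-(1 / 4) : ℝ) = -1 := by
    rw [show (4 : DiffPoly) = MvPolynomial.C 4 from (map_ofNat MvPolynomial.C 4).symm,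
      ← MvPolynomial.C_mul]
    norm_num
  have h2 : (4 : DiffPoly) * MvPolynomial.C (1 / 2 : ℝ) = 2 := by
    rw [show (4 : DiffPoly) = MvPolynomial.C 4 from (map_ofNat MvPolynomial.C 4).symm,
      ← MvPolynomial.C_mul, ← map_ofNat (MvPolynomial.C (σ := ℕ) (R := ℝ)) 2]
    norm_num
  linear_combination totalD (totalD (totalD (bPoly k))) * h1 -
    MvPolynomial.X 1 * bPoly k * h2

/-- The partial sums `∑_{i<k} b_i ξ^{k-1-i}` of the generating series of the `b_i`. -/
def gPoly (ξ : ℝ) : ℕ → DiffPoly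
  | 0 => 0
  | k + 1 => MvPolynomial.C ξ * gPoly ξ k + bPoly k

/-- The recursion telescopes: replacing u by u + ξ in the operator -(∂³ + 4u∂ + 2u_x) subtracts 4ξ∂,
which cancels the term ξ·4∂b_k coming from ξ G_k. -/
theorem four_mul_totalD_bPoly (ξ : ℝ) (k : ℕ) : 4 * totalD (bPoly k) =
    - totalD (totalD (totalD (gPoly ξ k)))
      - 4 * (MvPolynomial.X 0 + MvPolynomial.C ξ) * totalD (gPoly ξ k)
      - 2 * totalD (MvPolynomial.X 0) * gPoly ξ k := by
  induction k with
  | zero => simp [bPoly, gPoly]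
  | succ k ih =>
    have := four_mul_totalD_bPoly_succ k
    simp only [totalD_X] at ih
    simp only [gPoly, map_add, Derivation.leibniz, totalD_C, smul_eq_mul, mul_zero, add_zero,
      totalD_X]
    linear_combination this + MvPolynomial.C ξ * ih

/-- The coefficient of `f²` in the primitive of `2 f A f`. -/
def thetaXX (ξ : ℝ) : ℕ → DiffPoly
  | 0 => 0
  | k + 1 => MvPolynomial.C ξ * thetaXX ξ k + bPoly k
      + (MvPolynomial.C ξ + MvPolynomial.X 0) * gPoly ξ k
      + MvPolynomial.C (1 / 2) * totalD (totalD (gPoly ξ k))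

/-- The coefficient of `f f_x` in the primitive of `2 f A f`. -/
def thetaXY (ξ : ℝ) : ℕ → DiffPoly
  | 0 => 0
  | k + 1 => MvPolynomial.C ξ * thetaXY ξ k - totalD (gPoly ξ k)

/-- The coefficient of `f_x²` in the primitive of `2 f A f`. -/
def thetaYY (ξ : ℝ) : ℕ → DiffPoly
  | 0 => 0
  | k + 1 => MvPolynomial.C ξ * thetaYY ξ k + gPoly ξ k

/-- Differential polynomials in `u`, together with a solution `f` of `f_xx + (ξ + u) f = 0`,
its derivative, and `s = 1/∂⁻¹f²`. -/
abbrev ExtPoly : Type := MvPolynomial (ℕ ⊕ Fin 3) ℝ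

/-! ### The kernel of the total derivative, and the Darboux transform of the b_k -/

namespace ExtPoly

def U (k : ℕ) : ExtPoly := MvPolynomial.X (Sum.inl k)
def F : ExtPoly := MvPolynomial.X (Sum.inr 0)
def G : ExtPoly := MvPolynomial.X (Sum.inr 1)
def S : ExtPoly := MvPolynomial.X (Sum.inr 2)

/-- The derivatives of the generators. -/
def dGen (ξ : ℝ) : ℕ ⊕ Fin 3 → ExtPoly :=
  Sum.elim (fun k => U (k + 1))
    ![G, - (MvPolynomial.C ξ + U 0) * F, - (F * F * S * S)]

/-- The total derivative. -/
def D (ξ : ℝ) : Derivation ℝ ExtPoly ExtPoly := MvPolynomial.mkDerivation ℝ (dGen ξ)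

variable (ξ : ℝ)

theorem D_U (k : ℕ) : D ξ (U k) = U (k + 1) := by simp [D, U, dGen]
theorem D_F : D ξ F = G := by simp [D, F, dGen]
theorem D_G : D ξ G = - (MvPolynomial.C ξ + U 0) * F := by simp [D, G, dGen]
theorem D_S : D ξ S = - (F * F * S * S) := by simp [D, S, dGen]
theorem D_C (a : ℝ) : D ξ (MvPolynomial.C a) = 0 := by simp [D]

/-- The inclusion of the differential polynomials in `u`. -/
def incl : DiffPoly →ₐ[ℝ] ExtPoly := MvPolynomial.rename Sum.inl

theorem incl_X (k : ℕ) : incl (MvPolynomial.X k) = U k := by simp [incl, U]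
theorem incl_C (a : ℝ) : incl (MvPolynomial.C a) = MvPolynomial.C a := by simp [incl]

/-- An algebra homomorphism which intertwines the derivations on generators does so everywhere. -/
theorem hom_totalD (h : DiffPoly →ₐ[ℝ] ExtPoly)
    (hX : ∀ k, h (MvPolynomial.X (k + 1)) = D ξ (h (MvPolynomial.X k))) (p : DiffPoly) :
    h (totalD p) = D ξ (h p) := by
  induction p using MvPolynomial.induction_on with
  | C a =>
    rw [totalD_C, map_zero, show h (MvPolynomial.C a) = MvPolynomial.C a from h.commutes a, D_C]
  | add p q hp hq => simp only [map_add, hp, hq]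
  | mul_X p k hp =>
    simp only [Derivation.leibniz, map_add, map_mul, smul_eq_mul, hp, totalD_X, hX]

theorem incl_totalD (p : DiffPoly) : incl (totalD p) = D ξ (incl p) :=
  hom_totalD ξ incl (fun k => by rw [incl_X, incl_X, D_U]) p

/-- The transformed potential. -/
def darbouxU : ExtPoly := U 0 + 2 * D ξ (F * F * S)

/-- The substitution of the transformed potential in differential polynomials. -/
def darbouxHom : DiffPoly →ₐ[ℝ] ExtPoly :=
  MvPolynomial.aeval (fun k => (D ξ)^[k] (darbouxU ξ))

theorem darbouxHom_X (k : ℕ) : darbouxHom ξ (MvPolynomial.X k) = (D ξ)^[k] (darbouxU ξ) := by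
  simp [darbouxHom]

theorem darbouxHom_totalD (p : DiffPoly) : darbouxHom ξ (totalD p) = D ξ (darbouxHom ξ p) :=
  hom_totalD ξ _ (fun k => by rw [darbouxHom_X, darbouxHom_X, Function.iterate_succ_apply']) p

/-- The primitive of `2 f A f`. -/
def theta (k : ℕ) : ExtPoly :=
  incl (thetaXX ξ k) * (F * F) + incl (thetaXY ξ k) * (F * G) + incl (thetaYY ξ k) * (G * G)

theorem two_mul_theta_succ (k : ℕ) : 2 * theta ξ (k + 1) =
    2 * (MvPolynomial.C ξ * theta ξ k + incl (bPoly k) * F * F + incl (gPoly ξ k) * G * G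
      - D ξ (incl (gPoly ξ k)) * F * G + (MvPolynomial.C ξ + U 0) * incl (gPoly ξ k) * F * F)
      + D ξ (D ξ (incl (gPoly ξ k))) * F * F := by
  have h2 : (2 : ExtPoly) * MvPolynomial.C (1 / 2 : ℝ) = 1 := by
    rw [show (2 : ExtPoly) = MvPolynomial.C 2 from (map_ofNat MvPolynomial.C 2).symm,
      ← MvPolynomial.C_mul]
    norm_num
  simp only [theta, thetaXX, thetaXY, thetaYY, map_add, map_sub, map_mul, incl_totalD ξ,
    incl_C, incl_X]
  linear_combination (D ξ (D ξ (incl (gPoly ξ k))) * F * F) * h2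

theorem four_mul_D_bPoly (k : ℕ) : 4 * D ξ (incl (bPoly k)) =
    - D ξ (D ξ (D ξ (incl (gPoly ξ k))))
      - 4 * (U 0 + MvPolynomial.C ξ) * D ξ (incl (gPoly ξ k))
      - 2 * D ξ (U 0) * incl (gPoly ξ k) := by
  have := congrArg incl (four_mul_totalD_bPoly ξ k)
  simpa only [map_sub, map_neg, map_mul, map_add, incl_totalD ξ, incl_X, incl_C, map_ofNat]
    using this

theorem D_theta (k : ℕ) :
    D ξ (theta ξ k) = 2 * incl (gPoly ξ k) * F * G - D ξ (incl (gPoly ξ k)) * F * F := by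
  induction k with
  | zero => simp [theta, thetaXX, thetaXY, thetaYY, gPoly]
  | succ k ih =>
    have := quadratic_primitive_identity (D ξ) (D_C ξ ξ) (D_F ξ) (D_G ξ) ih
      (four_mul_D_bPoly ξ k) (two_mul_theta_succ ξ k)
    rw [gPoly, map_add, map_mul, incl_C]
    exact mul_left_cancel₀ two_ne_zero this

/-- The commutator of two derivations is a derivation, hence is determined by its values on the
generators; these are the partial derivatives of `dGen`. -/
theorem pderiv_D (i : ℕ ⊕ Fin 3) (p : ExtPoly) :
    MvPolynomial.pderiv i (D ξ p) = D ξ (MvPolynomial.pderiv i p) +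
      MvPolynomial.mkDerivation ℝ (fun j => MvPolynomial.pderiv i (dGen ξ j)) p := by
  have : ⁅MvPolynomial.pderiv (R := ℝ) i, D ξ⁆ =
      MvPolynomial.mkDerivation ℝ (fun j => MvPolynomial.pderiv i (dGen ξ j)) := by
    refine MvPolynomial.derivation_ext fun j => ?_
    rw [Derivation.commutator_apply]
    by_cases h : j = i
    · subst h; simp [D]
    · simp [D, MvPolynomial.pderiv_X_of_ne h]
  rw [← this, Derivation.commutator_apply]
  ring

theorem mkDerivation_pair (i j : ℕ ⊕ Fin 3) (a b : ExtPoly) (p : ExtPoly) :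
    MvPolynomial.mkDerivation ℝ
        (fun k => (if k = i then a else 0) + (if k = j then b else 0)) p =
      a * MvPolynomial.pderiv i p + b * MvPolynomial.pderiv j p := by
  have : MvPolynomial.mkDerivation ℝ
      (fun k => (if k = i then a else 0) + (if k = j then b else 0)) =
      a • MvPolynomial.pderiv (R := ℝ) i + b • MvPolynomial.pderiv (R := ℝ) j := by
    refine MvPolynomial.derivation_ext fun k => ?_
    simp only [MvPolynomial.mkDerivation_X, Derivation.add_apply, Derivation.smul_apply,
      MvPolynomial.pderiv_X, smul_eq_mul, Pi.single_apply, mul_ite, mul_one, mul_zero, eq_comm]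
  rw [this]; rfl

theorem pderiv_of_D_eq_zero {p : ExtPoly} (hp : D ξ p = 0) {i j k : ℕ ⊕ Fin 3}
    {a b : ExtPoly} (hi : MvPolynomial.pderiv i p = 0)
    (h : ∀ l, MvPolynomial.pderiv i (dGen ξ l) =
      (if l = j then a else 0) + (if l = k then b else 0)) :
    a * MvPolynomial.pderiv j p + b * MvPolynomial.pderiv k p = 0 := by
  have h1 := pderiv_D ξ i p
  rw [funext h, mkDerivation_pair, hp, hi, map_zero, map_zero, zero_add] at h1
  exact h1.symm

/-- Commutators with D pass the vanishing from one variable to the next: [∂/∂u⁽ᵐ⁺¹⁾, D] = ∂/∂u⁽ᵐ⁾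
descends from an order that does not occur in p; then [∂/∂u, D] = -F ∂/∂G, [∂/∂G, D] = ∂/∂F, and
[∂/∂F, D] contains -2FS² ∂/∂S. -/
theorem pderiv_eq_zero_of_D_eq_zero {p : ExtPoly} (hp : D ξ p = 0) (i : ℕ ⊕ Fin 3) :
    MvPolynomial.pderiv i p = 0 := by
  have hU : ∀ m, MvPolynomial.pderiv (Sum.inl m) p = 0 := by
    have step : ∀ m, MvPolynomial.pderiv (Sum.inl (m + 1)) p = 0 →
        MvPolynomial.pderiv (Sum.inl m) p = 0 := by
      intro m hm
      have := pderiv_of_D_eq_zero ξ hp (j := Sum.inl m) (k := Sum.inl m) (a := 1) (b := 0) hm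
        (by
          rintro (l | l)
          · simp [dGen, U, MvPolynomial.pderiv_X, Pi.single_apply, eq_comm]
          · fin_cases l <;> simp [dGen, U, F, G, S, MvPolynomial.pderiv_X])
      simpa using this
    have large : ∃ B, ∀ m ≥ B, MvPolynomial.pderiv (Sum.inl m) p = 0 := by
      obtain ⟨B, hB⟩ := (p.vars.preimage Sum.inl Sum.inl_injective.injOn).exists_nat_subset_range
      refine ⟨B, fun m hm => MvPolynomial.pderiv_eq_zero_of_notMem_vars fun hmem => ?_⟩
      have := hB (Finset.mem_preimage.2 hmem)
      rw [Finset.mem_range] at this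
      omega
    obtain ⟨B, hB⟩ := large
    intro m
    by_contra hm
    have : ∀ d, MvPolynomial.pderiv (Sum.inl (m + d)) p ≠ 0 := by
      intro d
      induction d with
      | zero => exact hm
      | succ d ih => exact fun h => ih (step _ h)
    exact this B (hB _ (by omega))
  have hG : MvPolynomial.pderiv (Sum.inr 1) p = 0 := by
    have := pderiv_of_D_eq_zero ξ hp (j := Sum.inr 1) (k := Sum.inr 1) (a := -F) (b := 0) (hU 0)
      (by
        rintro (l | l)
        · simp [dGen, U, MvPolynomial.pderiv_X]
        · fin_cases l <;> simp [dGen, U, F, G, S, MvPolynomial.pderiv_X])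
    simpa [F] using this
  have hF : MvPolynomial.pderiv (Sum.inr 0) p = 0 := by
    have := pderiv_of_D_eq_zero ξ hp (j := Sum.inr 0) (k := Sum.inr 0) (a := 1) (b := 0) hG
      (by
        rintro (l | l)
        · simp [dGen, U, MvPolynomial.pderiv_X]
        · fin_cases l <;> simp [dGen, U, F, G, S, MvPolynomial.pderiv_X])
    simpa using this
  have hS : MvPolynomial.pderiv (Sum.inr 2) p = 0 := by
    have := pderiv_of_D_eq_zero ξ hp (j := Sum.inr 2) (k := Sum.inr 1)
      (a := -(2 * F * S * S)) (b := - (MvPolynomial.C ξ + U 0)) hF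
      (by
        rintro (l | l)
        · simp [dGen, U, MvPolynomial.pderiv_X]
        · fin_cases l <;> simp [dGen, U, F, G, S, MvPolynomial.pderiv_X]
          ring)
    simpa [hG, F, S] using this
  match i with
  | Sum.inl m => exact hU m
  | Sum.inr 0 => exact hF
  | Sum.inr 1 => exact hG
  | Sum.inr 2 => exact hS

theorem eq_zero_of_D_eq_zero {p : ExtPoly} (hp : D ξ p = 0)
    (h0 : MvPolynomial.constantCoeff p = 0) : p = 0 := by
  ext m
  by_cases hm : m = 0
  · subst hm; simpa [MvPolynomial.constantCoeff_eq] using h0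
  · obtain ⟨i, hi⟩ := Finsupp.ne_iff.1 hm
    have hle : Finsupp.single i 1 ≤ m := by
      rw [Finsupp.single_le_iff]; exact Nat.one_le_iff_ne_zero.2 hi
    have h1 := congrArg (MvPolynomial.coeff (m - Finsupp.single i 1))
      (pderiv_eq_zero_of_D_eq_zero ξ hp i)
    rw [MvPolynomial.coeff_pderiv, tsub_add_cancel_of_le hle] at h1
    simp only [MvPolynomial.coeff_zero, mul_eq_zero] at h1 ⊢
    refine h1.resolve_right ?_
    positivity

theorem constantCoeff_D (p : ExtPoly) : MvPolynomial.constantCoeff (D ξ p) = 0 := by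
  induction p using MvPolynomial.induction_on with
  | C a => simp
  | add p q hp hq => simp [hp, hq]
  | mul_X p i _ =>
    have : MvPolynomial.constantCoeff (dGen ξ i) = 0 := by
      rcases i with l | l
      · simp [dGen, U]
      · fin_cases l <;> simp [dGen, F, G, U]
    simp [Derivation.leibniz, D, this]

theorem constantCoeff_incl (p : DiffPoly) :
    MvPolynomial.constantCoeff (incl p) = MvPolynomial.constantCoeff p := by
  simp [incl, MvPolynomial.constantCoeff_rename]

theorem constantCoeff_darbouxHom (p : DiffPoly) :
    MvPolynomial.constantCoeff (darbouxHom ξ p) = MvPolynomial.constantCoeff p := by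
  induction p using MvPolynomial.induction_on with
  | C a => simp [darbouxHom]
  | add p q hp hq => simp [hp, hq]
  | mul_X p i _ =>
    have : MvPolynomial.constantCoeff ((D ξ)^[i] (darbouxU ξ)) = 0 := by
      cases i with
      | zero => simp [darbouxU, constantCoeff_D, U]
      | succ i => rw [Function.iterate_succ_apply', constantCoeff_D]
    rw [map_mul, map_mul, darbouxHom_X, this, map_mul, MvPolynomial.constantCoeff_X, mul_zero,
      mul_zero]

/-- The Darboux transformation of the coefficients `b_k`. -/
theorem darbouxHom_bPoly (k : ℕ) :
    darbouxHom ξ (bPoly k) = incl (bPoly k) - D ξ (theta ξ k * S) := by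
  induction k with
  | zero => simp [bPoly, theta, thetaXX, thetaXY, thetaYY]
  | succ k ih =>
    -- A difference with zero derivative and zero constant coefficient vanishes. The constant
    -- coefficients agree because ū and all its derivatives are polynomials without constant term.
    rw [← sub_eq_zero]
    refine eq_zero_of_D_eq_zero ξ ?_ ?_
    -- In `darboux_identity` the factor s is part of θ, hence the multiplication by S.
    · have hn := congrArg (· * S) (two_mul_theta_succ ξ k)
      have key := darboux_identity (D ξ) (θ := theta ξ k * S) (θn := theta ξ (k + 1) * S)
        (D_C ξ ξ) (D_F ξ) (D_G ξ) (D_S ξ)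
        (by rw [Derivation.leibniz, D_theta, D_S]; simp only [smul_eq_mul]; ring)
        (four_mul_D_bPoly ξ k) (by linear_combination hn) rfl ih
      have h1 := congrArg (darbouxHom ξ) (four_mul_totalD_bPoly_succ k)
      have h2 := congrArg incl (four_mul_totalD_bPoly_succ k)
      simp only [map_sub, map_neg, map_mul, incl_totalD ξ, darbouxHom_totalD, incl_X,
        darbouxHom_X, map_ofNat, Function.iterate_zero, Function.iterate_one, id_eq] at h1 h2
      refine mul_left_cancel₀ (show (4 : ExtPoly) ≠ 0 from
        mod_cast (Nat.cast_ne_zero (R := ExtPoly)).2 four_ne_zero) ?_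
      have hU : U 1 = D ξ (U 0) := (D_U ξ 0).symm
      rw [hU] at h2
      simp only [map_sub, mul_zero]
      unfold darbouxU at h1
      linear_combination h1 - h2 + key
    · simp [constantCoeff_D, constantCoeff_incl, constantCoeff_darbouxHom]

end ExtPoly

/-! ### Second-order linear equations on a half-line -/

section HalfLine

variable {E F : Type*} [NormedAddCommGroup E] [NormedSpace ℝ E]
  [NormedAddCommGroup F] [NormedSpace ℝ F]

/-- The step of the sampling estimates for `‖y''‖ ≤ M ‖y‖`. -/
def sampleStep (M : ℝ) : ℝ := 1 / (112 * (M + 1))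

theorem sampleStep_pos {M : ℝ} (hM : 0 ≤ M) : 0 < sampleStep M := by
  unfold sampleStep; positivity

theorem sampleStep_mul_le {M : ℝ} (hM : 0 ≤ M) : sampleStep M * M ≤ 1 / 112 := by
  unfold sampleStep
  rw [div_mul_eq_mul_div, div_le_div_iff₀ (by positivity) (by positivity)]
  linarith

theorem sampleStep_le {M : ℝ} (hM : 0 ≤ M) : sampleStep M ≤ 1 / 112 := by
  unfold sampleStep
  rw [div_le_div_iff₀ (by positivity) (by positivity)]
  linarith

/-- Solutions of `‖y''‖ ≤ M ‖y‖` (with first jet `(y, y')`) are almost affine on short intervals,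
so that they are not small at two points which are not too close. -/
theorem two_point_estimate {M X : ℝ} (hM : 0 ≤ M) {y y' y'' : ℝ → E}
    (hy : ∀ s ≤ X, HasDerivAt y (y' s) s) (hy' : ∀ s ≤ X, HasDerivAt y' (y'' s) s)
    (hb : ∀ s ≤ X, ‖y'' s‖ ≤ M * ‖y s‖) {x : ℝ} (hx : x ≤ X) {s s' : ℝ}
    (hs : s ∈ Icc (x - 2 * sampleStep M) x) (hs' : s' ∈ Icc (x - 2 * sampleStep M) x)
    (hss : sampleStep M ≤ |s - s'|) :
    sampleStep M / 14 * (‖y x‖ + ‖y' x‖) ≤ ‖y s‖ ∨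
      sampleStep M / 14 * (‖y x‖ + ‖y' x‖) ≤ ‖y s'‖ := by
  have ha := sampleStep_pos hM
  have haM := sampleStep_mul_le hM
  have ha1 := sampleStep_le hM
  set a := sampleStep M
  set K := Icc (x - 2 * a) x
  have hK : Convex ℝ K := convex_Icc _ _
  have hKX : ∀ r ∈ K, r ≤ X := fun r hr => hr.2.trans hx
  have hxK : x ∈ K := ⟨by linarith, le_rfl⟩
  have hdist : ∀ r ∈ K, ‖r - x‖ ≤ 2 * a := by
    intro r hr
    rw [Real.norm_eq_abs, abs_le]
    constructor <;> linarith [hr.1, hr.2]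
  have hcont : ContinuousOn (fun r => ‖y r‖) K := fun r hr =>
    (hy r (hKX r hr)).continuousAt.norm.continuousWithinAt
  obtain ⟨r₀, hr₀, hmax⟩ := isCompact_Icc.exists_isMaxOn ⟨x, hxK⟩ hcont
  set m := ‖y r₀‖
  have hm : ∀ r ∈ K, ‖y r‖ ≤ m := fun r hr => hmax hr
  have hm0 : 0 ≤ m := norm_nonneg _
  set S := ‖y x‖ + ‖y' x‖ with hS
  have hyx := norm_nonneg (y x)
  have hyx' := norm_nonneg (y' x)
  have h1 : ∀ r ∈ K, ‖y' r - y' x‖ ≤ M * m * (2 * a) := by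
    intro r hr
    refine (hK.norm_image_sub_le_of_norm_hasDerivWithin_le
      (fun q hq => (hy' q (hKX q hq)).hasDerivWithinAt)
      (fun q hq => (hb q (hKX q hq)).trans (mul_le_mul_of_nonneg_left (hm q hq) hM))
      hxK hr).trans ?_
    exact mul_le_mul_of_nonneg_left (hdist r hr) (by positivity)
  have h2 : ∀ r ∈ K, ‖y r - y x - (r - x) • y' x‖ ≤ M * m * (2 * a) * (2 * a) := by
    intro r hr
    have := hK.norm_image_sub_le_of_norm_hasDerivWithin_le
      (f := fun q => y q - q • y' x) (f' := fun q => y' q - (1 : ℝ) • y' x)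
      (fun q hq => ((hy q (hKX q hq)).sub
        ((hasDerivAt_id q).smul_const (y' x))).hasDerivWithinAt)
      (fun q hq => by rw [one_smul]; exact h1 q hq) hxK hr
    have heq : y r - y x - (r - x) • y' x = y r - r • y' x - (y x - x • y' x) := by
      rw [sub_smul]; abel
    rw [heq]
    exact this.trans (mul_le_mul_of_nonneg_left (hdist r hr) (by positivity))
  -- The constant 112 in the step enters here: a M ≤ 1/112 makes the deviation from the tangent line
  -- at most m a / 28.
  have hMa : M * m * (2 * a) * (2 * a) ≤ m / 28 * a := by
    have : M * m * (2 * a) * (2 * a) = 4 * (m * a) * (a * M) := by ring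
    rw [this]
    calc 4 * (m * a) * (a * M) ≤ 4 * (m * a) * (1 / 112) :=
          mul_le_mul_of_nonneg_left haM (by positivity)
      _ = m / 28 * a := by ring
  have hma : m * a ≤ m := by nlinarith
  -- The maximum is attained at `r₀`, where y differs from its tangent line by at most m/28 since a
  -- ≤ 1; absorbing this term bounds m by the first jet at x.
  have hmS : m ≤ 2 * S := by
    have h3 := h2 r₀ hr₀
    have h4 : m ≤ ‖y r₀ - y x - (r₀ - x) • y' x‖ + ‖y x‖ + ‖(r₀ - x) • y' x‖ := by
      have : y r₀ = (y r₀ - y x - (r₀ - x) • y' x) + y x + (r₀ - x) • y' x := by abel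
      calc m = ‖(y r₀ - y x - (r₀ - x) • y' x) + y x + (r₀ - x) • y' x‖ := by rw [← this]
        _ ≤ _ := norm_add₃_le
    rw [norm_smul] at h4
    have h5 : ‖r₀ - x‖ * ‖y' x‖ ≤ ‖y' x‖ := by
      have := hdist r₀ hr₀
      nlinarith
    linarith
  have hS0 : 0 ≤ S := by positivity
  have h3 : ∀ r ∈ K, ‖y r - y x - (r - x) • y' x‖ ≤ a / 14 * S := by
    intro r hr
    refine ((h2 r hr).trans hMa).trans ?_
    nlinarith
  -- If y is small at both points, so is the tangent line. As the points are at least a apart, its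
  -- slope is then small, hence so is its value at x, which contradicts the size S of the jet.
  by_contra! hcon
  obtain ⟨hc, hc'⟩ := hcon
  have hl : ∀ r ∈ K, ‖y r‖ < a / 14 * S → ‖y x + (r - x) • y' x‖ < a / 7 * S := by
    intro r hr h
    have : y x + (r - x) • y' x = y r - (y r - y x - (r - x) • y' x) := by abel
    rw [this]
    refine (norm_sub_le _ _).trans_lt ?_
    linarith [h3 r hr]
  have e1 := hl s hs hc
  have e2 := hl s' hs' hc'
  have e3 : a * ‖y' x‖ < 2 * a / 7 * S := by
    have : (s - s') • y' x = (y x + (s - x) • y' x) - (y x + (s' - x) • y' x) := by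
      simp only [sub_smul]; abel
    have h4 : |s - s'| * ‖y' x‖ < 2 * a / 7 * S := by
      rw [← Real.norm_eq_abs, ← norm_smul, this]
      refine (norm_sub_le _ _).trans_lt ?_
      linarith
    exact (mul_le_mul_of_nonneg_right hss hyx').trans_lt h4
  have e4 : ‖y' x‖ < 2 / 7 * S := by
    refine lt_of_mul_lt_mul_left (a := a) ?_ ha.le
    linarith
  have e5 : ‖y x‖ ≤ ‖y x + (s - x) • y' x‖ + ‖(s - x) • y' x‖ := by
    have : y x = (y x + (s - x) • y' x) - (s - x) • y' x := by abel
    calc ‖y x‖ = ‖(y x + (s - x) • y' x) - (s - x) • y' x‖ := by rw [← this]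
      _ ≤ _ := norm_sub_le _ _
  rw [norm_smul] at e5
  have e6 : ‖s - x‖ * ‖y' x‖ ≤ 2 * a * (2 / 7 * S) :=
    mul_le_mul (hdist s hs) e4.le hyx' (by positivity)
  nlinarith

/-- The product of the norms of two first jets is controlled by three values of the product. -/
theorem three_point_estimate {M X : ℝ} (hM : 0 ≤ M) {y y' y'' : ℝ → E} {z z' z'' : ℝ → F}
    (hy : ∀ s ≤ X, HasDerivAt y (y' s) s) (hy' : ∀ s ≤ X, HasDerivAt y' (y'' s) s)
    (hyb : ∀ s ≤ X, ‖y'' s‖ ≤ M * ‖y s‖)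
    (hz : ∀ s ≤ X, HasDerivAt z (z' s) s) (hz' : ∀ s ≤ X, HasDerivAt z' (z'' s) s)
    (hzb : ∀ s ≤ X, ‖z'' s‖ ≤ M * ‖z s‖) {x : ℝ} (hx : x ≤ X) :
    (sampleStep M / 14) ^ 2 * ((‖y x‖ + ‖y' x‖) * (‖z x‖ + ‖z' x‖)) ≤
      ∑ i ∈ Finset.range 3, ‖y (x - i * sampleStep M)‖ * ‖z (x - i * sampleStep M)‖ := by
  have ha := sampleStep_pos hM
  have hp : ∀ i ∈ Finset.range 3, x - i * sampleStep M ∈ Icc (x - 2 * sampleStep M) x := by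
    intro i hi
    have h2 : (i : ℝ) ≤ 2 := by
      exact_mod_cast Nat.lt_succ_iff.1 (Finset.mem_range.1 hi)
    constructor <;> nlinarith
  have hd : ∀ i j : ℕ, i < j →
      sampleStep M ≤ |(x - i * sampleStep M) - (x - j * sampleStep M)| := by
    intro i j hij
    have h1 : (i : ℝ) + 1 ≤ j := by exact_mod_cast hij
    refine le_trans ?_ (le_abs_self _)
    nlinarith
  have hY := fun i j hi hj hij =>
    two_point_estimate hM hy hy' hyb hx (hp i hi) (hp j hj) (hd i j hij)
  have hZ := fun i j hi hj hij =>
    two_point_estimate hM hz hz' hzb hx (hp i hi) (hp j hj) (hd i j hij)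
  -- Pigeonhole: among the three points x, x - a, x - 2a each function is small at no more than one,
  -- so at some point neither is small.
  have good : ∃ i ∈ Finset.range 3,
      sampleStep M / 14 * (‖y x‖ + ‖y' x‖) ≤ ‖y (x - i * sampleStep M)‖ ∧
      sampleStep M / 14 * (‖z x‖ + ‖z' x‖) ≤ ‖z (x - i * sampleStep M)‖ := by
    have y01 := hY 0 1 (by simp) (by simp) (by simp)
    have y02 := hY 0 2 (by simp) (by simp) (by simp)
    have y12 := hY 1 2 (by simp) (by simp) (by simp)
    have z01 := hZ 0 1 (by simp) (by simp) (by simp)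
    have z02 := hZ 0 2 (by simp) (by simp) (by simp)
    have z12 := hZ 1 2 (by simp) (by simp) (by simp)
    by_contra! hcon
    have c0 := fun h => not_le.2 (hcon 0 (by simp) h)
    have c1 := fun h => not_le.2 (hcon 1 (by simp) h)
    have c2 := fun h => not_le.2 (hcon 2 (by simp) h)
    tauto
  obtain ⟨i, hi, h1, h2⟩ := good
  calc (sampleStep M / 14) ^ 2 * ((‖y x‖ + ‖y' x‖) * (‖z x‖ + ‖z' x‖))
      = (sampleStep M / 14 * (‖y x‖ + ‖y' x‖)) * (sampleStep M / 14 * (‖z x‖ + ‖z' x‖)) := by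
        ring
    _ ≤ ‖y (x - i * sampleStep M)‖ * ‖z (x - i * sampleStep M)‖ :=
        mul_le_mul h1 h2 (by positivity) (norm_nonneg _)
    _ ≤ _ := Finset.single_le_sum
        (f := fun i : ℕ => ‖y (x - i * sampleStep M)‖ * ‖z (x - i * sampleStep M)‖)
        (fun _ _ => by positivity) hi

theorem integrableOn_sum_translates {X a : ℝ} (ha : 0 ≤ a) {g : ℝ → ℝ}
    (hg : IntegrableOn g (Iic X)) (c : ℝ) :
    IntegrableOn (fun x => c * ∑ i ∈ Finset.range 3, g (x - i * a)) (Iic X) := by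
  refine Integrable.const_mul ?_ c
  refine integrable_finsetSum _ fun i _ => ?_
  have h1 : IntegrableOn (fun x => g (x - i * a)) ((fun x => x - i * a) ⁻¹' Iic X) :=
    ((measurePreserving_sub_right volume ((i : ℝ) * a)).integrableOn_comp_preimage
      (Homeomorph.subRight ((i : ℝ) * a)).measurableEmbedding).2 hg
  refine h1.mono_set fun x hx => ?_
  have : 0 ≤ (i : ℝ) * a := by positivity
  simp only [mem_preimage, mem_Iic] at hx ⊢
  linarith

/-- The first jet of a square integrable solution is controlled by the primitive of its square. -/
theorem jet_sq_le_integral {M X : ℝ} (hM : 0 ≤ M) {y y' y'' : ℝ → ℝ}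
    (hy : ∀ s ≤ X, HasDerivAt y (y' s) s) (hy' : ∀ s ≤ X, HasDerivAt y' (y'' s) s)
    (hb : ∀ s ≤ X, ‖y'' s‖ ≤ M * ‖y s‖) {x : ℝ} (hx : x ≤ X)
    (hint : IntegrableOn (fun s => y s ^ 2) (Iic x)) :
    sampleStep M * ((sampleStep M / 14) ^ 2 * (‖y x‖ + ‖y' x‖) ^ 2) ≤
      2 * ∫ s in Iic x, y s ^ 2 := by
  have ha := sampleStep_pos hM
  set a := sampleStep M
  have htr : IntegrableOn (fun s => y (s - a) ^ 2) (Iic x) := by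
    have h1 : IntegrableOn (fun s => y (s - a) ^ 2) ((fun s => s - a) ⁻¹' Iic x) :=
      ((measurePreserving_sub_right volume a).integrableOn_comp_preimage
        (Homeomorph.subRight a).measurableEmbedding).2 hint
    refine h1.mono_set fun s hs => ?_
    simp only [mem_preimage, mem_Iic] at hs ⊢
    linarith
  have hsub : Icc (x - a) x ⊆ Iic x := fun s hs => hs.2
  -- Of the two points s and s - a, at distance a, at least one carries a value comparable to the
  -- jet at x. Integrating over s in an interval of length a gives the estimate.
  have hpt : ∀ s ∈ Icc (x - a) x,
      (a / 14) ^ 2 * (‖y x‖ + ‖y' x‖) ^ 2 ≤ y s ^ 2 + y (s - a) ^ 2 := by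
    intro s hs
    have hc : 0 ≤ a / 14 * (‖y x‖ + ‖y' x‖) := by positivity
    have hsq : ∀ r, a / 14 * (‖y x‖ + ‖y' x‖) ≤ ‖y r‖ →
        (a / 14) ^ 2 * (‖y x‖ + ‖y' x‖) ^ 2 ≤ y r ^ 2 := by
      intro r hr
      rw [← mul_pow, ← sq_abs (y r)]
      exact pow_le_pow_left₀ hc hr 2
    rcases two_point_estimate hM hy hy' hb hx (s := s) (s' := s - a)
      ⟨by linarith [hs.1], hs.2⟩ ⟨by linarith [hs.1], by linarith [hs.2]⟩
      (by rw [sub_sub_cancel]; exact le_abs_self _) with h | h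
    · linarith [hsq _ h, sq_nonneg (y (s - a))]
    · linarith [hsq _ h, sq_nonneg (y s)]
  have h1 : a * ((a / 14) ^ 2 * (‖y x‖ + ‖y' x‖) ^ 2) ≤
      ∫ s in Icc (x - a) x, (y s ^ 2 + y (s - a) ^ 2) := by
    have h2 := setIntegral_mono_on (μ := volume)
      (f := fun _ => (a / 14) ^ 2 * (‖y x‖ + ‖y' x‖) ^ 2)
      (integrableOn_const (by simp)) ((hint.add htr).mono_set hsub) measurableSet_Icc hpt
    simpa [ha.le] using h2
  have h3 : ∫ s in Icc (x - a) x, (y s ^ 2 + y (s - a) ^ 2) ≤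
      ∫ s in Iic x, (y s ^ 2 + y (s - a) ^ 2) :=
    setIntegral_mono_set (hint.add htr) (ae_of_all _ fun s => by positivity) hsub.eventuallyLE
  have h4 : ∫ s in Iic x, y (s - a) ^ 2 ≤ ∫ s in Iic x, y s ^ 2 := by
    have h5 : ∫ s in (fun s => s - a) ⁻¹' Iic (x - a), y (s - a) ^ 2 =
        ∫ s in Iic (x - a), y s ^ 2 :=
      (measurePreserving_sub_right volume a).setIntegral_preimage_emb
        (Homeomorph.subRight a).measurableEmbedding (fun s => y s ^ 2) _
    have h6 : (fun s => s - a) ⁻¹' Iic (x - a) = Iic x := by ext s; simp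
    rw [h6] at h5
    rw [h5]
    exact setIntegral_mono_set hint (ae_of_all _ fun s => by positivity)
      (Iic_subset_Iic.2 (by linarith)).eventuallyLE
  rw [integral_add hint htr] at h3
  linarith

/-- Solutions of `y'' = q y` with vanishing initial values vanish. -/
theorem eq_zero_of_second_order {𝕜 : Type*} [RCLike 𝕜] {q y y' : ℝ → 𝕜} (hq : Continuous q)
    (hy : ∀ s, HasDerivAt y (y' s) s) (hy' : ∀ s, HasDerivAt y' (q s * y s) s) {x₀ : ℝ}
    (h0 : y x₀ = 0) (h0' : y' x₀ = 0) (x : ℝ) : y x = 0 := by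
  set A := min x x₀ - 1
  set B := max x x₀ + 1
  have hx : x ∈ Ioo A B := ⟨by simp only [A]; linarith [min_le_left x x₀],
    by simp only [B]; linarith [le_max_left x x₀]⟩
  have hx₀ : x₀ ∈ Ioo A B := ⟨by simp only [A]; linarith [min_le_right x x₀],
    by simp only [B]; linarith [le_max_right x x₀]⟩
  obtain ⟨C, hC⟩ := (isCompact_Icc (a := A) (b := B)).exists_bound_of_continuousOn hq.continuousOn
  -- The equation is treated as a first-order system for (y, y'). The maximum with 1 covers the
  -- component y', whose Lipschitz constant is 1.
  have hC' : ∀ t ∈ Ioo A B, ‖q t‖ ≤ max C 1 := fun t ht =>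
    (hC t (Ioo_subset_Icc_self ht)).trans (le_max_left _ _)
  have hlip : ∀ t ∈ Ioo A B, LipschitzOnWith (Real.toNNReal (max C 1))
      (fun p : 𝕜 × 𝕜 => (p.2, q t * p.1)) univ := by
    intro t ht
    refine LipschitzWith.lipschitzOnWith (LipschitzWith.of_dist_le_mul fun p p' => ?_)
    rw [Real.coe_toNNReal _ (by positivity)]
    have hm : 1 ≤ max C 1 := le_max_right _ _
    rw [Prod.dist_eq, Prod.dist_eq]
    refine max_le ?_ ?_
    · calc dist p.2 p'.2 ≤ max (dist p.1 p'.1) (dist p.2 p'.2) := le_max_right _ _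
        _ ≤ _ := le_mul_of_one_le_left (by positivity) hm
    · rw [dist_eq_norm, ← mul_sub, norm_mul, ← dist_eq_norm]
      exact mul_le_mul (hC' t ht) (le_max_left _ _) dist_nonneg (by positivity)
  have key := ODE_solution_unique_of_mem_Ioo (v := fun t (p : 𝕜 × 𝕜) => (p.2, q t * p.1))
    (s := fun _ => univ) (f := fun t => (y t, y' t)) (g := fun _ => 0) hlip hx₀
    (fun t _ => ⟨(hy t).prodMk (hy' t), mem_univ _⟩)
    (fun t _ => ⟨(hasDerivAt_const t (0 : 𝕜 × 𝕜)).congr_deriv (by ext <;> simp), mem_univ _⟩)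
    (by simp [h0, h0'])
  exact congrArg Prod.fst (key hx)

/-- The primitive vanishing at `-∞`. -/
theorem hasDerivAt_integral_Iic {E : Type*} [NormedAddCommGroup E] [NormedSpace ℝ E]
    [CompleteSpace E] {h : ℝ → E} (hc : Continuous h) (hi : ∀ x, IntegrableOn h (Iic x)) (x : ℝ) :
    HasDerivAt (fun x => ∫ y in Iic x, h y) (h x) x := by
  have h1 : (fun x => ∫ y in Iic x, h y) =
      fun x => (∫ y in Iic 0, h y) + ∫ y in (0 : ℝ)..x, h y := by
    funext x
    rw [← intervalIntegral.integral_Iic_sub_Iic (hi 0) (hi x)]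
    abel
  rw [h1]
  exact (intervalIntegral.integral_hasDerivAt_right (hc.intervalIntegrable _ _)
    hc.stronglyMeasurable.stronglyMeasurableAtFilter hc.continuousAt).const_add _

theorem tendsto_integral_Iic {E : Type*} [NormedAddCommGroup E] [NormedSpace ℝ E]
    [CompleteSpace E] {h : ℝ → E} (hi : ∀ x, IntegrableOn h (Iic x)) :
    Tendsto (fun x => ∫ y in Iic x, h y) atBot (𝓝 0) := by
  have h1 := intervalIntegral_tendsto_integral_Iic (f := h) 0 (hi 0) tendsto_id
  have h2 := h1.const_sub (∫ y in Iic 0, h y)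
  rw [sub_self] at h2
  refine h2.congr fun x => ?_
  rw [id, ← intervalIntegral.integral_Iic_sub_Iic (hi x) (hi 0)]
  abel

end HalfLine

/-! ### Smooth fields -/

section Fields

variable {E : Type*} [NormedAddCommGroup E] [NormedSpace ℝ E]

/-- The derivative in `x`. -/
def dX (h : ℝ → ℝ → E) (x t : ℝ) : E := deriv (fun y => h y t) x

/-- The derivative in `t`. -/
def dT (h : ℝ → ℝ → E) (x t : ℝ) : E := deriv (fun s => h x s) t

variable {T : Set ℝ} {h k : ℝ → ℝ → E}

theorem isOpen_domain (hT : IsOpen T) : IsOpen ((univ : Set ℝ) ×ˢ T) := isOpen_univ.prod hT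

namespace SmoothField

theorem contDiffAt (hh : SmoothField T h) (hT : IsOpen T) (x : ℝ) {t : ℝ} (ht : t ∈ T) :
    ContDiffAt ℝ ∞ (fun z : ℝ × ℝ => h z.1 z.2) (x, t) :=
  ContDiffOn.contDiffAt hh ((isOpen_domain hT).mem_nhds ⟨mem_univ _, ht⟩)

theorem congr (hh : SmoothField T h) (hk : ∀ x, ∀ t ∈ T, k x t = h x t) : SmoothField T k :=
  ContDiffOn.congr hh fun z hz => hk z.1 z.2 hz.2

theorem contDiff_slice (hh : SmoothField T h) (hT : IsOpen T) {t : ℝ} (ht : t ∈ T) :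
    ContDiff ℝ ∞ (fun y => h y t) := by
  rw [contDiff_iff_contDiffAt]
  intro x
  exact (hh.contDiffAt hT x ht).comp x (contDiffAt_id.prodMk contDiffAt_const)

theorem continuous_slice (hh : SmoothField T h) (hT : IsOpen T) {t : ℝ} (ht : t ∈ T) :
    Continuous (fun y => h y t) := (hh.contDiff_slice hT ht).continuous

theorem hasDerivAt_x (hh : SmoothField T h) (hT : IsOpen T) (x : ℝ) {t : ℝ} (ht : t ∈ T) :
    HasDerivAt (fun y => h y t) (dX h x t) x :=
  ((hh.contDiff_slice hT ht).differentiable (by simp) x).hasDerivAt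

theorem hasDerivAt_t (hh : SmoothField T h) (hT : IsOpen T) (x : ℝ) {t : ℝ} (ht : t ∈ T) :
    HasDerivAt (fun s => h x s) (dT h x t) t := by
  have : ContDiffAt ℝ ∞ (fun s => h x s) t :=
    (hh.contDiffAt hT x ht).comp t (contDiffAt_const.prodMk contDiffAt_id)
  exact (this.differentiableAt (by simp)).hasDerivAt

theorem hasFDerivAt (hh : SmoothField T h) (hT : IsOpen T) (x : ℝ) {t : ℝ} (ht : t ∈ T) :
    HasFDerivAt (fun z : ℝ × ℝ => h z.1 z.2)
      (fderiv ℝ (fun z : ℝ × ℝ => h z.1 z.2) (x, t)) (x, t) :=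
  ((hh.contDiffAt hT x ht).differentiableAt (by simp)).hasFDerivAt

theorem dX_eq_fderiv (hh : SmoothField T h) (hT : IsOpen T) (x : ℝ) {t : ℝ} (ht : t ∈ T) :
    dX h x t = fderiv ℝ (fun z : ℝ × ℝ => h z.1 z.2) (x, t) (1, 0) :=
  HasDerivAt.deriv (f := fun y => h y t)
    (HasFDerivAt.comp_hasDerivAt (f := fun y : ℝ => (y, t)) (l := fun z : ℝ × ℝ => h z.1 z.2) x
      (hh.hasFDerivAt hT x ht) ((hasDerivAt_id' x).prodMk (hasDerivAt_const x t)))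

theorem dT_eq_fderiv (hh : SmoothField T h) (hT : IsOpen T) (x : ℝ) {t : ℝ} (ht : t ∈ T) :
    dT h x t = fderiv ℝ (fun z : ℝ × ℝ => h z.1 z.2) (x, t) (0, 1) :=
  HasDerivAt.deriv (f := fun s => h x s) ((hh.hasFDerivAt hT x ht).comp_hasDerivAt t
    ((hasDerivAt_const t x).prodMk (hasDerivAt_id' t)))

theorem fderiv_apply (hh : SmoothField T h) (hT : IsOpen T) (v : ℝ × ℝ) :
    SmoothField T (fun x t => fderiv ℝ (fun z : ℝ × ℝ => h z.1 z.2) (x, t) v) :=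
  (ContDiffOn.fderiv_of_isOpen hh (isOpen_domain hT) (m := ∞) (by simp)).clm_apply
    contDiffOn_const

theorem dX (hh : SmoothField T h) (hT : IsOpen T) : SmoothField T (dX h) :=
  (hh.fderiv_apply hT (1, 0)).congr fun x _ ht => hh.dX_eq_fderiv hT x ht

theorem dT (hh : SmoothField T h) (hT : IsOpen T) : SmoothField T (dT h) :=
  (hh.fderiv_apply hT (0, 1)).congr fun x _ ht => hh.dT_eq_fderiv hT x ht

/-- Mixed partial derivatives commute. -/
theorem dT_dX (hh : SmoothField T h) (hT : IsOpen T) (x : ℝ) {t : ℝ} (ht : t ∈ T) :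
    KdVSources.dT (KdVSources.dX h) x t = KdVSources.dX (KdVSources.dT h) x t := by
  have hsymm : IsSymmSndFDerivAt ℝ (fun z : ℝ × ℝ => h z.1 z.2) (x, t) :=
    (hh.contDiffAt hT x ht).isSymmSndFDerivAt (by
      rw [minSmoothness_of_isRCLikeNormedField]; exact ENat.LEInfty.out)
  have hd : DifferentiableAt ℝ (fderiv ℝ (fun z : ℝ × ℝ => h z.1 z.2)) (x, t) :=
    ((hh.contDiffAt hT x ht).fderiv_right (m := ∞) (by simp)).differentiableAt (by simp)
  have h1 : KdVSources.dT (KdVSources.dX h) x t =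
      fderiv ℝ (fderiv ℝ (fun z : ℝ × ℝ => h z.1 z.2)) (x, t) (0, 1) (1, 0) := by
    have e : (fun s => KdVSources.dX h x s) =ᶠ[𝓝 t]
        fun s => fderiv ℝ (fun z : ℝ × ℝ => h z.1 z.2) (x, s) (1, 0) := by
      filter_upwards [hT.mem_nhds ht] with s hs using hh.dX_eq_fderiv hT x hs
    rw [KdVSources.dT, e.deriv_eq]
    refine HasDerivAt.deriv ?_
    have h3 := (hd.hasFDerivAt.comp_hasDerivAt t
      ((hasDerivAt_const t x).prodMk (hasDerivAt_id' t)))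
    exact (ContinuousLinearMap.apply ℝ E ((1 : ℝ), (0 : ℝ))).hasFDerivAt.comp_hasDerivAt t h3
  have h2 : KdVSources.dX (KdVSources.dT h) x t =
      fderiv ℝ (fderiv ℝ (fun z : ℝ × ℝ => h z.1 z.2)) (x, t) (1, 0) (0, 1) := by
    have e : (fun y => KdVSources.dT h y t) =
        fun y => fderiv ℝ (fun z : ℝ × ℝ => h z.1 z.2) (y, t) (0, 1) := by
      funext y
      exact hh.dT_eq_fderiv hT y ht
    rw [KdVSources.dX, e]
    refine HasDerivAt.deriv ?_
    have h3 := (hd.hasFDerivAt.comp_hasDerivAt x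
      ((hasDerivAt_id' x).prodMk (hasDerivAt_const x t)))
    exact (ContinuousLinearMap.apply ℝ E ((0 : ℝ), (1 : ℝ))).hasFDerivAt.comp_hasDerivAt x h3
  rw [h1, h2]
  exact hsymm _ _

theorem iteratedDeriv (hh : SmoothField T h) (hT : IsOpen T) (n : ℕ) :
    SmoothField T (fun x t => iteratedDeriv n (fun y => h y t) x) := by
  induction n with
  | zero => simpa using hh
  | succ n ih =>
    simp only [iteratedDeriv_succ]
    exact ih.dX hT

theorem add (hh : SmoothField T h) (hk : SmoothField T k) :
    SmoothField T (fun x t => h x t + k x t) := ContDiffOn.add hh hk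

theorem sub (hh : SmoothField T h) (hk : SmoothField T k) :
    SmoothField T (fun x t => h x t - k x t) := ContDiffOn.sub hh hk

theorem smul {a : ℝ → ℝ → ℝ} (ha : SmoothField T a) (hh : SmoothField T h) :
    SmoothField T (fun x t => a x t • h x t) := ContDiffOn.smul ha hh

theorem mul {a b : ℝ → ℝ → ℝ} (ha : SmoothField T a) (hb : SmoothField T b) :
    SmoothField T (fun x t => a x t * b x t) := ContDiffOn.mul ha hb

theorem const (c : E) : SmoothField T (fun _ _ => c) := contDiffOn_const

theorem sum {ι : Type*} {s : Finset ι} {f : ι → ℝ → ℝ → E} (hf : ∀ i ∈ s, SmoothField T (f i)) :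
    SmoothField T (fun x t => ∑ i ∈ s, f i x t) := ContDiffOn.sum hf

theorem div {a b : ℝ → ℝ → ℝ} (ha : SmoothField T a) (hb : SmoothField T b)
    (h0 : ∀ x, ∀ t ∈ T, b x t ≠ 0) : SmoothField T (fun x t => a x t / b x t) :=
  ContDiffOn.div ha hb fun z hz => h0 z.1 z.2 hz.2

theorem bounded_Icc (hh : SmoothField T h) (hT : IsOpen T) {t₀ : ℝ} (ht₀ : t₀ ∈ T) (X : ℝ) :
    ∃ C, ∀ᶠ t in 𝓝 t₀, ∀ x ∈ Icc 0 X, ‖h x t‖ ≤ C := by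
  obtain ⟨r, hr, hrT⟩ := Metric.nhds_basis_closedBall.mem_iff.1 (hT.mem_nhds ht₀)
  have hK : IsCompact (Icc 0 X ×ˢ Metric.closedBall t₀ r) :=
    isCompact_Icc.prod (isCompact_closedBall _ _)
  obtain ⟨C, hC⟩ := hK.exists_bound_of_continuousOn
    ((ContDiffOn.continuousOn hh).mono (prod_mono (subset_univ _) hrT))
  refine ⟨C, ?_⟩
  filter_upwards [Metric.closedBall_mem_nhds t₀ hr] with t ht x hx
  exact hC (x, t) ⟨hx, ht⟩

end SmoothField

/-- Decay is stated on x ≤ 0 only. On the remaining piece [0, X] the product is bounded by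
compactness, locally uniformly in t, so a constant is added to the dominating function there. -/
theorem DecayingProduct.dominated {p : ℝ → ℝ → ℝ} (hd : DecayingProduct T p h)
    (hT : IsOpen T) (hp : SmoothField T p) (hh : SmoothField T h) {t₀ : ℝ} (ht₀ : t₀ ∈ T) (X : ℝ) :
    ∃ g : ℝ → ℝ, IntegrableOn g (Iic X) ∧
      ∀ᶠ t in 𝓝 t₀, ∀ x ≤ X, ‖p x t • h x t‖ ≤ g x := by
  obtain ⟨g, hg, hgt⟩ := hd t₀ ht₀
  obtain ⟨C, hC⟩ := (hp.smul hh).bounded_Icc hT ht₀ X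
  refine ⟨fun x => (Iic 0).indicator g x + (Ioc 0 X).indicator (fun _ => C) x, ?_, ?_⟩
  · refine Integrable.integrableOn (Integrable.add ?_ ?_)
    · exact (integrable_indicator_iff measurableSet_Iic).2 hg
    · exact (integrable_indicator_iff measurableSet_Ioc).2 (integrableOn_const (by simp))
  · filter_upwards [hgt, hC] with t h1 h2 x hx
    rcases le_or_gt x 0 with h0 | h0
    · simpa [h0, h0.not_gt] using h1 x h0
    · simpa [h0, h0.not_ge, hx] using h2 x ⟨h0.le, hx⟩

theorem DecayingProduct.integrableOn {p : ℝ → ℝ → ℝ} (hd : DecayingProduct T p h)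
    (hT : IsOpen T) (hp : SmoothField T p) (hh : SmoothField T h) {t : ℝ} (ht : t ∈ T) (X : ℝ) :
    IntegrableOn (fun x => p x t • h x t) (Iic X) := by
  obtain ⟨g, hg, hgt⟩ := hd.dominated hT hp hh ht X
  refine Integrable.mono' hg
    ((hp.smul hh).continuous_slice hT ht).aestronglyMeasurable ?_
  rw [ae_restrict_iff' measurableSet_Iic]
  exact ae_of_all _ fun x hx => hgt.self_of_nhds x hx

theorem DecayingProduct.hasDerivAt_integral [CompleteSpace E] {p : ℝ → ℝ → ℝ}
    (hd : DecayingProduct T p h) (hT : IsOpen T) (hp : SmoothField T p) (hh : SmoothField T h)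
    (x : ℝ) {t : ℝ} (ht : t ∈ T) :
    HasDerivAt (fun y => integralFromNegInf (fun y s => p y s • h y s) y t)
      (p x t • h x t) x :=
  hasDerivAt_integral_Iic ((hp.smul hh).continuous_slice hT ht)
    (hd.integrableOn hT hp hh ht) x

theorem DecayingProduct.tendsto_integral [CompleteSpace E] {p : ℝ → ℝ → ℝ}
    (hd : DecayingProduct T p h) (hT : IsOpen T) (hp : SmoothField T p) (hh : SmoothField T h)
    {t : ℝ} (ht : t ∈ T) :
    Tendsto (fun y => integralFromNegInf (fun y s => p y s • h y s) y t) atBot (𝓝 0) :=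
  tendsto_integral_Iic (hd.integrableOn hT hp hh ht)

end Fields

/-! ### Differential polynomials in a field -/

/-- Evaluating a derivation on polynomials along functions which satisfy its equations. -/
theorem hasDerivAt_eval {σ : Type*} {v : σ → MvPolynomial σ ℝ} {y : σ → ℝ → ℝ} {x : ℝ}
    (hy : ∀ i, HasDerivAt (y i) (MvPolynomial.eval (fun j => y j x) (v i)) x)
    (p : MvPolynomial σ ℝ) :
    HasDerivAt (fun r => MvPolynomial.eval (fun j => y j r) p)
      (MvPolynomial.eval (fun j => y j x) (MvPolynomial.mkDerivation ℝ v p)) x := by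
  induction p using MvPolynomial.induction_on with
  | C a => simpa using hasDerivAt_const x a
  | add p q hp hq => simpa using! hp.add hq
  | mul_X p i hp =>
    simp only [map_mul, MvPolynomial.eval_X, Derivation.leibniz, MvPolynomial.mkDerivation_X,
      map_add, smul_eq_mul]
    refine (hp.mul (hy i)).congr_deriv ?_
    ring

namespace DiffPoly

variable {T : Set ℝ} {u : ℝ → ℝ → ℝ}

theorem at_add (p q : DiffPoly) (x t : ℝ) :
    DiffPoly.at (p + q) u x t = DiffPoly.at p u x t + DiffPoly.at q u x t := by
  simp [DiffPoly.at]

theorem at_mul (p q : DiffPoly) (x t : ℝ) :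
    DiffPoly.at (p * q) u x t = DiffPoly.at p u x t * DiffPoly.at q u x t := by
  simp [DiffPoly.at]

theorem at_C (a x t : ℝ) : DiffPoly.at (MvPolynomial.C a) u x t = a := by
  simp [DiffPoly.at]

theorem at_X (k : ℕ) (x t : ℝ) :
    DiffPoly.at (MvPolynomial.X k) u x t = iteratedDeriv k (fun y => u y t) x := by
  simp [DiffPoly.at]

theorem hasDerivAt_at (hu : SmoothField T u) (hT : IsOpen T) (P : DiffPoly) (x : ℝ) {t : ℝ}
    (ht : t ∈ T) : HasDerivAt (fun y => P.at u y t) ((totalD P).at u x t) x := by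
  refine hasDerivAt_eval (y := fun k x => iteratedDeriv k (fun y => u y t) x) (fun k => ?_) P
  rw [MvPolynomial.eval_X, iteratedDeriv_succ]
  exact (hu.iteratedDeriv hT k).hasDerivAt_x hT x ht

theorem smooth_at (hu : SmoothField T u) (hT : IsOpen T) (P : DiffPoly) :
    SmoothField T (P.at u) := by
  induction P using MvPolynomial.induction_on with
  | C a => exact (SmoothField.const a).congr fun x t _ => at_C a x t
  | add p q hp hq => exact (hp.add hq).congr fun x t _ => at_add p q x t
  | mul_X p i hp =>
    exact (hp.mul (hu.iteratedDeriv hT i)).congr fun x t _ => by rw [at_mul, at_X]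

theorem bounded_at (hu : SmoothField T u) (hT : IsOpen T) (hb : BoundedDerivsAtNegInf T u)
    (P : DiffPoly) {t₀ : ℝ} (ht₀ : t₀ ∈ T) (X : ℝ) :
    ∃ C, 0 ≤ C ∧ ∀ᶠ t in 𝓝 t₀, ∀ x ≤ X, |P.at u x t| ≤ C := by
  induction P using MvPolynomial.induction_on with
  | C a => exact ⟨|a|, abs_nonneg _, Eventually.of_forall fun t x _ => by rw [at_C]⟩
  | add p q hp hq =>
    obtain ⟨C, hC, h1⟩ := hp
    obtain ⟨C', hC', h2⟩ := hq
    refine ⟨C + C', by positivity, ?_⟩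
    filter_upwards [h1, h2] with t h1 h2 x hx
    rw [at_add]
    exact (abs_add_le _ _).trans (add_le_add (h1 x hx) (h2 x hx))
  | mul_X p i hp =>
    obtain ⟨C, hC, h1⟩ := hp
    obtain ⟨C', h2⟩ := hb i t₀ ht₀
    obtain ⟨C'', h3⟩ := (hu.iteratedDeriv hT i).bounded_Icc hT ht₀ X
    refine ⟨C * max 0 (max C' C''), by positivity, ?_⟩
    filter_upwards [h1, h2, h3] with t h1 h2 h3 x hx
    have h4 : |iteratedDeriv i (fun y => u y t) x| ≤ max 0 (max C' C'') := by
      rcases le_or_gt x 0 with h0 | h0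
      · exact (h2 x h0).trans ((le_max_left _ _).trans (le_max_right _ _))
      · exact (h3 x ⟨h0.le, hx⟩).trans ((le_max_right _ _).trans (le_max_right _ _))
    rw [at_mul, at_X, abs_mul]
    exact mul_le_mul (h1 x hx) h4 (abs_nonneg _) hC

end DiffPoly

/-! ### Solutions of the spectral problem -/

/-- A smooth potential with bounded derivatives at `-∞`. -/
structure IsPotential (T : Set ℝ) (u : ℝ → ℝ → ℝ) : Prop where
  isOpen : IsOpen T
  smooth : SmoothField T u
  bounded : BoundedDerivsAtNegInf T u

/-- A smooth solution of `q_xx + (μ + u) q = 0`. -/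
structure IsSpectral {𝕜 : Type*} [RCLike 𝕜] (T : Set ℝ) (u : ℝ → ℝ → ℝ) (μ : 𝕜)
    (q : ℝ → ℝ → 𝕜) : Prop where
  smooth : SmoothField T q
  spectral : ∀ x, ∀ t ∈ T,
    iteratedDeriv 2 (fun y => q y t) x + (μ + ((u x t : ℝ) : 𝕜)) * q x t = 0

/-- The norm of the first jet in `x`. -/
def jet {E : Type*} [NormedAddCommGroup E] [NormedSpace ℝ E] (q : ℝ → ℝ → E) (x t : ℝ) : ℝ :=
  ‖q x t‖ + ‖dX q x t‖

/-- The primitive of a product. -/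
abbrev prim {E : Type*} [NormedAddCommGroup E] [NormedSpace ℝ E] (p : ℝ → ℝ → ℝ)
    (q : ℝ → ℝ → E) : ℝ → ℝ → E :=
  integralFromNegInf (fun y s => p y s • q y s)

section Spectral

variable {𝕜 : Type*} [RCLike 𝕜] {T : Set ℝ} {u : ℝ → ℝ → ℝ} {μ : 𝕜} {lam : ℝ}
  {p : ℝ → ℝ → ℝ} {q : ℝ → ℝ → 𝕜}

theorem jet_nonneg {E : Type*} [NormedAddCommGroup E] [NormedSpace ℝ E] (q : ℝ → ℝ → E)
    (x t : ℝ) : 0 ≤ jet q x t := by unfold jet; positivity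

theorem norm_le_jet {E : Type*} [NormedAddCommGroup E] [NormedSpace ℝ E] (q : ℝ → ℝ → E)
    (x t : ℝ) : ‖q x t‖ ≤ jet q x t := le_add_of_nonneg_right (norm_nonneg _)

theorem norm_dX_le_jet {E : Type*} [NormedAddCommGroup E] [NormedSpace ℝ E] (q : ℝ → ℝ → E)
    (x t : ℝ) : ‖dX q x t‖ ≤ jet q x t := le_add_of_nonneg_left (norm_nonneg _)

theorem IsPotential.bound (hu : IsPotential T u) {t₀ : ℝ} (ht₀ : t₀ ∈ T) (X : ℝ) :
    ∃ C, 0 ≤ C ∧ ∀ᶠ t in 𝓝 t₀, ∀ x ≤ X, |u x t| ≤ C := by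
  simpa [DiffPoly.at_X] using
    DiffPoly.bounded_at hu.smooth hu.isOpen hu.bounded (MvPolynomial.X 0) ht₀ X

theorem IsSpectral.hasDerivAt (hq : IsSpectral T u μ q) (hT : IsOpen T) (x : ℝ) {t : ℝ}
    (ht : t ∈ T) : HasDerivAt (fun y => q y t) (dX q x t) x :=
  hq.smooth.hasDerivAt_x hT x ht

theorem IsSpectral.hasDerivAt_dX (hq : IsSpectral T u μ q) (hT : IsOpen T) (x : ℝ) {t : ℝ}
    (ht : t ∈ T) :
    HasDerivAt (fun y => dX q y t) (-(μ + ((u x t : ℝ) : 𝕜)) * q x t) x := by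
  have h1 := (hq.smooth.dX hT).hasDerivAt_x hT x ht
  refine h1.congr_deriv ?_
  have h2 := hq.spectral x t ht
  rw [iteratedDeriv_succ, iteratedDeriv_one] at h2
  rw [neg_mul]
  exact eq_neg_of_add_eq_zero_left h2

theorem IsSpectral.hasDerivAt_dX_real (hp : IsSpectral T u lam p) (hT : IsOpen T) (x : ℝ) {t : ℝ}
    (ht : t ∈ T) : HasDerivAt (fun y => dX p y t) (-(lam + u x t) * p x t) x := by
  simpa using hp.hasDerivAt_dX hT x ht

theorem norm_potential_mul_le {C x t M : ℝ} (hC : |u x t| ≤ C) (hM : ‖μ‖ + C ≤ M) :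
    ‖-(μ + ((u x t : ℝ) : 𝕜)) * q x t‖ ≤ M * ‖q x t‖ := by
  rw [norm_mul, norm_neg]
  refine mul_le_mul_of_nonneg_right ?_ (norm_nonneg _)
  refine ((norm_add_le _ _).trans ?_).trans hM
  rw [RCLike.norm_ofReal]
  linarith

/-- The product of first jets of two solutions decays if the product of the solutions does. -/
theorem jet_mul_jet_dominated (hu : IsPotential T u) (hp : IsSpectral T u lam p)
    (hq : IsSpectral T u μ q) (hd : DecayingProduct T p q) {t₀ : ℝ} (ht₀ : t₀ ∈ T) (X : ℝ) :
    ∃ g : ℝ → ℝ, IntegrableOn g (Iic X) ∧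
      ∀ᶠ t in 𝓝 t₀, ∀ x ≤ X, jet p x t * jet q x t ≤ g x := by
  obtain ⟨C, hC0, hC⟩ := hu.bound ht₀ X
  obtain ⟨g, hg, hgt⟩ := hd.dominated hu.isOpen hp.smooth hq.smooth ht₀ X
  set M := ‖lam‖ + ‖μ‖ + C
  have hM : 0 ≤ M := by positivity
  have ha := sampleStep_pos hM
  refine ⟨_, integrableOn_sum_translates ha.le hg (((sampleStep M / 14) ^ 2)⁻¹), ?_⟩
  filter_upwards [hC, hgt, hu.isOpen.mem_nhds ht₀] with t h1 h2 ht x hx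
  have h3 := three_point_estimate hM
    (fun s _ => hp.hasDerivAt hu.isOpen s ht) (fun s _ => hp.hasDerivAt_dX hu.isOpen s ht)
    (fun s hs => norm_potential_mul_le (h1 s hs) (by simp only [M]; linarith [norm_nonneg μ]))
    (fun s _ => hq.hasDerivAt hu.isOpen s ht) (fun s _ => hq.hasDerivAt_dX hu.isOpen s ht)
    (fun s hs => norm_potential_mul_le (h1 s hs) (by simp only [M]; linarith [norm_nonneg lam]))
    hx
  rw [← div_eq_inv_mul, le_div_iff₀ (by positivity), mul_comm]
  refine h3.trans (Finset.sum_le_sum fun i _ => ?_)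
  rw [← norm_smul]
  refine h2 _ ?_
  have : 0 ≤ (i : ℝ) * sampleStep M := by positivity
  linarith

theorem integrableOn_of_jet_bound (hu : IsPotential T u) (hp : IsSpectral T u lam p)
    (hq : IsSpectral T u μ q) (hd : DecayingProduct T p q) {t : ℝ} (ht : t ∈ T) (X C : ℝ)
    {h : ℝ → 𝕜} (hc : Continuous h) (hC : 0 ≤ C)
    (hb : ∀ x ≤ X, ‖h x‖ ≤ C * (jet p x t * jet q x t)) :
    IntegrableOn h (Iic X) := by
  obtain ⟨g, hg, hgt⟩ := jet_mul_jet_dominated hu hp hq hd ht X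
  refine Integrable.mono' (hg.const_mul C) hc.aestronglyMeasurable ?_
  rw [ae_restrict_iff' measurableSet_Iic]
  exact ae_of_all _ fun x hx =>
    (hb x hx).trans (mul_le_mul_of_nonneg_left (hgt.self_of_nhds x hx) hC)

/-- The Wronskian. -/
def wronskian (p : ℝ → ℝ → ℝ) (q : ℝ → ℝ → 𝕜) (x t : ℝ) : 𝕜 :=
  p x t • dX q x t - dX p x t • q x t

theorem norm_wronskian_le (p : ℝ → ℝ → ℝ) (q : ℝ → ℝ → 𝕜) (x t : ℝ) :
    ‖wronskian p q x t‖ ≤ jet p x t * jet q x t := by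
  refine (norm_sub_le _ _).trans ?_
  rw [norm_smul, norm_smul]
  unfold jet
  nlinarith [norm_nonneg (p x t), norm_nonneg (q x t), norm_nonneg (dX p x t),
    norm_nonneg (dX q x t), mul_nonneg (norm_nonneg (p x t)) (norm_nonneg (q x t)),
    mul_nonneg (norm_nonneg (dX p x t)) (norm_nonneg (dX q x t))]

theorem hasDerivAt_wronskian (hT : IsOpen T) (hp : IsSpectral T u lam p)
    (hq : IsSpectral T u μ q) (x : ℝ) {t : ℝ} (ht : t ∈ T) :
    HasDerivAt (fun y => wronskian p q y t) (((lam : 𝕜) - μ) * (p x t • q x t)) x := by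
  refine (((hp.hasDerivAt hT x ht).smul (hq.hasDerivAt_dX hT x ht)).sub
    ((hp.hasDerivAt_dX_real hT x ht).smul (hq.hasDerivAt hT x ht))).congr_deriv ?_
  simp only [RCLike.real_smul_eq_coe_mul]
  push_cast
  ring

theorem smooth_wronskian (hT : IsOpen T) (hp : SmoothField T p) (hq : SmoothField T q) :
    SmoothField T (wronskian p q) :=
  (hp.smul (hq.dX hT)).sub ((hp.dX hT).smul hq)

/-- The Wronskian of two solutions with decaying product is a multiple of the primitive of their
product. -/
theorem wronskian_eq (hu : IsPotential T u) (hp : IsSpectral T u lam p)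
    (hq : IsSpectral T u μ q) (hd : DecayingProduct T p q) (x : ℝ) {t : ℝ} (ht : t ∈ T) :
    wronskian p q x t = ((lam : 𝕜) - μ) * prim p q x t := by
  have hW := fun y => hasDerivAt_wronskian hu.isOpen hp hq y ht
  have hpq := hd.integrableOn hu.isOpen hp.smooth hq.smooth ht
  have hint : IntegrableOn (fun y => ((lam : 𝕜) - μ) * (p y t • q y t)) (Iic x) :=
    (hpq x).const_mul _
  have hWint : IntegrableOn (fun y => wronskian p q y t) (Iic x) :=
    integrableOn_of_jet_bound hu hp hq hd ht x 1
      ((smooth_wronskian hu.isOpen hp.smooth hq.smooth).continuous_slice hu.isOpen ht)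
      zero_le_one (fun y _ => by rw [one_mul]; exact norm_wronskian_le p q y t)
  -- The Wronskian is integrable by the jet estimate and has an integrable derivative, so it tends
  -- to 0 at -∞ and there is no boundary term.
  have hlim := tendsto_zero_of_hasDerivAt_of_integrableOn_Iic (fun y _ => hW y) hint hWint
  have h1 := integral_Iic_of_hasDerivAt_of_tendsto' (fun y _ => hW y) hint hlim
  rw [sub_zero, integral_const_mul] at h1
  exact h1.symm

/-- Two solutions for the same eigenvalue with decaying product are proportional. -/
theorem proportional (hu : IsPotential T u) (hp : IsSpectral T u lam p)
    (hq : IsSpectral T u (lam : 𝕜) q) (hd : DecayingProduct T p q) {t x₀ : ℝ} (ht : t ∈ T)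
    (h0 : p x₀ t ≠ 0) (x : ℝ) : q x t = p x t • ((p x₀ t)⁻¹ • q x₀ t) := by
  set c := (p x₀ t)⁻¹ • q x₀ t
  have hW := wronskian_eq hu hp hq hd x₀ ht
  rw [sub_self, zero_mul, wronskian, sub_eq_zero] at hW
  have hcont : Continuous (fun s => -((lam : 𝕜) + ((u s t : ℝ) : 𝕜))) :=
    (continuous_const.add (RCLike.continuous_ofReal.comp
      (hu.smooth.continuous_slice hu.isOpen ht))).neg
  have := eq_zero_of_second_order (y := fun s => q s t - p s t • c)
    (y' := fun s => dX q s t - dX p s t • c) hcont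
    (fun s => (hq.hasDerivAt hu.isOpen s ht).sub ((hp.hasDerivAt hu.isOpen s ht).smul_const c))
    (fun s => ((hq.hasDerivAt_dX hu.isOpen s ht).sub
      ((hp.hasDerivAt_dX_real hu.isOpen s ht).smul_const c)).congr_deriv (by
        simp only [RCLike.real_smul_eq_coe_mul]
        push_cast
        ring))
    (x₀ := x₀) (by simp [c, smul_smul, h0])
    (by
      simp only [c]
      rw [smul_comm, ← hW, smul_smul, inv_mul_cancel₀ h0, one_smul, sub_self]) x
  exact sub_eq_zero.1 this

end Spectral

/-- The data of a binary Darboux transformation: an eigenfunction `f` with decaying square. -/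
structure IsSeed (T : Set ℝ) (u : ℝ → ℝ → ℝ) (ξ : ℝ) (f : ℝ → ℝ → ℝ) : Prop where
  potential : IsPotential T u
  spectral : IsSpectral T u ξ f
  decay : DecayingProduct T f f
  nontrivial : ∀ t ∈ T, ∃ x, f x t ≠ 0

/-- The primitive of the square. -/
abbrev tau (f : ℝ → ℝ → ℝ) : ℝ → ℝ → ℝ := integralFromNegInf (fun y s => f y s ^ 2)

theorem tau_eq_prim (f : ℝ → ℝ → ℝ) : tau f = prim f f := by
  simp only [tau, prim, smul_eq_mul, sq]

theorem prim_smul_const {𝕜 : Type*} [RCLike 𝕜] {p r : ℝ → ℝ → ℝ} {q : ℝ → ℝ → 𝕜} {c : 𝕜} {t : ℝ}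
    (h : ∀ x, q x t = r x t • c) (x : ℝ) : prim p q x t = prim p r x t • c := by
  simp only [prim, integralFromNegInf, h, smul_smul, smul_eq_mul, integral_smul_const]

/-! ### Bounds and primitives for the binary transform -/

namespace IsSeed

variable {𝕜 : Type*} [RCLike 𝕜] {T : Set ℝ} {u : ℝ → ℝ → ℝ} {μ : 𝕜} {lam ξ : ℝ}
  {f p : ℝ → ℝ → ℝ} {q : ℝ → ℝ → 𝕜}

theorem isOpen (hf : IsSeed T u ξ f) : IsOpen T := hf.potential.isOpen

theorem hasDerivAt_tau (hf : IsSeed T u ξ f) (x : ℝ) {t : ℝ} (ht : t ∈ T) :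
    HasDerivAt (fun y => tau f y t) (f x t ^ 2) x := by
  rw [tau_eq_prim, sq]
  exact hf.decay.hasDerivAt_integral hf.isOpen hf.spectral.smooth hf.spectral.smooth x ht

theorem jet_sq_le_tau (hf : IsSeed T u ξ f) {t₀ : ℝ} (ht₀ : t₀ ∈ T) (X : ℝ) :
    ∃ C, 0 < C ∧ ∀ᶠ t in 𝓝 t₀, ∀ x ≤ X, jet f x t ^ 2 ≤ C * tau f x t := by
  obtain ⟨K, hK0, hK⟩ := hf.potential.bound ht₀ X
  set M := ‖ξ‖ + K
  have hM : 0 ≤ M := by positivity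
  have ha := sampleStep_pos hM
  refine ⟨2 / (sampleStep M * (sampleStep M / 14) ^ 2), by positivity, ?_⟩
  filter_upwards [hK, hf.isOpen.mem_nhds ht₀] with t h1 ht x hx
  have hint := hf.decay.integrableOn hf.isOpen hf.spectral.smooth hf.spectral.smooth ht x
  simp only [smul_eq_mul, ← sq] at hint
  have h2 := jet_sq_le_integral hM (fun s _ => hf.spectral.hasDerivAt hf.isOpen s ht)
    (fun s _ => hf.spectral.hasDerivAt_dX hf.isOpen s ht)
    (fun s hs => norm_potential_mul_le (h1 s hs) le_rfl) hx hint
  rw [div_mul_eq_mul_div, le_div_iff₀ (by positivity)]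
  calc jet f x t ^ 2 * (sampleStep M * (sampleStep M / 14) ^ 2)
      = sampleStep M * ((sampleStep M / 14) ^ 2 * jet f x t ^ 2) := by ring
    _ ≤ _ := h2

/-- The first jet of f at x is controlled by τ(x). If τ(x) were 0, the Cauchy data of f at x would
vanish, and f would be identically zero at that time. -/
theorem tau_pos (hf : IsSeed T u ξ f) (x : ℝ) {t : ℝ} (ht : t ∈ T) : 0 < tau f x t := by
  have h0 : 0 ≤ tau f x t := integral_nonneg fun y => sq_nonneg _
  refine lt_of_le_of_ne h0 fun h => ?_
  obtain ⟨C, _, hC⟩ := hf.jet_sq_le_tau ht x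
  have h1 := hC.self_of_nhds x le_rfl
  rw [← h, mul_zero] at h1
  have h2 : jet f x t = 0 := pow_eq_zero_iff two_ne_zero |>.1 (le_antisymm h1 (sq_nonneg _))
  have h3 : f x t = 0 := norm_eq_zero.1 (le_antisymm (h2 ▸ norm_le_jet f x t) (norm_nonneg _))
  have h4 : dX f x t = 0 :=
    norm_eq_zero.1 (le_antisymm (h2 ▸ norm_dX_le_jet f x t) (norm_nonneg _))
  obtain ⟨y, hy⟩ := hf.nontrivial t ht
  exact hy (eq_zero_of_second_order (q := fun s => -(ξ + u s t))
    ((continuous_const.add (hf.potential.smooth.continuous_slice hf.isOpen ht)).neg)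
    (fun s => hf.spectral.hasDerivAt hf.isOpen s ht)
    (fun s => hf.spectral.hasDerivAt_dX_real hf.isOpen s ht) h3 h4 y)

theorem prim_eq_of_ne (hf : IsSeed T u ξ f) (hq : IsSpectral T u μ q)
    (hd : DecayingProduct T f q) (hμ : μ ≠ ξ) (x : ℝ) {t : ℝ} (ht : t ∈ T) :
    prim f q x t = ((ξ : 𝕜) - μ)⁻¹ * wronskian f q x t := by
  rw [wronskian_eq hf.potential hf.spectral hq hd x ht, ← mul_assoc,
    inv_mul_cancel₀ (sub_ne_zero.2 hμ.symm), one_mul]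

/-- Away from the eigenvalue of the seed the primitive is a multiple of the Wronskian, so its joint
smoothness needs no differentiation under the integral. -/
theorem smooth_prim_of_ne (hf : IsSeed T u ξ f) (hq : IsSpectral T u μ q)
    (hd : DecayingProduct T f q) (hμ : μ ≠ ξ) : SmoothField T (prim f q) := by
  have h1 : SmoothField T (fun x t => ((ξ : 𝕜) - μ)⁻¹ * wronskian f q x t) :=
    ContDiffOn.mul contDiffOn_const (smooth_wronskian hf.isOpen hf.spectral.smooth hq.smooth)
  exact h1.congr fun x t ht => hf.prim_eq_of_ne hq hd hμ x ht

theorem norm_prim_le_of_ne (hf : IsSeed T u ξ f) (hq : IsSpectral T u μ q)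
    (hd : DecayingProduct T f q) (hμ : μ ≠ ξ) (x : ℝ) {t : ℝ} (ht : t ∈ T) :
    ‖prim f q x t‖ ≤ ‖(ξ : 𝕜) - μ‖⁻¹ * (jet f x t * jet q x t) := by
  rw [hf.prim_eq_of_ne hq hd hμ x ht, norm_mul, norm_inv]
  exact mul_le_mul_of_nonneg_left (norm_wronskian_le f q x t) (by positivity)

/-- Solutions for the eigenvalue of the seed are proportional to it. -/
theorem exists_proportional (hf : IsSeed T u ξ f) (hq : IsSpectral T u (ξ : 𝕜) q)
    (hd : DecayingProduct T f q) {t : ℝ} (ht : t ∈ T) :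
    ∃ c : 𝕜, (∀ x, q x t = f x t • c) ∧ ∀ x, prim f q x t = tau f x t • c := by
  obtain ⟨x₀, h0⟩ := hf.nontrivial t ht
  have h1 := proportional hf.potential hf.spectral hq hd ht h0
  refine ⟨_, h1, fun x => ?_⟩
  rw [prim_smul_const h1, tau_eq_prim]

/-- For the eigenvalue of the seed, the transform vanishes. -/
theorem binaryDarboux_eq_zero (hf : IsSeed T u ξ f) (hq : IsSpectral T u (ξ : 𝕜) q)
    (hd : DecayingProduct T f q) (x : ℝ) {t : ℝ} (ht : t ∈ T) : binaryDarboux f q x t = 0 := by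
  obtain ⟨c, h1, h2⟩ := hf.exists_proportional hq hd ht
  have := (hf.tau_pos x ht).ne'
  change q x t - (f x t / tau f x t) • prim f q x t = 0
  rw [h1, h2, smul_smul, div_mul_cancel₀ _ this, sub_self]

/-- The transform is controlled by the first jet. -/
theorem norm_binaryDarboux_le (hf : IsSeed T u ξ f) (hq : IsSpectral T u μ q)
    (hd : DecayingProduct T f q) {t₀ : ℝ} (ht₀ : t₀ ∈ T) (X : ℝ) :
    ∃ C, 0 ≤ C ∧ ∀ᶠ t in 𝓝 t₀, ∀ x ≤ X, ‖binaryDarboux f q x t‖ ≤ C * jet q x t := by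
  by_cases hμ : μ = ξ
  · subst hμ
    refine ⟨0, le_rfl, ?_⟩
    filter_upwards [hf.isOpen.mem_nhds ht₀] with t ht x _
    rw [hf.binaryDarboux_eq_zero hq hd x ht]
    simp
  · obtain ⟨C, hC0, hC⟩ := hf.jet_sq_le_tau ht₀ X
    refine ⟨1 + C * ‖(ξ : 𝕜) - μ‖⁻¹, by positivity, ?_⟩
    filter_upwards [hC, hf.isOpen.mem_nhds ht₀] with t h1 ht x hx
    have hτ := hf.tau_pos x ht
    have hjq := jet_nonneg q x t
    have hjf := jet_nonneg f x t
    refine (norm_sub_le _ _).trans ?_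
    rw [norm_smul, norm_div, Real.norm_of_nonneg hτ.le]
    -- By the Wronskian formula ∂⁻¹(fq) carries a factor jet f. With the prefactor f this makes (jet
    -- f)², which τ absorbs.
    have h2 : ‖f x t‖ / tau f x t * ‖prim f q x t‖ ≤ C * ‖(ξ : 𝕜) - μ‖⁻¹ * jet q x t := by
      rw [div_mul_eq_mul_div, div_le_iff₀ hτ]
      calc ‖f x t‖ * ‖prim f q x t‖
          ≤ jet f x t * (‖(ξ : 𝕜) - μ‖⁻¹ * (jet f x t * jet q x t)) :=
            mul_le_mul (norm_le_jet f x t) (hf.norm_prim_le_of_ne hq hd hμ x ht)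
              (norm_nonneg _) hjf
        _ = jet f x t ^ 2 * (‖(ξ : 𝕜) - μ‖⁻¹ * jet q x t) := by ring
        _ ≤ C * tau f x t * (‖(ξ : 𝕜) - μ‖⁻¹ * jet q x t) :=
            mul_le_mul_of_nonneg_right (h1 x hx) (by positivity)
        _ = _ := by ring
    have h3 := norm_le_jet q x t
    change ‖q x t‖ + ‖f x t‖ / tau f x t * ‖prim f q x t‖ ≤ _
    linarith

theorem decay_binaryDarboux (hf : IsSeed T u ξ f) (hp : IsSpectral T u lam p)
    (hq : IsSpectral T u μ q) (hfp : DecayingProduct T f p) (hfq : DecayingProduct T f q)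
    (hpq : DecayingProduct T p q) : DecayingProduct T (binaryDarboux f p) (binaryDarboux f q) := by
  intro t₀ ht₀
  obtain ⟨g, hg, hgt⟩ := jet_mul_jet_dominated hf.potential hp hq hpq ht₀ 0
  obtain ⟨C, hC0, hC⟩ := hf.norm_binaryDarboux_le hp (by simpa using hfp) ht₀ 0
  obtain ⟨C', hC0', hC'⟩ := hf.norm_binaryDarboux_le hq hfq ht₀ 0
  refine ⟨fun x => C * C' * g x, hg.const_mul _, ?_⟩
  filter_upwards [hgt, hC, hC'] with t h1 h2 h3 x hx
  rw [norm_smul]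
  calc ‖binaryDarboux f p x t‖ * ‖binaryDarboux f q x t‖
      ≤ (C * jet p x t) * (C' * jet q x t) :=
        mul_le_mul (h2 x hx) (h3 x hx) (norm_nonneg _) (mul_nonneg hC0 (jet_nonneg p x t))
    _ = C * C' * (jet p x t * jet q x t) := by ring
    _ ≤ _ := mul_le_mul_of_nonneg_left (h1 x hx) (by positivity)

theorem hasDerivAt_prim (hf : IsSeed T u ξ f) (hq : IsSpectral T u μ q)
    (hfq : DecayingProduct T f q) (x : ℝ) {t : ℝ} (ht : t ∈ T) :
    HasDerivAt (fun y => prim f q y t) (f x t • q x t) x :=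
  hfq.hasDerivAt_integral hf.isOpen hf.spectral.smooth hq.smooth x ht

/-- Expanding p̄ q̄ = (p - f s ∂⁻¹(fp)) (q - f s ∂⁻¹(fq)), the terms other than pq are minus the
derivative of s ∂⁻¹(fp) ∂⁻¹(fq). This one identity governs both the transformed sources and the sum
of their squares. -/
theorem hasDerivAt_prim_div_tau (hf : IsSeed T u ξ f) (hp : IsSpectral T u lam p)
    (hq : IsSpectral T u μ q) (hfp : DecayingProduct T f p) (hfq : DecayingProduct T f q)
    (x : ℝ) {t : ℝ} (ht : t ∈ T) :
    HasDerivAt (fun y => (prim f p y t / tau f y t) • prim f q y t)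
      (p x t • q x t - binaryDarboux f p x t • binaryDarboux f q x t) x := by
  have hτ := (hf.tau_pos x ht).ne'
  refine (((hf.hasDerivAt_prim hp hfp x ht).div (hf.hasDerivAt_tau x ht) hτ).smul
    (hf.hasDerivAt_prim hq hfq x ht)).congr_deriv ?_
  have hτ' : ((tau f x t : ℝ) : 𝕜) ≠ 0 := by exact_mod_cast hτ
  change _ = p x t • q x t - (p x t - (f x t / tau f x t) • prim f p x t) •
    (q x t - (f x t / tau f x t) • prim f q x t)
  simp only [RCLike.real_smul_eq_coe_mul, smul_eq_mul, Pi.div_apply]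
  push_cast
  field_simp
  ring

/-- The primitive of a product of transforms. -/
theorem prim_binaryDarboux (hf : IsSeed T u ξ f) (hp : IsSpectral T u lam p)
    (hq : IsSpectral T u μ q) (hfp : DecayingProduct T f p) (hfq : DecayingProduct T f q)
    (hpq : DecayingProduct T p q) (hμ : μ ≠ ξ) (x : ℝ) {t : ℝ} (ht : t ∈ T) :
    prim (binaryDarboux f p) (binaryDarboux f q) x t =
      prim p q x t - (prim f p x t / tau f x t) • prim f q x t := by
  -- For λ = ξ the source is proportional to f and its transform is zero, so that both sides vanish.
  -- Otherwise both primitives on the right have Wronskian formulas.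
  by_cases hlam : lam = ξ
  · subst hlam
    obtain ⟨c, h1, h2⟩ := hf.exists_proportional (𝕜 := ℝ) (by simpa using hp) hfp ht
    have h3 : prim (binaryDarboux f p) (binaryDarboux f q) x t = 0 := by
      refine (integral_congr_ae (ae_of_all _ fun y => ?_)).trans (integral_zero _ _)
      simp only [hf.binaryDarboux_eq_zero (𝕜 := ℝ) (by simpa using hp) hfp y ht, zero_smul]
    have h4 : prim p q x t = c • prim f q x t := by
      simp only [prim, integralFromNegInf, h1, smul_assoc, smul_comm _ c, integral_smul]
    rw [h3, h4, h2, smul_eq_mul, mul_div_cancel_left₀ _ (hf.tau_pos x ht).ne', sub_self]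
  · have hT := hf.isOpen
    obtain ⟨C, hC0, hC⟩ := hf.jet_sq_le_tau ht x
    have hd := fun y => hf.hasDerivAt_prim_div_tau hp hq hfp hfq y ht
    have hlam' : lam ≠ ((ξ : ℝ) : ℝ) := by simpa using hlam
    have hpqi := hpq.integrableOn hT hp.smooth hq.smooth ht
    have hZc : Continuous (fun y => (prim f p y t / tau f y t) • prim f q y t) :=
      continuous_iff_continuousAt.2 fun y => (hd y).continuousAt
    have hpc : Continuous (fun y => binaryDarboux f p y t) := by
      refine continuous_iff_continuousAt.2 fun y => ?_
      exact (hp.hasDerivAt hT y ht).continuousAt.sub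
        (((hf.spectral.hasDerivAt hT y ht).continuousAt.div (hf.hasDerivAt_tau y ht).continuousAt
          (hf.tau_pos y ht).ne').smul (hf.hasDerivAt_prim hp hfp y ht).continuousAt)
    have hqc : Continuous (fun y => binaryDarboux f q y t) := by
      refine continuous_iff_continuousAt.2 fun y => ?_
      exact (hq.hasDerivAt hT y ht).continuousAt.sub
        (((hf.spectral.hasDerivAt hT y ht).continuousAt.div (hf.hasDerivAt_tau y ht).continuousAt
          (hf.tau_pos y ht).ne').smul (hf.hasDerivAt_prim hq hfq y ht).continuousAt)
    have hbi : IntegrableOn (fun y => binaryDarboux f p y t • binaryDarboux f q y t) (Iic x) := by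
      obtain ⟨K, hK0, hK⟩ := hf.norm_binaryDarboux_le hp (by simpa using hfp) ht x
      obtain ⟨K', hK0', hK'⟩ := hf.norm_binaryDarboux_le hq hfq ht x
      refine integrableOn_of_jet_bound hf.potential hp hq hpq ht x (K * K') (hpc.smul hqc)
        (by positivity) fun y hy => ?_
      rw [norm_smul]
      calc ‖binaryDarboux f p y t‖ * ‖binaryDarboux f q y t‖
          ≤ (K * jet p y t) * (K' * jet q y t) :=
            mul_le_mul (hK.self_of_nhds y hy) (hK'.self_of_nhds y hy) (norm_nonneg _)
              (mul_nonneg hK0 (jet_nonneg p y t))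
        _ = _ := by ring
    -- The two Wronskian bounds give (jet f)² jet p jet q over τ, hence a multiple of jet p jet q.
    -- Integrability of the function and of its derivative removes the boundary term at -∞.
    have hZi : IntegrableOn (fun y => (prim f p y t / tau f y t) • prim f q y t) (Iic x) := by
      refine integrableOn_of_jet_bound hf.potential hp hq hpq ht x
        (‖ξ - lam‖⁻¹ * ‖(ξ : 𝕜) - μ‖⁻¹ * C) hZc (by positivity) fun y hy => ?_
      have hτ := hf.tau_pos y ht
      have hjp := jet_nonneg p y t
      have hjq := jet_nonneg q y t
      have hjf := jet_nonneg f y t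
      rw [norm_smul, norm_div, Real.norm_of_nonneg hτ.le, div_mul_eq_mul_div, div_le_iff₀ hτ]
      have e1 : ‖prim f p y t‖ ≤ ‖ξ - lam‖⁻¹ * (jet f y t * jet p y t) := by
        simpa using hf.norm_prim_le_of_ne hp (by simpa using hfp) hlam' y ht
      calc ‖prim f p y t‖ * ‖prim f q y t‖
          ≤ (‖ξ - lam‖⁻¹ * (jet f y t * jet p y t)) *
              (‖(ξ : 𝕜) - μ‖⁻¹ * (jet f y t * jet q y t)) :=
            mul_le_mul e1 (hf.norm_prim_le_of_ne hq hfq hμ y ht) (norm_nonneg _) (by positivity)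
        _ = ‖ξ - lam‖⁻¹ * ‖(ξ : 𝕜) - μ‖⁻¹ * (jet p y t * jet q y t) * jet f y t ^ 2 := by ring
        _ ≤ ‖ξ - lam‖⁻¹ * ‖(ξ : 𝕜) - μ‖⁻¹ * (jet p y t * jet q y t) * (C * tau f y t) :=
            mul_le_mul_of_nonneg_left (hC.self_of_nhds y hy) (by positivity)
        _ = _ := by ring
    have hlim := tendsto_zero_of_hasDerivAt_of_integrableOn_Iic (fun y _ => hd y)
      ((hpqi x).sub hbi) hZi
    have h1 := integral_Iic_of_hasDerivAt_of_tendsto' (fun y _ => hd y) ((hpqi x).sub hbi) hlim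
    rw [integral_sub (hpqi x) hbi, sub_zero] at h1
    change prim p q x t - prim (binaryDarboux f p) (binaryDarboux f q) x t = _ at h1
    rw [← h1]
    abel

end IsSeed

/-! ### The evolution in time -/

theorem DecayingProduct.symm {T : Set ℝ} {p q : ℝ → ℝ → ℝ} (h : DecayingProduct T p q) :
    DecayingProduct T q p := by
  simpa only [DecayingProduct, smul_eq_mul, mul_comm] using h

theorem prim_comm (p q : ℝ → ℝ → ℝ) : prim p q = prim q p := by
  simp only [prim, smul_eq_mul, mul_comm]

/-- The differential operators `A`, generated recursively. -/
def opM {𝕜 : Type*} [RCLike 𝕜] (u : ℝ → ℝ → ℝ) (μ : 𝕜) (ψ : ℝ → ℝ → 𝕜) (x t : ℝ) : ℕ → 𝕜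
  | 0 => 0
  | k + 1 => μ * opM u μ ψ x t k + (((bPoly k).at u x t : ℝ) : 𝕜) * dX ψ x t
      - (1 / 2) * (((totalD (bPoly k)).at u x t : ℝ) : 𝕜) * ψ x t

/-- The derivative of `A ψ` in `x`. -/
def opMX {𝕜 : Type*} [RCLike 𝕜] (u : ℝ → ℝ → ℝ) (μ : 𝕜) (ψ : ℝ → ℝ → 𝕜) (x t : ℝ) : ℕ → 𝕜
  | 0 => 0
  | k + 1 => μ * opMX u μ ψ x t k
      + (1 / 2) * (((totalD (bPoly k)).at u x t : ℝ) : 𝕜) * dX ψ x t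
      - (((bPoly k).at u x t : ℝ) : 𝕜) * (μ + ((u x t : ℝ) : 𝕜)) * ψ x t
      - (1 / 2) * (((totalD (totalD (bPoly k))).at u x t : ℝ) : 𝕜) * ψ x t

theorem aPoly_at (k : ℕ) (u : ℝ → ℝ → ℝ) (x t : ℝ) :
    (aPoly k).at u x t = -(1 / 2) * (totalD (bPoly k)).at u x t := by
  simp [aPoly, DiffPoly.at]

theorem opM_eq_sum {𝕜 : Type*} [RCLike 𝕜] (u : ℝ → ℝ → ℝ) (μ : 𝕜) (ψ : ℝ → ℝ → 𝕜) (x t : ℝ)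
    (k : ℕ) : opM u μ ψ x t k = ∑ i ∈ Finset.range k, μ ^ (k - 1 - i) *
      ((aPoly i).at u x t • ψ x t + (bPoly i).at u x t • deriv (fun y => ψ y t) x) := by
  induction k with
  | zero => simp [opM]
  | succ k ih =>
    rw [opM, ih, Finset.sum_range_succ, Finset.mul_sum, add_sub_assoc]
    congr 1
    · refine Finset.sum_congr rfl fun i hi => ?_
      have := Finset.mem_range.1 hi
      rw [← mul_assoc, ← pow_succ']
      congr 2
      omega
    · simp only [add_tsub_cancel_right, tsub_self, pow_zero, one_mul, aPoly_at,
        RCLike.real_smul_eq_coe_mul, dX]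
      push_cast
      ring

theorem opA_eq_opM {𝕜 : Type*} [RCLike 𝕜] (n : ℕ) (u : ℝ → ℝ → ℝ) (μ : 𝕜) (ψ : ℝ → ℝ → 𝕜)
    (x t : ℝ) : opA n u μ ψ x t = opM u μ ψ x t (n + 2) :=
  (opM_eq_sum u μ ψ x t (n + 2)).symm

section

variable {𝕜 : Type*} [RCLike 𝕜] {T : Set ℝ} {u : ℝ → ℝ → ℝ} {μ : 𝕜} {ξ : ℝ}
  {f : ℝ → ℝ → ℝ} {q : ℝ → ℝ → 𝕜}

theorem hasDerivAt_ofReal {g : ℝ → ℝ} {g' x : ℝ} (h : HasDerivAt g g' x) :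
    HasDerivAt (fun y => ((g y : ℝ) : 𝕜)) ((g' : ℝ) : 𝕜) x :=
  (RCLike.ofRealCLM (K := 𝕜)).hasFDerivAt.comp_hasDerivAt x h

theorem hasDerivAt_opM (hu : SmoothField T u) (hT : IsOpen T) (hq : IsSpectral T u μ q) (k : ℕ)
    (x : ℝ) {t : ℝ} (ht : t ∈ T) :
    HasDerivAt (fun y => opM u μ q y t k) (opMX u μ q x t k) x := by
  induction k with
  | zero => exact hasDerivAt_const x 0
  | succ k ih =>
    refine (((ih.const_mul μ).add
      ((hasDerivAt_ofReal (DiffPoly.hasDerivAt_at hu hT (bPoly k) x ht)).mul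
        (hq.hasDerivAt_dX hT x ht))).sub
      (((hasDerivAt_ofReal (DiffPoly.hasDerivAt_at hu hT (totalD (bPoly k)) x ht)).const_mul
        ((1 : 𝕜) / 2)).mul (hq.hasDerivAt hT x ht))).congr_deriv ?_
    rw [opMX]
    ring

/-- At the real value ξ the powers of the spectral parameter can be absorbed in the coefficients,
which gives the form G_k ∂ - ½ (∂G_k) used in the polynomial identities. -/
theorem opM_real (f : ℝ → ℝ → ℝ) (x t : ℝ) (k : ℕ) : opM u ξ f x t k =
    (gPoly ξ k).at u x t * dX f x t - 1 / 2 * (totalD (gPoly ξ k)).at u x t * f x t := by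
  induction k with
  | zero => simp [opM, gPoly, DiffPoly.at]
  | succ k ih =>
    rw [opM, ih]
    simp only [gPoly, map_add, Derivation.leibniz, totalD_C, DiffPoly.at, map_mul, smul_eq_mul,
      mul_zero, add_zero, MvPolynomial.eval_C, RCLike.ofReal_real_eq_id, id]
    ring

theorem opMX_real (f : ℝ → ℝ → ℝ) (x t : ℝ) (k : ℕ) : opMX u ξ f x t k =
    1 / 2 * (totalD (gPoly ξ k)).at u x t * dX f x t
      - (ξ + u x t) * (gPoly ξ k).at u x t * f x t
      - 1 / 2 * (totalD (totalD (gPoly ξ k))).at u x t * f x t := by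
  induction k with
  | zero => simp [opMX, gPoly, DiffPoly.at]
  | succ k ih =>
    rw [opMX, ih]
    simp only [gPoly, map_add, Derivation.leibniz, totalD_C, DiffPoly.at, map_mul, smul_eq_mul,
      mul_zero, add_zero, MvPolynomial.eval_C, RCLike.ofReal_real_eq_id, id]
    ring

end

/-- The value of the primitive of `2 f A f`. -/
def thetaVal (u : ℝ → ℝ → ℝ) (ξ : ℝ) (f : ℝ → ℝ → ℝ) (k : ℕ) (x t : ℝ) : ℝ :=
  (thetaXX ξ k).at u x t * (f x t * f x t) + (thetaXY ξ k).at u x t * (f x t * dX f x t)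
    + (thetaYY ξ k).at u x t * (dX f x t * dX f x t)

/-- The values of the generators of `ExtPoly`. -/
def ExtPoly.gen (u f : ℝ → ℝ → ℝ) (i : ℕ ⊕ Fin 3) (x t : ℝ) : ℝ :=
  Sum.elim (fun k => iteratedDeriv k (fun y => u y t) x)
    ![f x t, KdVSources.dX f x t, (tau f x t)⁻¹] i

/-- The value of an extended differential polynomial. -/
def ExtPoly.val (P : ExtPoly) (u f : ℝ → ℝ → ℝ) (x t : ℝ) : ℝ :=
  MvPolynomial.eval (fun i => ExtPoly.gen u f i x t) P

namespace ExtPoly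

variable {u f : ℝ → ℝ → ℝ}

theorem val_U (k : ℕ) (x t : ℝ) :
    val (U k) u f x t = iteratedDeriv k (fun y => u y t) x := by simp [val, U, gen]
theorem val_F (x t : ℝ) : val F u f x t = f x t := by simp [val, F, gen]
theorem val_G (x t : ℝ) : val G u f x t = KdVSources.dX f x t := by simp [val, G, gen]
theorem val_S (x t : ℝ) : val S u f x t = (tau f x t)⁻¹ := by simp [val, S, gen]
theorem val_add (P Q : ExtPoly) (x t : ℝ) :
    val (P + Q) u f x t = val P u f x t + val Q u f x t := by simp [val]
theorem val_sub (P Q : ExtPoly) (x t : ℝ) :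
    val (P - Q) u f x t = val P u f x t - val Q u f x t := by simp [val]
theorem val_mul (P Q : ExtPoly) (x t : ℝ) :
    val (P * Q) u f x t = val P u f x t * val Q u f x t := by simp [val]
theorem val_neg (P : ExtPoly) (x t : ℝ) :
    val (-P) u f x t = - val P u f x t := by simp [val]
theorem val_two (x t : ℝ) : val 2 u f x t = 2 := by simp [val]
theorem val_C (a x t : ℝ) : val (MvPolynomial.C a) u f x t = a := by simp [val]
theorem val_incl (P : DiffPoly) (x t : ℝ) : val (incl P) u f x t = P.at u x t := by
  simp [val, incl, MvPolynomial.eval_rename, DiffPoly.at, Function.comp_def, gen]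

theorem val_theta (ξ : ℝ) (k : ℕ) (x t : ℝ) :
    val (theta ξ k) u f x t = thetaVal u ξ f k x t := by
  simp only [theta, val_add, val_mul, val_incl, val_F, val_G, thetaVal]

end ExtPoly

namespace IsSeed

variable {T : Set ℝ} {u f : ℝ → ℝ → ℝ} {ξ : ℝ}

/-- The passage from algebra to functions: evaluation turns D into d/dx, because the functions u⁽ᵏ⁾,
f, f_x, 1/τ satisfy the equations that define D on the generators. -/
theorem hasDerivAt_val (hf : IsSeed T u ξ f) (P : ExtPoly) (x : ℝ) {t : ℝ} (ht : t ∈ T) :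
    HasDerivAt (fun y => P.val u f y t) ((ExtPoly.D ξ P).val u f x t) x := by
  refine hasDerivAt_eval (y := fun i x => ExtPoly.gen u f i x t) (fun i => ?_) P
  change HasDerivAt _ (ExtPoly.val (ExtPoly.dGen ξ i) u f x t) x
  match i with
  | Sum.inl k =>
    have h := (hf.potential.smooth.iteratedDeriv hf.isOpen k).hasDerivAt_x hf.isOpen x ht
    refine h.congr_deriv ?_
    simp only [ExtPoly.dGen, Sum.elim_inl, ExtPoly.val_U, iteratedDeriv_succ, dX]
  | Sum.inr 0 =>
    refine (hf.spectral.hasDerivAt hf.isOpen x ht).congr_deriv ?_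
    simp [ExtPoly.dGen, ExtPoly.val_G]
  | Sum.inr 1 =>
    refine (hf.spectral.hasDerivAt_dX_real hf.isOpen x ht).congr_deriv ?_
    simp [ExtPoly.dGen, ExtPoly.val_mul, ExtPoly.val_neg, ExtPoly.val_add, ExtPoly.val_C,
      ExtPoly.val_U, ExtPoly.val_F]
  | Sum.inr 2 =>
    refine ((hf.hasDerivAt_tau x ht).inv (hf.tau_pos x ht).ne').congr_deriv ?_
    simp [ExtPoly.dGen, ExtPoly.val_mul, ExtPoly.val_neg, ExtPoly.val_F, ExtPoly.val_S]
    field_simp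

theorem hasDerivAt_theta (hf : IsSeed T u ξ f) (k : ℕ) (x : ℝ) {t : ℝ} (ht : t ∈ T) :
    HasDerivAt (fun y => thetaVal u ξ f k y t) (2 * f x t * opM u ξ f x t k) x := by
  have h := hf.hasDerivAt_val (ExtPoly.theta ξ k) x ht
  simp only [ExtPoly.val_theta, ExtPoly.D_theta, ← ExtPoly.incl_totalD, ExtPoly.val_sub,
    ExtPoly.val_mul, ExtPoly.val_incl, ExtPoly.val_two, ExtPoly.val_F, ExtPoly.val_G] at h
  refine h.congr_deriv ?_
  rw [opM_real]
  ring

theorem smooth_theta (hf : IsSeed T u ξ f) (k : ℕ) : SmoothField T (thetaVal u ξ f k) := by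
  have hu := DiffPoly.smooth_at hf.potential.smooth hf.isOpen
  have h1 := hf.spectral.smooth
  have h2 := h1.dX hf.isOpen
  exact (((hu _).mul (h1.mul h1)).add ((hu _).mul (h1.mul h2))).add ((hu _).mul (h2.mul h2))

theorem theta_bound (hf : IsSeed T u ξ f) (k : ℕ) {t₀ : ℝ} (ht₀ : t₀ ∈ T) (X : ℝ) :
    ∃ C, 0 ≤ C ∧ ∀ᶠ t in 𝓝 t₀, ∀ x ≤ X, |thetaVal u ξ f k x t| ≤ C * (jet f x t * jet f x t) := by
  have hb := fun P => DiffPoly.bounded_at hf.potential.smooth hf.isOpen hf.potential.bounded P ht₀ X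
  obtain ⟨C₁, hC₁, h1⟩ := hb (thetaXX ξ k)
  obtain ⟨C₂, hC₂, h2⟩ := hb (thetaXY ξ k)
  obtain ⟨C₃, hC₃, h3⟩ := hb (thetaYY ξ k)
  refine ⟨C₁ + C₂ + C₃, by positivity, ?_⟩
  filter_upwards [h1, h2, h3] with t h1 h2 h3 x hx
  have hF : |f x t| ≤ jet f x t := norm_le_jet f x t
  have hG : |dX f x t| ≤ jet f x t := norm_dX_le_jet f x t
  have hj := jet_nonneg f x t
  have key : ∀ {a b c C : ℝ}, 0 ≤ C → |a| ≤ C → |b| ≤ jet f x t → |c| ≤ jet f x t →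
      |a * (b * c)| ≤ C * (jet f x t * jet f x t) := by
    intro a b c C hC ha hb hc
    rw [abs_mul, abs_mul]
    exact mul_le_mul ha (mul_le_mul hb hc (abs_nonneg _) hj) (by positivity) hC
  refine (abs_add_three _ _ _).trans ?_
  have := key hC₁ (h1 x hx) hF hF
  have := key hC₂ (h2 x hx) hF hG
  have := key hC₃ (h3 x hx) hG hG
  linarith

theorem opM_bound (hf : IsSeed T u ξ f) (k : ℕ) {t₀ : ℝ} (ht₀ : t₀ ∈ T) (X : ℝ) :
    ∃ C, 0 ≤ C ∧ ∀ᶠ t in 𝓝 t₀, ∀ x ≤ X, |opM u ξ f x t k| ≤ C * jet f x t := by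
  have hb := fun P => DiffPoly.bounded_at hf.potential.smooth hf.isOpen hf.potential.bounded P ht₀ X
  obtain ⟨C₁, hC₁, h1⟩ := hb (gPoly ξ k)
  obtain ⟨C₂, hC₂, h2⟩ := hb (totalD (gPoly ξ k))
  refine ⟨C₁ + C₂, by positivity, ?_⟩
  filter_upwards [h1, h2] with t h1 h2 x hx
  have hF : |f x t| ≤ jet f x t := norm_le_jet f x t
  have hG : |dX f x t| ≤ jet f x t := norm_dX_le_jet f x t
  have hj := jet_nonneg f x t
  rw [opM_real]
  refine (abs_sub _ _).trans ?_
  have e1 := mul_le_mul (h1 x hx) hG (abs_nonneg _) hC₁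
  have e2 := mul_le_mul (h2 x hx) hF (abs_nonneg _) hC₂
  rw [← abs_mul] at e1 e2
  rw [mul_assoc, abs_mul (1 / 2 : ℝ), abs_of_nonneg (by norm_num : (0 : ℝ) ≤ 1 / 2)]
  linarith [abs_nonneg ((totalD (gPoly ξ k)).at u x t * f x t)]

end IsSeed

/-- A seed together with sources, evolving by the Lax pair. -/
structure IsSourceSeed (T : Set ℝ) (n : ℕ) {N : ℕ} (α η : ℝ) (lam : Fin N → ℝ) (u : ℝ → ℝ → ℝ)
    (φ : Fin N → ℝ → ℝ → ℝ) (ξ : ℝ) (f : ℝ → ℝ → ℝ) : Prop where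
  seed : IsSeed T u ξ f
  source : ∀ j, IsSpectral T u (lam j) (φ j)
  decay : ∀ j, DecayingProduct T f (φ j)
  evolution : ∀ x, ∀ t ∈ T, dT f x t =
    opM u ξ f x t (n + 2) + η * f x t + α * ∑ j, φ j x t * prim f (φ j) x t

namespace IsSourceSeed

variable {T : Set ℝ} {n N : ℕ} {α η : ℝ} {lam : Fin N → ℝ} {u : ℝ → ℝ → ℝ}
  {φ : Fin N → ℝ → ℝ → ℝ} {ξ : ℝ} {f : ℝ → ℝ → ℝ}

/-- The time derivative of `∂⁻¹f²`. -/
def tauRate (n : ℕ) {N : ℕ} (α η : ℝ) (u : ℝ → ℝ → ℝ) (φ : Fin N → ℝ → ℝ → ℝ) (ξ : ℝ)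
    (f : ℝ → ℝ → ℝ) (x t : ℝ) : ℝ :=
  thetaVal u ξ f (n + 2) x t + 2 * η * tau f x t + α * ∑ j, prim f (φ j) x t ^ 2

/-- Each term of 2 f f_t is an exact derivative: 2 f A f by the construction of θ, 2η f² trivially,
and 2 f φ_j ∂⁻¹(fφ_j) as the derivative of a square. -/
theorem hasDerivAt_tauRate (h : IsSourceSeed T n α η lam u φ ξ f) (x : ℝ) {t : ℝ} (ht : t ∈ T) :
    HasDerivAt (fun y => tauRate n α η u φ ξ f y t) (2 * f x t * dT f x t) x := by
  have hA : ∀ j, HasDerivAt (fun y => prim f (φ j) y t) (f x t • φ j x t) x := fun j =>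
    h.seed.hasDerivAt_prim (h.source j) (h.decay j) x ht
  refine (((h.seed.hasDerivAt_theta (n + 2) x ht).add
    ((h.seed.hasDerivAt_tau x ht).const_mul (2 * η))).add
    ((HasDerivAt.fun_sum fun j (_ : j ∈ Finset.univ) => (hA j).pow 2).const_mul α)).congr_deriv ?_
  rw [h.evolution x t ht, mul_add, mul_add]
  congr 1
  · ring
  · simp only [Finset.mul_sum]
    refine Finset.sum_congr rfl fun j _ => ?_
    simp only [smul_eq_mul]
    push_cast
    ring

/-- The domination that permits differentiating ∂⁻¹f² in t under the integral. The local terms are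
bounded by (jet f)²; in the source terms the inner primitive is bounded by the full integral of a
dominating function of f φ_j. -/
theorem tau_rate_dominated (h : IsSourceSeed T n α η lam u φ ξ f) {t₀ : ℝ} (ht₀ : t₀ ∈ T)
    (X : ℝ) : ∃ g : ℝ → ℝ, IntegrableOn g (Iic X) ∧
      ∀ᶠ t in 𝓝 t₀, ∀ x ≤ X, |2 * f x t * dT f x t| ≤ g x := by
  have hs := h.seed
  obtain ⟨C, hC0, hC⟩ := hs.opM_bound (n + 2) ht₀ X
  obtain ⟨g, hg, hgt⟩ := jet_mul_jet_dominated hs.potential hs.spectral hs.spectral hs.decay ht₀ X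
  choose G hG hGt using fun j =>
    (h.decay j).dominated hs.isOpen hs.spectral.smooth (h.source j).smooth ht₀ X
  refine ⟨fun x => 2 * (C + |η|) * g x + 2 * |α| * ∑ j, G j x * ∫ y in Iic X, G j y, ?_, ?_⟩
  · exact (hg.const_mul _).add
      ((integrable_finsetSum _ fun j _ => (hG j).mul_const _).const_mul _)
  · filter_upwards [hC, hgt, eventually_all.2 hGt, hs.isOpen.mem_nhds ht₀] with t h1 h2 h3 ht x hx
    have hj := jet_nonneg f x t
    have hF : |f x t| ≤ jet f x t := norm_le_jet f x t
    have hA : ∀ j, |f x t * φ j x t * prim f (φ j) x t| ≤ G j x * ∫ y in Iic X, G j y := by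
      intro j
      have e1 : |f x t * φ j x t| ≤ G j x := h3 j x hx
      have e2 : |prim f (φ j) x t| ≤ ∫ y in Iic X, G j y := by
        have hGx : IntegrableOn (G j) (Iic x) := (hG j).mono_set (Iic_subset_Iic.2 hx)
        have e3 : ‖prim f (φ j) x t‖ ≤ ∫ y in Iic x, G j y := by
          refine norm_integral_le_of_norm_le hGx ?_
          rw [ae_restrict_iff' measurableSet_Iic]
          exact ae_of_all _ fun y hy => h3 j y (le_trans hy hx)
        refine e3.trans (setIntegral_mono_set (hG j) ?_ (Iic_subset_Iic.2 hx).eventuallyLE)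
        rw [EventuallyLE, ae_restrict_iff' measurableSet_Iic]
        exact ae_of_all _ fun y hy => (norm_nonneg _).trans (h3 j y hy)
      rw [abs_mul]
      exact mul_le_mul e1 e2 (abs_nonneg _) ((abs_nonneg _).trans e1)
    have hM : |f x t * opM u ξ f x t (n + 2)| ≤ C * g x := by
      rw [abs_mul]
      calc |f x t| * |opM u ξ f x t (n + 2)| ≤ jet f x t * (C * jet f x t) :=
            mul_le_mul hF (h1 x hx) (abs_nonneg _) hj
        _ = C * (jet f x t * jet f x t) := by ring
        _ ≤ C * g x := mul_le_mul_of_nonneg_left (h2 x hx) hC0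
    have hη : |η * (f x t * f x t)| ≤ |η| * g x := by
      rw [abs_mul, abs_mul]
      refine mul_le_mul_of_nonneg_left ?_ (abs_nonneg _)
      exact (mul_le_mul hF hF (abs_nonneg _) hj).trans (h2 x hx)
    have hS : |∑ j, f x t * φ j x t * prim f (φ j) x t| ≤ ∑ j, G j x * ∫ y in Iic X, G j y :=
      (Finset.abs_sum_le_sum_abs _ _).trans (Finset.sum_le_sum fun j _ => hA j)
    have e : 2 * f x t * dT f x t = 2 * (f x t * opM u ξ f x t (n + 2) + η * (f x t * f x t) +
        α * ∑ j, f x t * φ j x t * prim f (φ j) x t) := by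
      simp only [h.evolution x t ht, mul_assoc, ← Finset.mul_sum]
      ring
    rw [e, abs_mul, abs_two]
    have e4 := (abs_add_three (f x t * opM u ξ f x t (n + 2)) (η * (f x t * f x t))
      (α * ∑ j, f x t * φ j x t * prim f (φ j) x t))
    rw [abs_mul α] at e4
    have e5 := mul_le_mul_of_nonneg_left hS (abs_nonneg α)
    linarith

/-- The time derivative of `∂⁻¹f²`. -/
theorem hasDerivAt_tau (h : IsSourceSeed T n α η lam u φ ξ f) (x : ℝ) {t : ℝ} (ht : t ∈ T) :
    HasDerivAt (fun s => tau f x s) (tauRate n α η u φ ξ f x t) t := by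
  have hs := h.seed
  have hT := hs.isOpen
  obtain ⟨g, hg, hgt⟩ := h.tau_rate_dominated ht x
  have hset : {s | s ∈ T ∧ ∀ y ≤ x, |2 * f y s * dT f y s| ≤ g y} ∈ 𝓝 t :=
    inter_mem (hT.mem_nhds ht) hgt
  have hsq : ∀ s ∈ T, Continuous (fun y => f y s ^ 2) := fun s hsT =>
    (hs.spectral.smooth.continuous_slice hT hsT).pow 2
  have hsm : Continuous (fun y => 2 * f y t * dT f y t) :=
    (continuous_const.mul (hs.spectral.smooth.continuous_slice hT ht)).mul
      ((hs.spectral.smooth.dT hT).continuous_slice hT ht)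
  have hint : IntegrableOn (fun y => f y t ^ 2) (Iic x) := by
    simpa only [smul_eq_mul, ← sq] using
      hs.decay.integrableOn hT hs.spectral.smooth hs.spectral.smooth ht x
  have key := hasDerivAt_integral_of_dominated_loc_of_deriv_le (μ := volume.restrict (Iic x))
    (F := fun s y => f y s ^ 2) (F' := fun s y => 2 * f y s * dT f y s) (bound := g) hset
    (by
      filter_upwards [hT.mem_nhds ht] with s hsT using (hsq s hsT).aestronglyMeasurable)
    hint hsm.aestronglyMeasurable
    (by
      rw [ae_restrict_iff' measurableSet_Iic]
      exact ae_of_all _ fun y hy s hs' => hs'.2 y hy)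
    hg
    (ae_of_all _ fun y s hs' => by
      refine ((hs.spectral.smooth.hasDerivAt_t hT y hs'.1).pow 2).congr_deriv ?_
      push_cast
      ring)
  refine key.2.congr_deriv ?_
  -- Both θ and ∂θ = 2 f A f are bounded by multiples of (jet f)², hence integrable, so θ tends to 0
  -- at -∞.
  have hθ : Tendsto (fun y => thetaVal u ξ f (n + 2) y t) atBot (𝓝 0) := by
    obtain ⟨C, hC0, hC⟩ := hs.theta_bound (n + 2) ht x
    obtain ⟨K, hK0, hK⟩ := hs.opM_bound (n + 2) ht x
    refine tendsto_zero_of_hasDerivAt_of_integrableOn_Iic (a := x)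
      (fun y _ => hs.hasDerivAt_theta (n + 2) y ht) ?_ ?_
    · refine integrableOn_of_jet_bound hs.potential hs.spectral hs.spectral hs.decay ht x (2 * K)
        ?_ (by positivity) fun y hy => ?_
      · exact (continuous_const.mul (hs.spectral.smooth.continuous_slice hT ht)).mul
          (continuous_iff_continuousAt.2 fun y =>
            (hasDerivAt_opM hs.potential.smooth hT hs.spectral (n + 2) y ht).continuousAt)
      · rw [norm_mul, norm_mul, Real.norm_ofNat]
        have e1 := norm_le_jet f y t
        have e2 : ‖opM u ξ f y t (n + 2)‖ ≤ K * jet f y t := hK.self_of_nhds y hy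
        have e3 := mul_le_mul e1 e2 (norm_nonneg _) (jet_nonneg f y t)
        linarith
    · exact integrableOn_of_jet_bound hs.potential hs.spectral hs.spectral hs.decay ht x C
        ((hs.smooth_theta (n + 2)).continuous_slice hT ht) hC0 fun y hy => hC.self_of_nhds y hy
  have hτ : Tendsto (fun y => tau f y t) atBot (𝓝 0) := by
    rw [tau_eq_prim]
    exact hs.decay.tendsto_integral hT hs.spectral.smooth hs.spectral.smooth ht
  have hA : ∀ j, Tendsto (fun y => prim f (φ j) y t) atBot (𝓝 0) := fun j =>
    (h.decay j).tendsto_integral hT hs.spectral.smooth (h.source j).smooth ht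
  have hlim : Tendsto (fun y => tauRate n α η u φ ξ f y t) atBot (𝓝 0) := by
    have := (hθ.add (hτ.const_mul (2 * η))).add
      ((tendsto_finsetSum Finset.univ fun j _ => (hA j).pow 2).const_mul α)
    simp only [mul_zero, add_zero, ne_eq, OfNat.ofNat_ne_zero, not_false_eq_true, zero_pow,
      Finset.sum_const_zero] at this
    exact this
  have h1 := integral_Iic_of_hasDerivAt_of_tendsto' (fun y _ => h.hasDerivAt_tauRate y ht)
    key.1 hlim
  rw [h1, sub_zero]

end IsSourceSeed

/-! ### Joint smoothness of ∂⁻¹f² -/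

namespace IsSeed

variable {T : Set ℝ} {u f p : ℝ → ℝ → ℝ} {ξ lam : ℝ}

/-- Near a point τ is Lipschitz in x, uniformly in t, since τ_x = f² is locally bounded. Continuity
in t for each fixed x then gives joint continuity. -/
theorem continuousOn_tau (hf : IsSeed T u ξ f)
    (hc : ∀ x, ∀ t ∈ T, ContinuousAt (fun s => tau f x s) t) :
    ContinuousOn (fun z : ℝ × ℝ => tau f z.1 z.2) (univ ×ˢ T) := by
  rintro ⟨x₀, t₀⟩ ⟨-, ht₀⟩
  refine ContinuousAt.continuousWithinAt ?_
  have hcont : ContinuousAt (fun z : ℝ × ℝ => f z.1 z.2 ^ 2) (x₀, t₀) :=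
    (hf.spectral.smooth.contDiffAt hf.isOpen x₀ ht₀).continuousAt.pow 2
  set C := f x₀ t₀ ^ 2 + 1
  have hlt : ∀ᶠ z in 𝓝 (x₀, t₀), f z.1 z.2 ^ 2 < C :=
    hcont.eventually_lt_const (by simp [C])
  rw [nhds_prod_eq] at hlt
  obtain ⟨P, hP, Q, hQ, hPQ⟩ := eventually_prod_iff.1 hlt
  obtain ⟨r, hr, hrP⟩ := Metric.eventually_nhds_iff_ball.1 hP
  have hbd : ∀ᶠ z : ℝ × ℝ in 𝓝 (x₀, t₀), ‖tau f z.1 z.2 - tau f x₀ t₀‖ ≤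
      C * ‖z.1 - x₀‖ + ‖tau f x₀ z.2 - tau f x₀ t₀‖ := by
    rw [nhds_prod_eq]
    refine eventually_prod_iff.2 ⟨fun x => x ∈ Metric.ball x₀ r, Metric.ball_mem_nhds _ hr,
      fun t => Q t ∧ t ∈ T, hQ.and (hf.isOpen.mem_nhds ht₀), ?_⟩
    rintro x hx t ⟨hQt, ht⟩
    have h1 := (convex_ball x₀ r).norm_image_sub_le_of_norm_hasDerivWithin_le
      (f := fun y => tau f y t) (f' := fun y => f y t ^ 2) (C := C)
      (fun y _ => (hf.hasDerivAt_tau y ht).hasDerivWithinAt)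
      (fun y hy => by
        rw [Real.norm_of_nonneg (sq_nonneg _)]
        exact (hPQ (hrP y hy) hQt).le)
      (Metric.mem_ball_self hr) hx
    have h2 : tau f x t - tau f x₀ t₀ =
        (tau f x t - tau f x₀ t) + (tau f x₀ t - tau f x₀ t₀) := by ring
    rw [h2]
    exact (norm_add_le _ _).trans (add_le_add_left h1 _)
  refine tendsto_iff_norm_sub_tendsto_zero.2 (squeeze_zero' (Eventually.of_forall fun _ =>
    norm_nonneg _) hbd ?_)
  have e1 : Tendsto (fun z : ℝ × ℝ => C * ‖z.1 - x₀‖) (𝓝 (x₀, t₀)) (𝓝 0) := by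
    have : ContinuousAt (fun z : ℝ × ℝ => C * ‖z.1 - x₀‖) (x₀, t₀) := by fun_prop
    simpa [ContinuousAt] using this
  have e2 : Tendsto (fun z : ℝ × ℝ => ‖tau f x₀ z.2 - tau f x₀ t₀‖) (𝓝 (x₀, t₀)) (𝓝 0) := by
    have h3 : ContinuousAt (fun z : ℝ × ℝ => tau f x₀ z.2) (x₀, t₀) :=
      ContinuousAt.comp (g := fun s => tau f x₀ s) (f := Prod.snd) (x := (x₀, t₀))
        (hc x₀ t₀ ht₀) continuousAt_snd
    exact tendsto_iff_norm_sub_tendsto_zero.1 h3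
  simpa using e1.add e2

/-- The primitive of `f p` is as smooth as that of `f²`. -/
theorem contDiffOn_prim (hf : IsSeed T u ξ f) (hp : IsSpectral T u lam p)
    (hd : DecayingProduct T f p) {m : ℕ}
    (hτ : ContDiffOn ℝ m (fun z : ℝ × ℝ => tau f z.1 z.2) (univ ×ˢ T)) :
    ContDiffOn ℝ m (fun z : ℝ × ℝ => prim f p z.1 z.2) (univ ×ˢ T) := by
  have hm : (m : ℕ∞ω) ≤ ∞ := ENat.LEInfty.out
  by_cases hlam : lam = ξ
  · subst hlam
    rintro ⟨x, t⟩ ⟨-, ht⟩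
    refine ContDiffAt.contDiffWithinAt ?_
    have hmem := (isOpen_domain hf.isOpen).mem_nhds (show (x, t) ∈ univ ×ˢ T from ⟨mem_univ _, ht⟩)
    obtain ⟨x₀, h0⟩ := hf.nontrivial t ht
    have hslice : ∀ {h : ℝ → ℝ → ℝ}, SmoothField T h →
        ContDiffAt ℝ m (fun z : ℝ × ℝ => h x₀ z.2) (x, t) := fun hh =>
      ContDiffAt.comp (g := fun z : ℝ × ℝ => _) (f := fun z : ℝ × ℝ => (x₀, z.2)) (x, t)
        ((hh.contDiffAt hf.isOpen x₀ ht).of_le hm) (contDiffAt_const.prodMk contDiffAt_snd)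
    have hfs := hslice hf.spectral.smooth
    -- When λ = ξ, p = c(t) f with c(t) = p(x₀, t) / f(x₀, t). The same x₀ serves for all nearby
    -- times, so c is smooth there.
    have hev : (fun z : ℝ × ℝ => prim f p z.1 z.2) =ᶠ[𝓝 (x, t)]
        fun z => tau f z.1 z.2 * ((f x₀ z.2)⁻¹ * p x₀ z.2) := by
      filter_upwards [hmem, hfs.continuousAt.eventually_ne h0] with z hz hne
      have := proportional (𝕜 := ℝ) hf.potential hf.spectral (by simpa using hp) hd hz.2 hne
      rw [prim_smul_const this, ← tau_eq_prim]
      rfl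
    refine ContDiffAt.congr_of_eventuallyEq ?_ hev
    exact (hτ.contDiffAt hmem).mul ((hfs.inv h0).mul (hslice hp.smooth))
  · exact (ContDiffOn.of_le (hf.smooth_prim_of_ne hp hd (by simpa using hlam)) hm)

end IsSeed

namespace IsSourceSeed

variable {T : Set ℝ} {n N : ℕ} {α η : ℝ} {lam : Fin N → ℝ} {u : ℝ → ℝ → ℝ}
  {φ : Fin N → ℝ → ℝ → ℝ} {ξ : ℝ} {f : ℝ → ℝ → ℝ}

theorem contDiffOn_tauRate (h : IsSourceSeed T n α η lam u φ ξ f) {m : ℕ}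
    (hτ : ContDiffOn ℝ m (fun z : ℝ × ℝ => tau f z.1 z.2) (univ ×ˢ T)) :
    ContDiffOn ℝ m (fun z : ℝ × ℝ => tauRate n α η u φ ξ f z.1 z.2) (univ ×ˢ T) := by
  have h1 : ContDiffOn ℝ m (fun z : ℝ × ℝ => thetaVal u ξ f (n + 2) z.1 z.2) (univ ×ˢ T) :=
    ContDiffOn.of_le (h.seed.smooth_theta (n + 2)) ENat.LEInfty.out
  exact (h1.add (contDiffOn_const.mul hτ)).add (contDiffOn_const.mul
    (ContDiffOn.sum fun j _ => (h.seed.contDiffOn_prim (h.source j) (h.decay j) hτ).pow 2))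

/-- Bootstrap: τ_x = f² is smooth, and τ_t is built from smooth functions, τ and the ∂⁻¹(fφ_j),
which are as smooth as τ. So τ ∈ Cᵐ gives both partial derivatives in Cᵐ, hence τ ∈ Cᵐ⁺¹. -/
theorem smooth_tau (h : IsSourceSeed T n α η lam u φ ξ f) : SmoothField T (tau f) := by
  have hT := h.seed.isOpen
  have hO := isOpen_domain hT
  refine contDiffOn_infty.2 fun m => ?_
  induction m with
  | zero =>
    exact contDiffOn_zero.2 (h.seed.continuousOn_tau fun x t ht =>
      (h.hasDerivAt_tau x ht).continuousAt)
  | succ m ih =>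
    have hf2 : ContDiffOn ℝ m (fun z : ℝ × ℝ => f z.1 z.2 ^ 2) (univ ×ˢ T) :=
      (ContDiffOn.of_le h.seed.spectral.smooth ENat.LEInfty.out).pow 2
    have hr := h.contDiffOn_tauRate ih
    set D₁ : ℝ → ℝ → ℝ →L[ℝ] ℝ := fun x t => (f x t ^ 2) • ContinuousLinearMap.id ℝ ℝ
    set D₂ : ℝ → ℝ → ℝ →L[ℝ] ℝ := fun x t =>
      tauRate n α η u φ ξ f x t • ContinuousLinearMap.id ℝ ℝ
    have hd : ∀ z ∈ (univ : Set ℝ) ×ˢ T, HasFDerivAt (fun z : ℝ × ℝ => tau f z.1 z.2)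
        (f z.1 z.2 ^ 2 • ContinuousLinearMap.fst ℝ ℝ ℝ +
          tauRate n α η u φ ξ f z.1 z.2 • ContinuousLinearMap.snd ℝ ℝ ℝ) z := by
      rintro z hz
      have hmem := hO.mem_nhds hz
      -- Continuity of both partial derivatives yields joint differentiability.
      have key := hasStrictFDerivAt_uncurry_coprod (𝕜 := ℝ) (u := z) (f := tau f) (f₁ := D₁)
        (f₂ := D₂)
        (by
          filter_upwards [hmem] with w hw
          refine (h.seed.hasDerivAt_tau w.1 hw.2).hasFDerivAt.congr_fderiv ?_
          ext
          simp [D₁, Function.HasUncurry.uncurry])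
        (by
          filter_upwards [hmem] with w hw
          refine (h.hasDerivAt_tau w.1 hw.2).hasFDerivAt.congr_fderiv ?_
          ext
          simp [D₂, Function.HasUncurry.uncurry])
        ((hf2.continuousOn.continuousAt hmem).smul continuousAt_const)
        ((hr.continuousOn.continuousAt hmem).smul continuousAt_const)
      refine key.hasFDerivAt.congr_fderiv ?_
      ext <;> simp [D₁, D₂, Function.HasUncurry.uncurry]
    push_cast
    rw [contDiffOn_succ_iff_hasFDerivWithinAt_of_uniqueDiffOn hO.uniqueDiffOn]
    refine ⟨by simp, _, ?_, fun z hz => (hd z hz).hasFDerivWithinAt⟩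
    exact (hf2.smul contDiffOn_const).add (hr.smul contDiffOn_const)

end IsSourceSeed

/-! ### The transformed potential -/

namespace IsSeed

variable {𝕜 : Type*} [RCLike 𝕜] {T : Set ℝ} {u f : ℝ → ℝ → ℝ} {ξ : ℝ} {μ : 𝕜} {q : ℝ → ℝ → 𝕜}

theorem smooth_val (hf : IsSeed T u ξ f) (hτ : SmoothField T (tau f)) (P : ExtPoly) :
    SmoothField T (P.val u f) := by
  induction P using MvPolynomial.induction_on with
  | C a => exact (SmoothField.const a).congr fun x t _ => ExtPoly.val_C a x t
  | add p q hp hq => exact (hp.add hq).congr fun x t _ => ExtPoly.val_add p q x t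
  | mul_X p i hp =>
    have hi : SmoothField T (ExtPoly.gen u f i) := by
      match i with
      | Sum.inl k => exact hf.potential.smooth.iteratedDeriv hf.isOpen k
      | Sum.inr 0 => exact hf.spectral.smooth
      | Sum.inr 1 => exact hf.spectral.smooth.dX hf.isOpen
      | Sum.inr 2 => exact ContDiffOn.inv hτ fun z hz => (hf.tau_pos z.1 hz.2).ne'
    exact (hp.mul hi).congr fun x t _ => by simp [ExtPoly.val]

theorem iteratedDeriv_darbouxPotential (hf : IsSeed T u ξ f) (k : ℕ) (x : ℝ) {t : ℝ}
    (ht : t ∈ T) : iteratedDeriv k (fun y => binaryDarbouxPotential f u y t) x =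
      ExtPoly.val ((ExtPoly.D ξ)^[k] (ExtPoly.darbouxU ξ)) u f x t := by
  induction k generalizing x with
  | zero =>
    have h1 : (deriv fun y => Real.log (tau f y t)) =
        fun y => ExtPoly.val (ExtPoly.F * ExtPoly.F * ExtPoly.S) u f y t := by
      funext y
      rw [((hf.hasDerivAt_tau y ht).log (hf.tau_pos y ht).ne').deriv]
      simp only [ExtPoly.val_mul, ExtPoly.val_F, ExtPoly.val_S]
      ring
    have h2 : iteratedDeriv 2 (fun y => Real.log (tau f y t)) x =
        ExtPoly.val (ExtPoly.D ξ (ExtPoly.F * ExtPoly.F * ExtPoly.S)) u f x t := by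
      rw [iteratedDeriv_succ, iteratedDeriv_one, h1]
      exact (hf.hasDerivAt_val _ x ht).deriv
    rw [iteratedDeriv_zero, Function.iterate_zero, id, ExtPoly.darbouxU, ExtPoly.val_add,
      ExtPoly.val_mul, ExtPoly.val_two, ExtPoly.val_U, iteratedDeriv_zero, ← h2]
    rfl
  | succ k ih =>
    rw [iteratedDeriv_succ, funext ih, Function.iterate_succ_apply']
    exact (hf.hasDerivAt_val _ x ht).deriv

theorem at_darbouxPotential (hf : IsSeed T u ξ f) (P : DiffPoly) (x : ℝ) {t : ℝ} (ht : t ∈ T) :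
    P.at (binaryDarbouxPotential f u) x t = (ExtPoly.darbouxHom ξ P).val u f x t := by
  simp only [DiffPoly.at, hf.iteratedDeriv_darbouxPotential _ x ht]
  induction P using MvPolynomial.induction_on with
  | C a => simp [ExtPoly.val, ExtPoly.darbouxHom]
  | add p q hp hq => simp only [map_add, hp, hq, ExtPoly.val_add]
  | mul_X p i hp =>
    simp only [map_mul, hp, ExtPoly.val_mul, MvPolynomial.eval_X, ExtPoly.darbouxHom_X]

theorem darbouxPotential_eq (hf : IsSeed T u ξ f) (x : ℝ) {t : ℝ} (ht : t ∈ T) :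
    binaryDarbouxPotential f u x t = u x t + 2 * (2 * f x t * dX f x t * (tau f x t)⁻¹
      - f x t ^ 4 * (tau f x t)⁻¹ ^ 2) := by
  have := hf.iteratedDeriv_darbouxPotential 0 x ht
  rw [iteratedDeriv_zero, Function.iterate_zero, id, ExtPoly.darbouxU] at this
  rw [this]
  simp only [Derivation.leibniz, smul_eq_mul, ExtPoly.D_F, ExtPoly.D_S, ExtPoly.val_add,
    ExtPoly.val_mul, ExtPoly.val_neg, ExtPoly.val_U, ExtPoly.val_F, ExtPoly.val_G, ExtPoly.val_S,
    ExtPoly.val_two, iteratedDeriv_zero]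
  ring

/-- The extended differential polynomials whose values stay bounded at `-∞`. -/
def _root_.KdVSources.ExtPoly.boundedPart : Subalgebra ℝ ExtPoly :=
  Algebra.adjoin ℝ (range ExtPoly.U ∪ {ExtPoly.F * ExtPoly.F * ExtPoly.S,
    ExtPoly.F * ExtPoly.G * ExtPoly.S, ExtPoly.G * ExtPoly.G * ExtPoly.S})

/-- Stability under D is what bounds all x-derivatives of ū. Differentiating s yields -(f²s) s, so
that each quadratic quantity divided by τ only acquires a further bounded factor f²s. -/
theorem _root_.KdVSources.ExtPoly.D_mem_boundedPart (ξ : ℝ) {P : ExtPoly}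
    (hP : P ∈ ExtPoly.boundedPart) : ExtPoly.D ξ P ∈ ExtPoly.boundedPart := by
  have hU : ∀ k, ExtPoly.U k ∈ ExtPoly.boundedPart := fun k =>
    Algebra.subset_adjoin (Or.inl ⟨k, rfl⟩)
  have hv : ExtPoly.F * ExtPoly.F * ExtPoly.S ∈ ExtPoly.boundedPart :=
    Algebra.subset_adjoin (Or.inr (by simp))
  have hw : ExtPoly.F * ExtPoly.G * ExtPoly.S ∈ ExtPoly.boundedPart :=
    Algebra.subset_adjoin (Or.inr (by simp))
  have hz : ExtPoly.G * ExtPoly.G * ExtPoly.S ∈ ExtPoly.boundedPart :=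
    Algebra.subset_adjoin (Or.inr (by simp))
  have hξ : MvPolynomial.C ξ + ExtPoly.U 0 ∈ ExtPoly.boundedPart :=
    add_mem (ExtPoly.boundedPart.algebraMap_mem ξ) (hU 0)
  induction hP using Algebra.adjoin_induction with
  | mem P hP =>
    rcases hP with ⟨k, rfl⟩ | rfl | rfl | rfl
    · rw [ExtPoly.D_U]; exact hU _
    · have : ExtPoly.D ξ (ExtPoly.F * ExtPoly.F * ExtPoly.S) =
          ExtPoly.F * ExtPoly.G * ExtPoly.S + ExtPoly.F * ExtPoly.G * ExtPoly.S -
          (ExtPoly.F * ExtPoly.F * ExtPoly.S) * (ExtPoly.F * ExtPoly.F * ExtPoly.S) := by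
        simp only [Derivation.leibniz, smul_eq_mul, ExtPoly.D_F, ExtPoly.D_S]; ring
      rw [this]
      exact sub_mem (add_mem hw hw) (mul_mem hv hv)
    · have : ExtPoly.D ξ (ExtPoly.F * ExtPoly.G * ExtPoly.S) =
          ExtPoly.G * ExtPoly.G * ExtPoly.S - (MvPolynomial.C ξ + ExtPoly.U 0) *
          (ExtPoly.F * ExtPoly.F * ExtPoly.S) -
          (ExtPoly.F * ExtPoly.F * ExtPoly.S) * (ExtPoly.F * ExtPoly.G * ExtPoly.S) := by
        simp only [Derivation.leibniz, smul_eq_mul, ExtPoly.D_F, ExtPoly.D_G, ExtPoly.D_S]; ring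
      rw [this]
      exact sub_mem (sub_mem hz (mul_mem hξ hv)) (mul_mem hv hw)
    · have : ExtPoly.D ξ (ExtPoly.G * ExtPoly.G * ExtPoly.S) =
          - (MvPolynomial.C ξ + ExtPoly.U 0) * (ExtPoly.F * ExtPoly.G * ExtPoly.S) -
          (MvPolynomial.C ξ + ExtPoly.U 0) * (ExtPoly.F * ExtPoly.G * ExtPoly.S) -
          (ExtPoly.F * ExtPoly.F * ExtPoly.S) * (ExtPoly.G * ExtPoly.G * ExtPoly.S) := by
        simp only [Derivation.leibniz, smul_eq_mul, ExtPoly.D_G, ExtPoly.D_S]; ring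
      rw [this]
      exact sub_mem (sub_mem (mul_mem (neg_mem hξ) hw) (mul_mem hξ hw)) (mul_mem hv hz)
  | algebraMap a =>
    rw [Derivation.map_algebraMap]; exact zero_mem _
  | add P Q _ _ h1 h2 => rw [map_add]; exact add_mem h1 h2
  | mul P Q hP hQ h1 h2 =>
    rw [Derivation.leibniz]
    exact add_mem (mul_mem hP h2) (mul_mem hQ h1)

theorem bounded_val (hf : IsSeed T u ξ f) {P : ExtPoly} (hP : P ∈ ExtPoly.boundedPart)
    {t₀ : ℝ} (ht₀ : t₀ ∈ T) :
    ∃ C, 0 ≤ C ∧ ∀ᶠ t in 𝓝 t₀, ∀ x ≤ 0, |P.val u f x t| ≤ C := by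
  induction hP using Algebra.adjoin_induction with
  | mem P hP =>
    obtain ⟨K, hK0, hK⟩ := hf.jet_sq_le_tau ht₀ 0
    have quad : ∃ C, 0 ≤ C ∧ ∀ᶠ t in 𝓝 t₀, ∀ x ≤ 0, ∀ a b : ℝ, |a| ≤ jet f x t →
        |b| ≤ jet f x t → |a * b * (tau f x t)⁻¹| ≤ C := by
      refine ⟨K, hK0.le, ?_⟩
      filter_upwards [hK, hf.isOpen.mem_nhds ht₀] with t h1 ht x hx a b ha hb
      have hτ := hf.tau_pos x ht
      rw [abs_mul, abs_mul, abs_inv, abs_of_pos hτ, ← div_eq_mul_inv, div_le_iff₀ hτ]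
      refine le_trans ?_ (h1 x hx)
      rw [sq]
      exact mul_le_mul ha hb (abs_nonneg _) (jet_nonneg f x t)
    obtain ⟨C, hC0, hC⟩ := quad
    rcases hP with ⟨k, rfl⟩ | rfl | rfl | rfl
    · obtain ⟨C, hC0, hC⟩ := DiffPoly.bounded_at hf.potential.smooth hf.isOpen
        hf.potential.bounded (MvPolynomial.X k) ht₀ 0
      refine ⟨C, hC0, ?_⟩
      simpa only [DiffPoly.at_X, ← ExtPoly.val_U (f := f)] using hC
    all_goals
      refine ⟨C, hC0, ?_⟩
      filter_upwards [hC] with t h1 x hx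
      simp only [ExtPoly.val_mul, ExtPoly.val_F, ExtPoly.val_G, ExtPoly.val_S]
      refine h1 x hx _ _ ?_ ?_ <;> first | exact norm_le_jet f x t | exact norm_dX_le_jet f x t
  | algebraMap a =>
    exact ⟨|a|, abs_nonneg _, Eventually.of_forall fun t x _ => by
      rw [MvPolynomial.algebraMap_eq, ExtPoly.val_C]⟩
  | add P Q _ _ h1 h2 =>
    obtain ⟨C, hC0, hC⟩ := h1
    obtain ⟨C', hC0', hC'⟩ := h2
    refine ⟨C + C', by positivity, ?_⟩
    filter_upwards [hC, hC'] with t h1 h2 x hx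
    rw [ExtPoly.val_add]
    exact (abs_add_le _ _).trans (add_le_add (h1 x hx) (h2 x hx))
  | mul P Q _ _ h1 h2 =>
    obtain ⟨C, hC0, hC⟩ := h1
    obtain ⟨C', hC0', hC'⟩ := h2
    refine ⟨C * C', by positivity, ?_⟩
    filter_upwards [hC, hC'] with t h1 h2 x hx
    rw [ExtPoly.val_mul, abs_mul]
    exact mul_le_mul (h1 x hx) (h2 x hx) (abs_nonneg _) hC0

theorem isPotential_darboux (hf : IsSeed T u ξ f) (hτ : SmoothField T (tau f)) :
    IsPotential T (binaryDarbouxPotential f u) where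
  isOpen := hf.isOpen
  smooth := (hf.smooth_val hτ (ExtPoly.darbouxU ξ)).congr fun x t ht => by
    simpa using hf.iteratedDeriv_darbouxPotential 0 x ht
  bounded := by
    intro k t₀ ht₀
    have hU : ExtPoly.U 0 ∈ ExtPoly.boundedPart := Algebra.subset_adjoin (Or.inl ⟨0, rfl⟩)
    have hv : ExtPoly.F * ExtPoly.F * ExtPoly.S ∈ ExtPoly.boundedPart :=
      Algebra.subset_adjoin (Or.inr (by simp))
    have hmem : (ExtPoly.D ξ)^[k] (ExtPoly.darbouxU ξ) ∈ ExtPoly.boundedPart := by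
      induction k with
      | zero =>
        have := ExtPoly.D_mem_boundedPart ξ hv
        rw [Function.iterate_zero, id, ExtPoly.darbouxU, two_mul]
        exact add_mem hU (add_mem this this)
      | succ k ih =>
        rw [Function.iterate_succ_apply']
        exact ExtPoly.D_mem_boundedPart ξ ih
    obtain ⟨C, -, hC⟩ := hf.bounded_val hmem ht₀
    refine ⟨C, ?_⟩
    filter_upwards [hC, hf.isOpen.mem_nhds ht₀] with t h1 ht x hx
    rw [hf.iteratedDeriv_darbouxPotential k x ht]
    exact h1 x hx

/-! ### The transformed wave functions -/

theorem binaryDarboux_eq (f : ℝ → ℝ → ℝ) (q : ℝ → ℝ → 𝕜) (x t : ℝ) : binaryDarboux f q x t =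
    q x t - (f x t * (tau f x t)⁻¹) • prim f q x t := by
  rw [← div_eq_mul_inv]; rfl

theorem hasDerivAt_binaryDarboux (hf : IsSeed T u ξ f) (hq : IsSpectral T u μ q)
    (hd : DecayingProduct T f q) (x : ℝ) {t : ℝ} (ht : t ∈ T) :
    HasDerivAt (fun y => binaryDarboux f q y t) (dX q x t -
      ((dX f x t * (tau f x t)⁻¹ - f x t ^ 3 * (tau f x t)⁻¹ ^ 2) • prim f q x t +
        (f x t ^ 2 * (tau f x t)⁻¹) • q x t)) x := by
  simp only [binaryDarboux_eq]
  refine ((hq.hasDerivAt hf.isOpen x ht).sub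
    (((hf.spectral.hasDerivAt hf.isOpen x ht).mul
      ((hf.hasDerivAt_tau x ht).inv (hf.tau_pos x ht).ne')).smul
      (hf.hasDerivAt_prim hq hd x ht))).congr_deriv ?_
  simp only [RCLike.real_smul_eq_coe_mul, Pi.mul_apply, Pi.inv_apply]
  have hτ' : ((tau f x t : ℝ) : 𝕜) ≠ 0 := by exact_mod_cast (hf.tau_pos x ht).ne'
  push_cast
  field_simp
  ring

theorem dX_binaryDarboux (hf : IsSeed T u ξ f) (hq : IsSpectral T u μ q)
    (hd : DecayingProduct T f q) (x : ℝ) {t : ℝ} (ht : t ∈ T) :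
    dX (binaryDarboux f q) x t = dX q x t -
      ((dX f x t * (tau f x t)⁻¹ - f x t ^ 3 * (tau f x t)⁻¹ ^ 2) • prim f q x t +
        (f x t ^ 2 * (tau f x t)⁻¹) • q x t) :=
  (hf.hasDerivAt_binaryDarboux hq hd x ht).deriv

/-- After clearing powers of τ, the terms that do not cancel identically are a multiple of W(f, q) -
(ξ - μ) ∂⁻¹(fq), which is zero. -/
theorem spectral_binaryDarboux (hf : IsSeed T u ξ f) (hq : IsSpectral T u μ q)
    (hd : DecayingProduct T f q) (x : ℝ) {t : ℝ} (ht : t ∈ T) :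
    iteratedDeriv 2 (fun y => binaryDarboux f q y t) x +
      (μ + ((binaryDarbouxPotential f u x t : ℝ) : 𝕜)) * binaryDarboux f q x t = 0 := by
  have h1 : deriv (fun y => binaryDarboux f q y t) = _ :=
    funext fun y => hf.dX_binaryDarboux hq hd y ht
  have hf1 := hf.spectral.hasDerivAt hf.isOpen x ht
  have hf2 := hf.spectral.hasDerivAt_dX_real hf.isOpen x ht
  have hs := (hf.hasDerivAt_tau x ht).inv (hf.tau_pos x ht).ne'
  have hq1 := hq.hasDerivAt hf.isOpen x ht
  rw [iteratedDeriv_succ, iteratedDeriv_one, h1]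
  refine (congrArg (· + _) (HasDerivAt.deriv
    ((hq.hasDerivAt_dX hf.isOpen x ht).sub
      ((((hf2.mul hs).sub ((hf1.pow 3).mul (hs.pow 2))).smul (hf.hasDerivAt_prim hq hd x ht)).add
        (((hf1.pow 2).mul hs).smul hq1))))).trans ?_
  have hW := wronskian_eq hf.potential hf.spectral hq hd x ht
  rw [wronskian] at hW
  rw [binaryDarboux_eq, hf.darbouxPotential_eq x ht]
  simp only [RCLike.real_smul_eq_coe_mul, Pi.mul_apply, Pi.inv_apply, Pi.sub_apply,
    Pi.pow_apply] at hW ⊢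
  have hτ' : ((tau f x t : ℝ) : 𝕜) ≠ 0 := by exact_mod_cast (hf.tau_pos x ht).ne'
  push_cast
  field_simp
  linear_combination -(((f x t : ℝ) : 𝕜) * ((tau f x t : ℝ) : 𝕜) ^ 2) * hW

theorem smooth_binaryDarboux (hf : IsSeed T u ξ f) (hτ : SmoothField T (tau f)) (hq : IsSpectral T u μ q)
    (hd : DecayingProduct T f q) : SmoothField T (binaryDarboux f q) := by
  by_cases hμ : μ = ξ
  · subst hμ
    exact (SmoothField.const 0).congr fun x t ht => hf.binaryDarboux_eq_zero hq hd x ht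
  · exact hq.smooth.sub ((hf.spectral.smooth.div hτ fun x t ht => (hf.tau_pos x ht).ne').smul
      (hf.smooth_prim_of_ne hq hd hμ))

end IsSeed

/-! ### Covariance of the evolution -/

/-- The local part of the time derivative of `∂⁻¹(f ψ)`. -/
def omega {𝕜 : Type*} [RCLike 𝕜] (u : ℝ → ℝ → ℝ) (ξ : ℝ) (f : ℝ → ℝ → ℝ) (μ : 𝕜)
    (ψ : ℝ → ℝ → 𝕜) (x t : ℝ) : ℕ → 𝕜
  | 0 => 0
  | k + 1 => μ * omega u ξ f μ ψ x t k
      + (((bPoly k).at u x t : ℝ) : 𝕜) * ((f x t : ℝ) : 𝕜) * ψ x t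
      + ((opM u ξ f x t k : ℝ) : 𝕜) * dX ψ x t - ((opMX u ξ f x t k : ℝ) : 𝕜) * ψ x t

/-- The right-hand side is W(A_k f, ψ) + W(f, A_k ψ), the change of W(f, ψ) under the local flow. It
is divisible by ξ - μ, and the recursion for `omega` defines the quotient. -/
theorem omega_eq {𝕜 : Type*} [RCLike 𝕜] (u : ℝ → ℝ → ℝ) (ξ : ℝ) (f : ℝ → ℝ → ℝ) (μ : 𝕜)
    (ψ : ℝ → ℝ → 𝕜) (x t : ℝ) (k : ℕ) :
    ((ξ : 𝕜) - μ) * omega u ξ f μ ψ x t k =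
      ((opM u ξ f x t k : ℝ) : 𝕜) * dX ψ x t + ((f x t : ℝ) : 𝕜) * opMX u μ ψ x t k
      - ((opMX u ξ f x t k : ℝ) : 𝕜) * ψ x t - ((dX f x t : ℝ) : 𝕜) * opM u μ ψ x t k := by
  induction k with
  | zero => simp [omega, opM, opMX]
  | succ k ih =>
    simp only [omega, opM, opMX, RCLike.ofReal_real_eq_id, id]
    push_cast
    linear_combination μ * ih

/-- This is the recursion of `omega` with ψ = f and μ = ξ. Thus θ_k plays for ∂⁻¹f² the role that
`omega` plays for ∂⁻¹(fψ). -/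
theorem thetaVal_succ (u : ℝ → ℝ → ℝ) (ξ : ℝ) (f : ℝ → ℝ → ℝ) (k : ℕ) (x t : ℝ) :
    thetaVal u ξ f (k + 1) x t = ξ * thetaVal u ξ f k x t + (bPoly k).at u x t * f x t ^ 2
      + opM u ξ f x t k * dX f x t - opMX u ξ f x t k * f x t := by
  have h := congrArg (fun P => ExtPoly.val P u f x t) (ExtPoly.two_mul_theta_succ ξ k)
  simp only [← ExtPoly.incl_totalD, ExtPoly.val_add, ExtPoly.val_mul, ExtPoly.val_two,
    ExtPoly.val_theta, ExtPoly.val_sub, ExtPoly.val_C, ExtPoly.val_incl, ExtPoly.val_F,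
    ExtPoly.val_G, ExtPoly.val_U, iteratedDeriv_zero] at h
  rw [opM_real, opMX_real]
  linear_combination h / 2

namespace IsSeed

variable {𝕜 : Type*} [RCLike 𝕜] {T : Set ℝ} {u f : ℝ → ℝ → ℝ} {ξ : ℝ} {μ : 𝕜} {q : ℝ → ℝ → 𝕜}

theorem bPoly_darboux (hf : IsSeed T u ξ f) (k : ℕ) (x : ℝ) {t : ℝ} (ht : t ∈ T) :
    (bPoly k).at (binaryDarbouxPotential f u) x t = (bPoly k).at u x t
      - (2 * f x t * opM u ξ f x t k * (tau f x t)⁻¹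
        - thetaVal u ξ f k x t * f x t ^ 2 * (tau f x t)⁻¹ ^ 2) := by
  rw [hf.at_darbouxPotential _ x ht, ExtPoly.darbouxHom_bPoly, opM_real]
  simp only [Derivation.leibniz, smul_eq_mul, ExtPoly.D_theta, ExtPoly.D_S, ← ExtPoly.incl_totalD,
    ExtPoly.val_add, ExtPoly.val_sub, ExtPoly.val_mul, ExtPoly.val_neg, ExtPoly.val_two,
    ExtPoly.val_theta, ExtPoly.val_incl, ExtPoly.val_F, ExtPoly.val_G, ExtPoly.val_S]
  ring

theorem totalD_bPoly_darboux (hf : IsSeed T u ξ f) (k : ℕ) (x : ℝ) {t : ℝ} (ht : t ∈ T) :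
    (totalD (bPoly k)).at (binaryDarbouxPotential f u) x t = (totalD (bPoly k)).at u x t
      - (2 * (dX f x t * opM u ξ f x t k + f x t * opMX u ξ f x t k) * (tau f x t)⁻¹
        - 4 * f x t ^ 3 * opM u ξ f x t k * (tau f x t)⁻¹ ^ 2
        + thetaVal u ξ f k x t * (2 * f x t ^ 4 * (tau f x t)⁻¹ ^ 3
          - 2 * f x t * dX f x t * (tau f x t)⁻¹ ^ 2)) := by
  have h2 : ExtPoly.D ξ (2 : ExtPoly) = 0 := (ExtPoly.D ξ).map_natCast 2
  rw [hf.at_darbouxPotential _ x ht, ExtPoly.darbouxHom_totalD, ExtPoly.darbouxHom_bPoly,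
    opM_real, opMX_real]
  simp only [Derivation.leibniz, smul_eq_mul, ExtPoly.D_theta, ExtPoly.D_F, ExtPoly.D_G,
    ExtPoly.D_S, h2, map_sub, map_add, map_neg, ← ExtPoly.incl_totalD,
    ExtPoly.val_add, ExtPoly.val_sub, ExtPoly.val_mul, ExtPoly.val_neg, ExtPoly.val_two,
    ExtPoly.val_theta, ExtPoly.val_incl, ExtPoly.val_F, ExtPoly.val_G, ExtPoly.val_S,
    ExtPoly.val_C, ExtPoly.val_U, iteratedDeriv_zero, mul_zero, add_zero]
  ring

/-- The transformation law of the operators `A`. -/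
theorem opM_darboux (hf : IsSeed T u ξ f) (hq : IsSpectral T u μ q)
    (hd : DecayingProduct T f q) (k : ℕ) (x : ℝ) {t : ℝ} (ht : t ∈ T) :
    opM (binaryDarbouxPotential f u) μ (binaryDarboux f q) x t k =
      opM u μ q x t k
      - (((tau f x t)⁻¹ : ℝ) : 𝕜) * prim f q x t * ((opM u ξ f x t k : ℝ) : 𝕜)
      - ((f x t : ℝ) : 𝕜) * (((tau f x t)⁻¹ : ℝ) : 𝕜) * (omega u ξ f μ q x t k
        - (((tau f x t)⁻¹ : ℝ) : 𝕜) * prim f q x t * ((thetaVal u ξ f k x t : ℝ) : 𝕜)) := by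
  induction k with
  | zero => simp [opM, omega, thetaVal, thetaXX, thetaXY, thetaYY, DiffPoly.at]
  | succ k ih =>
    have hW := wronskian_eq hf.potential hf.spectral hq hd x ht
    rw [wronskian] at hW
    rw [opM, ih, hf.bPoly_darboux k x ht, hf.totalD_bPoly_darboux k x ht,
      hf.dX_binaryDarboux hq hd x ht, binaryDarboux_eq, omega, thetaVal_succ, opM, opM]
    simp only [RCLike.real_smul_eq_coe_mul, RCLike.ofReal_real_eq_id, id] at hW ⊢
    generalize (tau f x t)⁻¹ = s
    push_cast
    -- The right-hand side of the law is the derivative of ψ - f s ∂⁻¹(fψ) under the local flow, in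
    -- which τ_t is θ_k and (∂⁻¹(fψ))_t is `omega`. The identity is polynomial in s; only the
    -- Wronskian formula for ∂⁻¹(fψ) is needed besides.
    linear_combination (((f x t : ℝ) : 𝕜) * (s : 𝕜) ^ 2 * ((thetaVal u ξ f k x t : ℝ) : 𝕜)
      - (s : 𝕜) * ((opM u ξ f x t k : ℝ) : 𝕜)) * hW

end IsSeed

namespace IsLaxSolution

variable {𝕜 : Type*} [RCLike 𝕜] {T : Set ℝ} {n N : ℕ} {α η : ℝ} {u : ℝ → ℝ → ℝ}
  {φ : Fin N → ℝ → ℝ → ℝ} {μ : 𝕜} {ψ : ℝ → ℝ → 𝕜}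

theorem isSpectral (h : IsLaxSolution T n α η u φ μ ψ) : IsSpectral T u μ ψ :=
  ⟨h.smooth, h.spectral⟩

theorem dT_eq (h : IsLaxSolution T n α η u φ μ ψ) (x : ℝ) {t : ℝ} (ht : t ∈ T) :
    dT ψ x t = opM u μ ψ x t (n + 2) + η • ψ x t + α • ∑ j, φ j x t • prim (φ j) ψ x t := by
  rw [← opA_eq_opM]
  exact h.evolution x t ht

theorem dT_dX_eq (h : IsLaxSolution T n α η u φ μ ψ) (hT : IsOpen T) (hu : SmoothField T u)
    (hφ : ∀ j, SmoothField T (φ j)) (x : ℝ) {t : ℝ} (ht : t ∈ T) :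
    dT (dX ψ) x t = opMX u μ ψ x t (n + 2) + η • dX ψ x t +
      α • ∑ j, (φ j x t • φ j x t • ψ x t + dX (φ j) x t • prim (φ j) ψ x t) := by
  rw [h.smooth.dT_dX hT x ht]
  have h1 : (fun y => dT ψ y t) = _ := funext fun y => h.dT_eq y ht
  rw [dX, h1]
  exact (((hasDerivAt_opM hu hT h.isSpectral (n + 2) x ht).add
    ((h.isSpectral.hasDerivAt hT x ht).const_smul η)).add
    ((HasDerivAt.fun_sum fun j (_ : j ∈ Finset.univ) => ((hφ j).hasDerivAt_x hT x ht).smul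
      ((h.decay j).hasDerivAt_integral hT (hφ j) h.smooth x ht)).const_smul α)).deriv

end IsLaxSolution

namespace IsSourceSeed

variable {𝕜 : Type*} [RCLike 𝕜] {T : Set ℝ} {n N : ℕ} {α η : ℝ} {lam : Fin N → ℝ}
  {u : ℝ → ℝ → ℝ} {φ : Fin N → ℝ → ℝ → ℝ} {ξ : ℝ} {f : ℝ → ℝ → ℝ} {μ : 𝕜} {ψ : ℝ → ℝ → 𝕜}

theorem of_isLaxSolution (hu : IsPotential T u) (hφ : ∀ j, IsSpectral T u (lam j) (φ j))
    (hf : IsLaxSolution T n α η u φ ξ f) (hff : DecayingProduct T f f)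
    (hf0 : ∀ t ∈ T, ∃ x, f x t ≠ 0) : IsSourceSeed T n α η lam u φ ξ f where
  seed := ⟨hu, hf.isSpectral, hff, hf0⟩
  source := hφ
  decay j := (hf.decay j).symm
  evolution x t ht := by
    rw [hf.dT_eq x ht]
    simp only [smul_eq_mul, prim_comm f]

/-- The time derivative of `∂⁻¹(f ψ)`. -/
theorem hasDerivAt_prim (h : IsSourceSeed T n α η lam u φ ξ f)
    (hf : IsLaxSolution T n α η u φ ξ f) (hψ : IsLaxSolution T n α η u φ μ ψ)
    (hd : DecayingProduct T f ψ) (hμ : μ ≠ ξ) (x : ℝ) {t : ℝ} (ht : t ∈ T) :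
    HasDerivAt (fun s => prim f ψ x s) (omega u ξ f μ ψ x t (n + 2) +
      (2 * η) • prim f ψ x t + α • ∑ j, prim f (φ j) x t • prim (φ j) ψ x t) t := by
  have hT := h.seed.isOpen
  have hu := h.seed.potential.smooth
  have hφ := fun j => (h.source j).smooth
  have hev : (fun s => prim f ψ x s) =ᶠ[𝓝 t]
      fun s => ((ξ : 𝕜) - μ)⁻¹ * wronskian f ψ x s := by
    filter_upwards [hT.mem_nhds ht] with s hs
    exact h.seed.prim_eq_of_ne hψ.isSpectral hd hμ x hs
  refine HasDerivAt.congr_of_eventuallyEq ?_ hev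
  refine ((((hf.smooth.hasDerivAt_t hT x ht).smul ((hψ.smooth.dX hT).hasDerivAt_t hT x ht)).sub
    (((hf.smooth.dX hT).hasDerivAt_t hT x ht).smul (hψ.smooth.hasDerivAt_t hT x ht))).const_mul
    ((ξ : 𝕜) - μ)⁻¹).congr_deriv ?_
  have hne : (ξ : 𝕜) - μ ≠ 0 := sub_ne_zero.2 hμ.symm
  rw [inv_mul_eq_iff_eq_mul₀ hne, hψ.dT_eq x ht, hψ.dT_dX_eq hT hu hφ x ht,
    hf.dT_dX_eq hT hu hφ x ht, hf.dT_eq x ht]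
  have hW := wronskian_eq h.seed.potential h.seed.spectral hψ.isSpectral hd x ht
  have hΩ := omega_eq u ξ f μ ψ x t (n + 2)
  -- The terms with φ_j² f ψ cancel. What is left is W(f, φ_j) ∂⁻¹(φ_jψ) + ∂⁻¹(fφ_j) W(φ_j, ψ), and
  -- the eigenvalue differences ξ - λ_j and λ_j - μ add up to ξ - μ.
  have hsum : ∑ j, (((φ j x t : ℝ) : 𝕜) * ((prim (φ j) f x t : ℝ) : 𝕜) * dX ψ x t
      + ((f x t : ℝ) : 𝕜) * (((φ j x t : ℝ) : 𝕜) * (((φ j x t : ℝ) : 𝕜) * ψ x t)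
        + ((dX (φ j) x t : ℝ) : 𝕜) * prim (φ j) ψ x t)
      - (((φ j x t : ℝ) : 𝕜) * (((φ j x t : ℝ) : 𝕜) * ((f x t : ℝ) : 𝕜))
        + ((dX (φ j) x t : ℝ) : 𝕜) * ((prim (φ j) f x t : ℝ) : 𝕜)) * ψ x t
      - ((dX f x t : ℝ) : 𝕜) * (((φ j x t : ℝ) : 𝕜) * prim (φ j) ψ x t)) =
      ((ξ : 𝕜) - μ) * ∑ j, ((prim f (φ j) x t : ℝ) : 𝕜) * prim (φ j) ψ x t := by
    rw [Finset.mul_sum]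
    refine Finset.sum_congr rfl fun j _ => ?_
    have h1 := wronskian_eq h.seed.potential h.seed.spectral (h.source j) (h.decay j) x ht
    have h2 := wronskian_eq h.seed.potential (h.source j) hψ.isSpectral (hψ.decay j) x ht
    have h1' := congrArg (fun r : ℝ => (r : 𝕜)) h1
    simp only [wronskian, RCLike.real_smul_eq_coe_mul, RCLike.ofReal_real_eq_id, id] at h1' h2
    push_cast at h1'
    rw [prim_comm (φ j) f]
    linear_combination prim (φ j) ψ x t * h1' + ((prim f (φ j) x t : ℝ) : 𝕜) * h2
  simp only [Finset.sum_add_distrib, Finset.sum_sub_distrib, mul_add, add_mul,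
    ← Finset.mul_sum, ← Finset.sum_mul] at hsum
  simp only [wronskian, RCLike.real_smul_eq_coe_mul, smul_eq_mul,
    Finset.sum_add_distrib] at hW hΩ ⊢
  push_cast
  linear_combination (α : 𝕜) * hsum + 2 * (η : 𝕜) * hW - hΩ

/-- The sum over the transformed sources. -/
theorem sum_binaryDarboux (h : IsSourceSeed T n α η lam u φ ξ f)
    (hψ : IsLaxSolution T n α η u φ μ ψ) (hd : DecayingProduct T f ψ) (hμ : μ ≠ ξ) (x : ℝ)
    {t : ℝ} (ht : t ∈ T) :
    ∑ j, binaryDarboux f (φ j) x t • prim (binaryDarboux f (φ j)) (binaryDarboux f ψ) x t =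
      ∑ j, ((φ j x t : ℝ) : 𝕜) * prim (φ j) ψ x t
      - ((f x t : ℝ) : 𝕜) * (((tau f x t)⁻¹ : ℝ) : 𝕜) *
        ∑ j, ((prim f (φ j) x t : ℝ) : 𝕜) * prim (φ j) ψ x t
      - (((tau f x t)⁻¹ : ℝ) : 𝕜) * prim f ψ x t *
        ∑ j, ((φ j x t : ℝ) : 𝕜) * ((prim (φ j) f x t : ℝ) : 𝕜)
      + ((f x t : ℝ) : 𝕜) * (((tau f x t)⁻¹ : ℝ) : 𝕜) ^ 2 * prim f ψ x t *
        ∑ j, ((prim f (φ j) x t : ℝ) : 𝕜) ^ 2 := by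
  simp only [Finset.mul_sum, ← Finset.sum_sub_distrib, ← Finset.sum_add_distrib]
  refine Finset.sum_congr rfl fun j _ => ?_
  rw [h.seed.prim_binaryDarboux (h.source j) hψ.isSpectral (h.decay j) hd (hψ.decay j) hμ x ht,
    IsSeed.binaryDarboux_eq, prim_comm (φ j) f, div_eq_mul_inv]
  simp only [RCLike.real_smul_eq_coe_mul, RCLike.ofReal_real_eq_id, id]
  push_cast
  ring

theorem dT_binaryDarboux (h : IsSourceSeed T n α η lam u φ ξ f)
    (hf : IsLaxSolution T n α η u φ ξ f) (hψ : IsLaxSolution T n α η u φ μ ψ)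
    (hd : DecayingProduct T f ψ) (hμ : μ ≠ ξ) (x : ℝ) {t : ℝ} (ht : t ∈ T) :
    dT (binaryDarboux f ψ) x t =
      opM (binaryDarbouxPotential f u) μ (binaryDarboux f ψ) x t (n + 2) +
      η • binaryDarboux f ψ x t +
      α • ∑ j, binaryDarboux f (φ j) x t •
        prim (binaryDarboux f (φ j)) (binaryDarboux f ψ) x t := by
  have hT := h.seed.isOpen
  have hder := (hψ.smooth.hasDerivAt_t hT x ht).sub
    (((hf.smooth.hasDerivAt_t hT x ht).mul
      ((h.hasDerivAt_tau x ht).inv (h.seed.tau_pos x ht).ne')).smul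
      (h.hasDerivAt_prim hf hψ hd hμ x ht))
  have hfun : (fun s => binaryDarboux f ψ x s) =
      (fun s => ψ x s) - ((fun s => f x s) * (fun s => tau f x s)⁻¹) • fun s => prim f ψ x s :=
    funext fun s => IsSeed.binaryDarboux_eq f ψ x s
  rw [dT, hfun, hder.deriv, h.sum_binaryDarboux hψ hd hμ x ht,
    h.seed.opM_darboux hψ.isSpectral hd (n + 2) x ht, hψ.dT_eq x ht, hf.dT_eq x ht,
    IsSeed.binaryDarboux_eq, tauRate]
  have hτ := (h.seed.tau_pos x ht).ne'
  have hinv : tau f x t * (tau f x t)⁻¹ = 1 := mul_inv_cancel₀ hτ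
  have hinv' := congrArg (fun r : ℝ => (r : 𝕜)) hinv
  simp only [RCLike.real_smul_eq_coe_mul, smul_eq_mul, Pi.mul_apply, Pi.inv_apply, div_eq_mul_inv,
    ← inv_pow] at hinv' ⊢
  generalize (tau f x t)⁻¹ = s at hinv' ⊢
  push_cast at hinv' ⊢
  -- The local and the source terms match identically. Only the contribution 2ητ to τ_t requires τ s
  -- = 1.
  linear_combination (2 * (η : 𝕜) * ((f x t : ℝ) : 𝕜) * (s : 𝕜) * prim f ψ x t) * hinv'

theorem isLaxSolution_darboux (h : IsSourceSeed T n α η lam u φ ξ f)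
    (hf : IsLaxSolution T n α η u φ ξ f) (hψ : IsLaxSolution T n α η u φ μ ψ)
    (hd : DecayingProduct T f ψ) :
    IsLaxSolution T n α η (binaryDarbouxPotential f u) (fun j => binaryDarboux f (φ j)) μ
      (binaryDarboux f ψ) where
  smooth := h.seed.smooth_binaryDarboux h.smooth_tau hψ.isSpectral hd
  decay j := h.seed.decay_binaryDarboux (h.source j) hψ.isSpectral (h.decay j) hd (hψ.decay j)
  spectral x t ht := h.seed.spectral_binaryDarboux hψ.isSpectral hd x ht
  evolution x t ht := by
    -- At the eigenvalue of the seed the transform is identically zero on ℝ × T, and the evolution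
    -- equation is trivial.
    by_cases hμ : μ = ξ
    · subst hμ
      have h0 := fun y s hs => h.seed.binaryDarboux_eq_zero hψ.isSpectral hd y (t := s) hs
      have hT : (fun s => binaryDarboux f ψ x s) =ᶠ[𝓝 t] fun _ => 0 := by
        filter_upwards [h.seed.isOpen.mem_nhds ht] with s hs using h0 x s hs
      have hX : (fun y => binaryDarboux f ψ y t) = fun _ => 0 := funext fun y => h0 y t ht
      simp only [hT.deriv_eq, opA, opB, integralFromNegInf, h0 _ t ht, deriv_const, smul_zero,
        add_zero, mul_zero, integral_zero, Finset.sum_const_zero]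
    · rw [opA_eq_opM]
      exact h.dT_binaryDarboux hf hψ hd hμ x ht

/-- The transformed potential and sources solve the equation of the original ones. -/
theorem evolution_darboux (h : IsSourceSeed T n α η lam u φ ξ f)
    (hu : IsKdVSourceSolution T n α lam u φ) (x : ℝ) {t : ℝ} (ht : t ∈ T) :
    deriv (fun s => binaryDarbouxPotential f u x s) t =
      deriv (fun y => -2 * (bPoly (n + 2)).at (binaryDarbouxPotential f u) y t
        - 2 * α * ∑ j, binaryDarboux f (φ j) y t ^ 2) x := by
  have hT := h.seed.isOpen
  set ℓ : ℝ → ℝ → ℝ := fun x t => Real.log (tau f x t)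
  have hℓ : SmoothField T ℓ := ContDiffOn.log h.smooth_tau fun z hz =>
    (h.seed.tau_pos z.1 hz.2).ne'
  have hℓx := hℓ.dX hT
  have hU : ∀ s, binaryDarbouxPotential f u x s = u x s + 2 * dX (dX ℓ) x s := by
    intro s
    rw [binaryDarbouxPotential, iteratedDeriv_succ, iteratedDeriv_one]
    rfl
  have hswap : dT (dX (dX ℓ)) x t = dX (dX (dT ℓ)) x t := by
    rw [hℓx.dT_dX hT x ht]
    have : (fun y => dT (dX ℓ) y t) = fun y => dX (dT ℓ) y t :=
      funext fun y => hℓ.dT_dX hT y ht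
    simp only [dX] at this ⊢
    rw [this]
  -- The constant 2η disappears at the next x-derivative, so that η does not enter the equation for
  -- ū.
  have hLt : ∀ y, dT ℓ y t = thetaVal u ξ f (n + 2) y t * (tau f y t)⁻¹ + 2 * η +
      α * ∑ j, prim f (φ j) y t / tau f y t * prim f (φ j) y t := by
    intro y
    have hτ := (h.seed.tau_pos y ht).ne'
    have h1 : dT ℓ y t = tauRate n α η u φ ξ f y t / tau f y t :=
      ((h.hasDerivAt_tau y ht).log hτ).deriv
    rw [h1, tauRate, add_div, add_div, mul_div_assoc α, Finset.sum_div, mul_div_cancel_right₀ _ hτ,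
      div_eq_mul_inv]
    congr 3
    funext j
    ring
  have hLtx : ∀ y, dX (dT ℓ) y t = 2 * f y t * opM u ξ f y t (n + 2) * (tau f y t)⁻¹
      - thetaVal u ξ f (n + 2) y t * f y t ^ 2 * (tau f y t)⁻¹ ^ 2 +
      α * ∑ j, (φ j y t ^ 2 - binaryDarboux f (φ j) y t ^ 2) := by
    intro y
    rw [dX, funext hLt]
    refine HasDerivAt.deriv ((((((h.seed.hasDerivAt_theta (n + 2) y ht).mul
      ((h.seed.hasDerivAt_tau y ht).inv (h.seed.tau_pos y ht).ne')).add_const (2 * η))).add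
      ((HasDerivAt.fun_sum fun j (_ : j ∈ Finset.univ) => h.seed.hasDerivAt_prim_div_tau
        (h.source j) (h.source j) (h.decay j) (h.decay j) y ht).const_mul α)).congr_deriv ?_)
    simp only [smul_eq_mul, sq, Pi.inv_apply, div_eq_mul_inv, mul_inv]
    ring
  -- The transformed flux is the old one plus 2 ∂(ln τ)_t. Its derivative matches ū_t = u_t + 2 (∂²
  -- ln τ)_t once t- and x-derivatives are exchanged.
  have hRHS : (fun y => -2 * (bPoly (n + 2)).at (binaryDarbouxPotential f u) y t
        - 2 * α * ∑ j, binaryDarboux f (φ j) y t ^ 2) =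
      fun y => (-2 * (bPoly (n + 2)).at u y t - 2 * α * ∑ j, φ j y t ^ 2)
        + 2 * dX (dT ℓ) y t := by
    funext y
    rw [h.seed.bPoly_darboux (n + 2) y ht, hLtx, Finset.sum_sub_distrib]
    ring
  have hF : SmoothField T (fun y t => -2 * (bPoly (n + 2)).at u y t - 2 * α * ∑ j, φ j y t ^ 2) :=
    ((SmoothField.const (-2)).mul (DiffPoly.smooth_at h.seed.potential.smooth hT _)).sub
      ((SmoothField.const (2 * α)).mul (SmoothField.sum fun j _ =>
        ContDiffOn.pow (h.source j).smooth 2))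
  rw [hRHS, funext hU]
  have e1 := ((h.seed.potential.smooth.hasDerivAt_t hT x ht).add
    (((hℓx.dX hT).hasDerivAt_t hT x ht).const_mul 2)).deriv
  have e2 := ((hF.hasDerivAt_x hT x ht).add
    ((((hℓ.dT hT).dX hT).hasDerivAt_x hT x ht).const_mul 2)).deriv
  refine e1.trans (Eq.trans ?_ e2.symm)
  rw [hswap]
  congr 1
  exact hu.evolution x t ht

end IsSourceSeed

end

end KdVSources

/-! ### Both claims of the theorem -/

open KdVSources
theorem theorem4p2 {𝕜 : Type*} [RCLike 𝕜]
    (T : Set ℝ) (hT : IsOpen T) (n N : ℕ) (α η : ℝ) (lam : Fin N → ℝ)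
    (u : ℝ → ℝ → ℝ) (φ : Fin N → ℝ → ℝ → ℝ)
    (hu : IsKdVSourceSolution T n α lam u φ)
    (ξ₁ : ℝ) (f₁ : ℝ → ℝ → ℝ)
    (hf : IsLaxSolution T n α η u φ ξ₁ f₁)
    (hff : DecayingProduct T f₁ f₁)
    (hf0 : ∀ t ∈ T, ∃ x, f₁ x t ≠ 0) :
    (∀ (μ : 𝕜) (ψ : ℝ → ℝ → 𝕜),
      IsLaxSolution T n α η u φ μ ψ → DecayingProduct T f₁ ψ →
        IsLaxSolution T n α η (binaryDarbouxPotential f₁ u) (fun j => binaryDarboux f₁ (φ j))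
          μ (binaryDarboux f₁ ψ)) ∧
    IsKdVSourceSolution T n α lam (binaryDarbouxPotential f₁ u)
      (fun j => binaryDarboux f₁ (φ j)) := by
  have hφ : ∀ j, IsSpectral T u (lam j) (φ j) := fun j => ⟨hu.smooth_φ j, hu.source j⟩
  have h := IsSourceSeed.of_isLaxSolution ⟨hT, hu.smooth_u, hu.bounded_u⟩ hφ hf hff hf0
  have hp := h.seed.isPotential_darboux h.smooth_tau
  refine ⟨fun μ ψ hψ hd => h.isLaxSolution_darboux hf hψ hd, ?_⟩
  exact
    { smooth_u := hp.smooth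
      smooth_φ := fun j => h.seed.smooth_binaryDarboux h.smooth_tau (hφ j) (h.decay j)
      bounded_u := hp.bounded
      evolution := fun x t ht => h.evolution_darboux hu x ht
      source := fun j x t ht => h.seed.spectral_binaryDarboux (hφ j) (h.decay j) x ht }
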